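/- Let $\Sigma=\{z=0\}\subset\mathbb R^3$ and $S(x,y,z)=(-y,-x,-z)$. Let $\mathfrak X_S$ be the set of piecewise linear vector fields $Z=(X,Y)$, where $X$ (acting for $z\ge 0$) and $Y$ (acting for $z<0$) are polynomial vector fields of degree one such that: $DX$ and $DY$ each have a nonzero real eigenvalue and a pair of non-real conjugate eigenvalues; the tangency sets $\{p\in\Sigma: X_3(p)=0\}$ and $\{p\in\Sigma: Y_3(p)=0\}$ are lines meeting exactly at the origin; and $X\circ S=S\circ Y$ on $z\ge 0$. The crossing region is $\Sigma^c=\{p\in\Sigma: X_3(p)Y_3(p)>0\}$. Trajectories follow $X$ above and $Y$ below $\Sigma$, and pass from one to the other at points of $\Sigma^c$. A crossing symmetric periodic orbit is a periodic orbit $\gamma$ with $S(\gamma)=\gamma$ that meets $\Sigma$ in exactly two points, both in $\Sigma^c$. A symmetric limit cycle is such an orbit that is isolated among all periodic orbits. Asymptotic stability of a cycle means orbital asymptotic stability. **(a)** Let $Z\in\mathfrak X_S$, and let $(x_0,y_0,0)$ and $(x_1,y_1,0)$ be two successive points of intersection with $\Sigma$ of a trajectory of $Z$, both in $\Sigma^c$.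 The trajectory segment between them lies on a crossing symmetric periodic orbit of $Z$ if and only if $x_1=-y_0$ and $y_1=-x_0$. For real $A,C,H,\Lambda$ let $Z_{A,C,H,\Lambda}=(X,Y)$ be the canonical form $$X=\bigl(Ax-H(((A-C)^2+1)z-\Lambda),\ \Lambda-(1+C^2)z,\ 2Cz+y\bigr),$$ $$Y=\bigl(-\Lambda-(1+C^2)z,\ Ay-H(((A-C)^2+1)z+\Lambda),\ 2Cz+x\bigr),$$ with eigenvalues $A$ and $C\pm i$ of $DX$ and $DY$; for $\Lambda>0$ the fold lines of $X$ and $Y$ are both visible. Assume from now on the resonance $A=-2C$ with $C\ne0$ (the real eigenvalue is minus twice the real part of the complex pair), and write $Z_{C,H,\Lambda}=Z_{-2C,C,H,\Lambda}$. Then $Z_{C,H,\Lambda}\in\mathfrak X_S$ for all real $H,\Lambda$. Put $\overline H(C)=\dfrac{1}{2\cosh(\pi C)-1}$. There are points $\xi_\Lambda(C,H)$ such that the following two statements hold. **(b)** For all $\Lambda>0$ and $C\neq 0$, and for every $H<\overline H(C)$ sufficiently close to $\overline H(C)$, the point $\xi_\Lambda(C,H)$ lies in $\Sigma$ and on a symmetric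 limit cycle of $Z_{C,H,\Lambda}$; moreover $\|\xi_\Lambda(C,H)\|\to\infty$ as $H\to\overline H(C)^-$. In particular there are $Z\in\mathfrak X_S$ satisfying the resonance that have a symmetric limit cycle, of arbitrarily large amplitude. **(c)** There is a nonempty open subset $B$ of the $(C,H)$-plane, the stability region, which does not depend on $\Lambda$ and which for every $C>0$ contains $(C,H)$ for all $H<\overline H(C)$ sufficiently close to $\overline H(C)$, such that for every $\Lambda>0$ the map $\xi_\Lambda$ is continuous on $B$ and, for every $(C,H)\in B$, the point $\xi_\Lambda(C,H)$ lies in $\Sigma$ and on a symmetric limit cycle of $Z_{C,H,\Lambda}$ that is asymptotically stable. Since $B$ is open, the stability persists under small perturbations of $(C,H)$. -/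

import Mathlib

open Filter Topology
open scoped Matrix

namespace PWL

/-- Phase space `ℝ³`, with coordinates `x = p 0`, `y = p 1`, `z = p 2`. -/
abbrev R3 : Type := Fin 3 → ℝ

/-- A polynomial vector field of degree one on `ℝ³`: `p ↦ lin p + const`. -/
structure AffineField where
  lin : Matrix (Fin 3) (Fin 3) ℝ
  const : R3

/-- The value of the vector field at a point. -/
def AffineField.eval (X : AffineField) (p : R3) : R3 := X.lin *ᵥ p + X.const

/-- A piecewise linear vector field `Z = (X, Y)`: `X` acts where `z ≥ 0` and `Y` where `z < 0`. -/
structure PiecewiseField where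
  X : AffineField
  Y : AffineField

/-- The switching plane `z = 0`. -/
def switchingPlane : Set R3 := {p | p 2 = 0}

/-- The Lie derivative `Xf` of `f(x, y, z) = z` along `X`. -/
def lieZ (X : AffineField) (p : R3) : ℝ := X.eval p 2

/-- The crossing region of the switching plane. -/
def crossingRegion (Z : PiecewiseField) : Set R3 :=
  {p | p ∈ switchingPlane ∧ 0 < lieZ Z.X p * lieZ Z.Y p}

/-- The tangency set of `X` with the switching plane. -/
def tangencySet (X : AffineField) : Set R3 := {p | p ∈ switchingPlane ∧ lieZ X p = 0}

/-- The eigenvalues of `M` are the nonzero real number `a` and the nonreal pair `c ± i w`. -/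
def HasFocalSpectrum (M : Matrix (Fin 3) (Fin 3) ℝ) (a c w : ℝ) : Prop :=
  a ≠ 0 ∧ w ≠ 0 ∧
    spectrum ℂ (M.map (algebraMap ℝ ℂ)) =
      {(a : ℂ), (c : ℂ) + (w : ℂ) * Complex.I, (c : ℂ) - (w : ℂ) * Complex.I}

/-- The class of fields for which `DX` and `DY` each have one nonzero real eigenvalue and one
pair of nonreal conjugate eigenvalues. -/
def ClassL (Z : PiecewiseField) : Prop :=
  (∃ a c w, HasFocalSpectrum Z.X.lin a c w) ∧ (∃ a c w, HasFocalSpectrum Z.Y.lin a c w)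

/-- The subclass for which the tangency lines are concurrent at the origin. A tangency set is
cut out of the plane by one affine equation, so the condition says that both sets are lines
and that they meet exactly at the origin. -/
def ClassT (Z : PiecewiseField) : Prop :=
  ClassL Z ∧ tangencySet Z.X ∩ tangencySet Z.Y = {0}

/-- The involution `S(x, y, z) = (-y, -x, -z)`. -/
def invol (p : R3) : R3 := ![-p 1, -p 0, -p 2]

/-- The subclass of fields that are equivariant under the involution `S`. -/
def ClassS (Z : PiecewiseField) : Prop :=
  ClassT Z ∧ ∀ p : R3, 0 ≤ p 2 → Z.X.eval (invol p) = invol (Z.Y.eval p)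

/-- The real eigenvalue is minus twice the real part of the associated complex pair, for both
linear parts. -/
def IsResonant (Z : PiecewiseField) : Prop :=
  (∃ a c w, HasFocalSpectrum Z.X.lin a c w ∧ a = -2 * c) ∧
    (∃ a c w, HasFocalSpectrum Z.Y.lin a c w ∧ a = -2 * c)

/-- `φ` is a (crossing) trajectory of `Z` on the time interval `I`: it follows `X` above and `Y`
below the switching plane, it meets this plane only in the crossing region, and there it
switches from `Y` to `X` when it crosses upwards and from `X` to `Y` when it crosses
downwards. -/
def IsTrajectoryOn (Z : PiecewiseField) (φ : ℝ → R3) (I : Set ℝ) : Prop :=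
  ∀ t ∈ I,
    (0 < φ t 2 → HasDerivWithinAt φ (Z.X.eval (φ t)) I t) ∧
    (φ t 2 < 0 → HasDerivWithinAt φ (Z.Y.eval (φ t)) I t) ∧
    (φ t 2 = 0 →
      φ t ∈ crossingRegion Z ∧
      (0 < lieZ Z.X (φ t) →
        HasDerivWithinAt φ (Z.Y.eval (φ t)) (I ∩ Set.Iic t) t ∧
        HasDerivWithinAt φ (Z.X.eval (φ t)) (I ∩ Set.Ici t) t) ∧
      (lieZ Z.X (φ t) < 0 →
        HasDerivWithinAt φ (Z.X.eval (φ t)) (I ∩ Set.Iic t) t ∧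
        HasDerivWithinAt φ (Z.Y.eval (φ t)) (I ∩ Set.Ici t) t))

/-- The point set `γ` is a (nonconstant) periodic orbit of `Z`. -/
def IsPeriodicOrbit (Z : PiecewiseField) (γ : Set R3) : Prop :=
  ∃ (φ : ℝ → R3) (T : ℝ), 0 < T ∧ IsTrajectoryOn Z φ Set.univ ∧ Function.Periodic φ T ∧
    (∃ s t, φ s ≠ φ t) ∧ Set.range φ = γ

/-- A crossing symmetric periodic orbit: a periodic orbit that crosses the switching plane at
exactly two points and is invariant under `S`. -/
def IsCrossingSymmetricPeriodicOrbit (Z : PiecewiseField) (γ : Set R3) : Prop :=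
  IsPeriodicOrbit Z γ ∧ (∃ p q, p ≠ q ∧ γ ∩ switchingPlane = {p, q}) ∧ invol '' γ = γ

/-- A symmetric limit cycle: a crossing symmetric periodic orbit that is isolated among all
periodic orbits. -/
def IsSymmetricLimitCycle (Z : PiecewiseField) (γ : Set R3) : Prop :=
  IsCrossingSymmetricPeriodicOrbit Z γ ∧
    ∃ U : Set R3, IsOpen U ∧ γ ⊆ U ∧ ∀ γ', IsPeriodicOrbit Z γ' → γ' ⊆ U → γ' = γ

/-- Orbital asymptotic stability of `γ`: through every nearby point there is a trajectory defined
for all future times, every trajectory that starts near `γ` stays near `γ`, and its distance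
to `γ` tends to zero. -/
def IsAsymptoticallyStable (Z : PiecewiseField) (γ : Set R3) : Prop :=
  (∃ δ > 0, ∀ p : R3, Metric.infDist p γ < δ →
    ∃ φ : ℝ → R3, φ 0 = p ∧ IsTrajectoryOn Z φ (Set.Ici 0)) ∧
  (∀ ε > 0, ∃ δ > 0, ∀ φ : ℝ → R3, IsTrajectoryOn Z φ (Set.Ici 0) →
    Metric.infDist (φ 0) γ < δ → ∀ t, 0 ≤ t → Metric.infDist (φ t) γ < ε) ∧
  (∃ δ > 0, ∀ φ : ℝ → R3, IsTrajectoryOn Z φ (Set.Ici 0) →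
    Metric.infDist (φ 0) γ < δ → Tendsto (fun t => Metric.infDist (φ t) γ) atTop (𝓝 0))

/-- The canonical form of the equivariant class, with real eigenvalue `A`, complex pair `C ± i`,
inclination parameter `H` and second Lie derivative `Λ`:
`X = (A x - H (((A - C)² + 1) z - Λ), Λ - (1 + C²) z, 2 C z + y)` and
`Y = (-Λ - (1 + C²) z, A y - H (((A - C)² + 1) z + Λ), 2 C z + x)`. -/
def canonicalField (A C H Λ : ℝ) : PiecewiseField where
  X :=
    { lin := !![A, 0, -(H * ((A - C) ^ 2 + 1)); 0, 0, -(1 + C ^ 2); 0, 1, 2 * C]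
      const := ![H * Λ, Λ, 0] }
  Y :=
    { lin := !![0, 0, -(1 + C ^ 2); 0, A, -(H * ((A - C) ^ 2 + 1)); 1, 0, 2 * C]
      const := ![-Λ, -(H * Λ), 0] }

/-- The critical value `1 / (2 cosh (π C) - 1)` of the parameter `H`. -/
noncomputable def criticalH (C : ℝ) : ℝ := 1 / (2 * Real.cosh (Real.pi * C) - 1)

end PWL

namespace PWL

/-- Equivariance of a piecewise field under the involution, on the whole space. -/
def Equivariant (Z : PiecewiseField) : Prop := ∀ p, Z.X.eval (invol p) = invol (Z.Y.eval p)

/-- The condition that `IsTrajectoryOn` imposes at a single time. -/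
def IsTrajectoryAt (Z : PiecewiseField) (φ : ℝ → R3) (I : Set ℝ) (t : ℝ) : Prop :=
  (0 < φ t 2 → HasDerivWithinAt φ (Z.X.eval (φ t)) I t) ∧
    (φ t 2 < 0 → HasDerivWithinAt φ (Z.Y.eval (φ t)) I t) ∧
    (φ t 2 = 0 →
      φ t ∈ crossingRegion Z ∧
      (0 < lieZ Z.X (φ t) →
        HasDerivWithinAt φ (Z.Y.eval (φ t)) (I ∩ Set.Iic t) t ∧
        HasDerivWithinAt φ (Z.X.eval (φ t)) (I ∩ Set.Ici t) t) ∧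
      (lieZ Z.X (φ t) < 0 →
        HasDerivWithinAt φ (Z.X.eval (φ t)) (I ∩ Set.Iic t) t ∧
        HasDerivWithinAt φ (Z.Y.eval (φ t)) (I ∩ Set.Ici t) t))

@[simp] lemma invol_zero_coord (p : R3) : invol p 0 = -p 1 := rfl
@[simp] lemma invol_one_coord (p : R3) : invol p 1 = -p 0 := rfl
@[simp] lemma invol_two_coord (p : R3) : invol p 2 = -p 2 := rfl

@[simp] lemma invol_invol (p : R3) : invol (invol p) = p := by
  ext i; fin_cases i <;> simp

lemma invol_eq_iff {p q : R3} : invol p = q ↔ p = invol q :=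
  ⟨fun h => by rw [← h, invol_invol], fun h => by rw [h, invol_invol]⟩

lemma continuous_invol : Continuous invol := by
  refine continuous_pi fun i => ?_
  fin_cases i
  · exact (continuous_apply 1).neg
  · exact (continuous_apply 0).neg
  · exact (continuous_apply 2).neg

lemma dist_invol (p q : R3) : dist (invol p) (invol q) = dist p q := by
  have key : ∀ p q : R3, dist (invol p) (invol q) ≤ dist p q := by
    intro p q
    refine (dist_pi_le_iff dist_nonneg).2 fun i => ?_
    fin_cases i
    · simpa [dist_neg_neg] using dist_le_pi_dist p q 1
    · simpa [dist_neg_neg] using dist_le_pi_dist p q 0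
    · simpa [dist_neg_neg] using dist_le_pi_dist p q 2
  refine le_antisymm (key p q) ?_
  simpa using key (invol p) (invol q)

lemma isometry_invol : Isometry invol := Isometry.of_dist_eq dist_invol

lemma infDist_invol {γ : Set R3} (hγ : invol '' γ = γ) (p : R3) :
    Metric.infDist (invol p) γ = Metric.infDist p γ := by
  conv_lhs => rw [← hγ]
  exact Metric.infDist_image isometry_invol

lemma invol_mem_switchingPlane {p : R3} : invol p ∈ switchingPlane ↔ p ∈ switchingPlane := by
  simp [switchingPlane]

lemma hasDerivWithinAt_invol {φ : ℝ → R3} {v : R3} {I : Set ℝ} {t : ℝ}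
    (h : HasDerivWithinAt φ v I t) :
    HasDerivWithinAt (fun s => invol (φ s)) (invol v) I t := by
  rw [hasDerivWithinAt_pi] at h ⊢
  intro i
  fin_cases i
  · exact (h 1).neg
  · exact (h 0).neg
  · exact (h 2).neg

lemma AffineField.eval_coord (X : AffineField) (p : R3) (i : Fin 3) :
    X.eval p i = X.lin i 0 * p 0 + X.lin i 1 * p 1 + X.lin i 2 * p 2 + X.const i := by
  simp [AffineField.eval, Matrix.mulVec, dotProduct, Fin.sum_univ_three]

lemma AffineField.continuous_eval (X : AffineField) : Continuous X.eval := by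
  refine continuous_pi fun i => ?_
  simp only [AffineField.eval_coord]
  fun_prop

lemma continuous_lieZ (X : AffineField) : Continuous (lieZ X) :=
  (continuous_apply 2).comp X.continuous_eval

lemma ClassS.equivariant {Z : PiecewiseField} (h : ClassS Z) : Equivariant Z := by
  intro p
  have h1 := h.2 ![p 0, p 1, 0] (by simp)
  have h2 := h.2 ![p 0, p 1, 1] (by simp)
  ext i
  have e1 := congrFun h1 i
  have e2 := congrFun h2 i
  fin_cases i <;> simp [AffineField.eval_coord] at e1 e2 ⊢ <;>
    linear_combination e1 + p 2 * (e2 - e1)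

namespace Equivariant

variable {Z : PiecewiseField}

lemma eval_Y (h : Equivariant Z) (p : R3) : Z.Y.eval (invol p) = invol (Z.X.eval p) := by
  have := h (invol p)
  rw [invol_invol] at this
  rw [this, invol_invol]

lemma lieZ_X (h : Equivariant Z) (p : R3) : lieZ Z.X (invol p) = -lieZ Z.Y p := by
  simp [lieZ, h p]

lemma lieZ_Y (h : Equivariant Z) (p : R3) : lieZ Z.Y (invol p) = -lieZ Z.X p := by
  simp [lieZ, h.eval_Y p]

lemma invol_mem_crossingRegion (h : Equivariant Z) {p : R3} (hp : p ∈ crossingRegion Z) :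
    invol p ∈ crossingRegion Z := by
  refine ⟨invol_mem_switchingPlane.2 hp.1, ?_⟩
  rw [h.lieZ_X, h.lieZ_Y]
  linarith [hp.2, mul_comm (lieZ Z.X p) (lieZ Z.Y p)]

end Equivariant

namespace IsTrajectoryAt

variable {Z : PiecewiseField} {φ ψ : ℝ → R3} {I J : Set ℝ} {t : ℝ}

lemma mono (h : IsTrajectoryAt Z φ I t) (hJ : J ⊆ I) : IsTrajectoryAt Z φ J t := by
  obtain ⟨h1, h2, h3⟩ := h
  refine ⟨fun h => (h1 h).mono hJ, fun h => (h2 h).mono hJ, fun h => ?_⟩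
  obtain ⟨h4, h5, h6⟩ := h3 h
  have e1 : J ∩ Set.Iic t ⊆ I ∩ Set.Iic t := Set.inter_subset_inter_left _ hJ
  have e2 : J ∩ Set.Ici t ⊆ I ∩ Set.Ici t := Set.inter_subset_inter_left _ hJ
  exact ⟨h4, fun h => ⟨(h5 h).1.mono e1, (h5 h).2.mono e2⟩,
    fun h => ⟨(h6 h).1.mono e1, (h6 h).2.mono e2⟩⟩

lemma of_inter_nhds (hJ : J ∈ 𝓝 t) (h : IsTrajectoryAt Z φ (I ∩ J) t) :
    IsTrajectoryAt Z φ I t := by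
  obtain ⟨h1, h2, h3⟩ := h
  rw [Set.inter_right_comm, Set.inter_right_comm I J (Set.Ici t)] at h3
  simp only [hasDerivWithinAt_inter hJ] at h1 h2 h3
  exact ⟨h1, h2, h3⟩

lemma congr (h : IsTrajectoryAt Z φ I t) (he : Set.EqOn ψ φ I) (ht : t ∈ I) :
    IsTrajectoryAt Z ψ I t := by
  obtain ⟨h1, h2, h3⟩ := h
  have e := he ht
  have key : ∀ {v K}, K ⊆ I → HasDerivWithinAt φ v K t → HasDerivWithinAt ψ v K t :=
    fun hK hd => hd.congr (fun x hx => he (hK hx)) e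
  unfold IsTrajectoryAt
  rw [e]
  refine ⟨fun h => key subset_rfl (h1 h), fun h => key subset_rfl (h2 h), fun h => ?_⟩
  obtain ⟨h4, h5, h6⟩ := h3 h
  exact ⟨h4, fun h => ⟨key Set.inter_subset_left (h5 h).1, key Set.inter_subset_left (h5 h).2⟩,
    fun h => ⟨key Set.inter_subset_left (h6 h).1, key Set.inter_subset_left (h6 h).2⟩⟩

lemma union (h : IsTrajectoryAt Z φ (I ∩ Set.Iic t) t)
    (h' : IsTrajectoryAt Z φ (I ∩ Set.Ici t) t) : IsTrajectoryAt Z φ I t := by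
  have e : I = I ∩ Set.Iic t ∪ I ∩ Set.Ici t := by
    rw [← Set.inter_union_distrib_left, Set.Iic_union_Ici, Set.inter_univ]
  obtain ⟨h1, h2, h3⟩ := h
  obtain ⟨k1, k2, k3⟩ := h'
  refine ⟨fun h => ?_, fun h => ?_, fun h => ?_⟩
  · rw [e]; exact (h1 h).union (k1 h)
  · rw [e]; exact (h2 h).union (k2 h)
  · obtain ⟨h4, h5, h6⟩ := h3 h
    obtain ⟨-, k5, k6⟩ := k3 h
    simp only [Set.inter_assoc, Set.inter_self] at h5 h6 k5 k6
    exact ⟨h4, fun h => ⟨(h5 h).1, (k5 h).2⟩, fun h => ⟨(h6 h).1, (k6 h).2⟩⟩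

lemma continuousWithinAt (h : IsTrajectoryAt Z φ I t) : ContinuousWithinAt φ I t := by
  obtain ⟨h1, h2, h3⟩ := h
  rcases lt_trichotomy (φ t 2) 0 with h | h | h
  · exact (h2 h).continuousWithinAt
  · have e : I = I ∩ Set.Iic t ∪ I ∩ Set.Ici t := by
      rw [← Set.inter_union_distrib_left, Set.Iic_union_Ici, Set.inter_univ]
    obtain ⟨h4, h5, h6⟩ := h3 h
    have hne : lieZ Z.X (φ t) ≠ 0 := fun h0 => by simpa [h0] using h4.2
    rw [e]
    rcases lt_or_gt_of_ne hne with h | h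
    · exact (h6 h).1.continuousWithinAt.union (h6 h).2.continuousWithinAt
    · exact (h5 h).1.continuousWithinAt.union (h5 h).2.continuousWithinAt
  · exact (h1 h).continuousWithinAt

lemma comp_add {a : ℝ} (h : IsTrajectoryAt Z φ I (t + a)) :
    IsTrajectoryAt Z (fun s => φ (s + a)) ((· + a) ⁻¹' I) t := by
  have key : ∀ {v} {K L : Set ℝ}, Set.MapsTo (· + a) L K → HasDerivWithinAt φ v K (t + a) →
      HasDerivWithinAt (fun s => φ (s + a)) v L t := by
    intro v K L hL hd
    have := HasDerivWithinAt.scomp t hd ((hasDerivAt_id t).add_const a).hasDerivWithinAt hL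
    simpa [Function.comp_def] using this
  obtain ⟨h1, h2, h3⟩ := h
  have m0 : Set.MapsTo (· + a) ((· + a) ⁻¹' I) I := fun x hx => hx
  have m1 : Set.MapsTo (· + a) ((· + a) ⁻¹' I ∩ Set.Iic t) (I ∩ Set.Iic (t + a)) :=
    fun x hx => ⟨hx.1, by simpa using hx.2⟩
  have m2 : Set.MapsTo (· + a) ((· + a) ⁻¹' I ∩ Set.Ici t) (I ∩ Set.Ici (t + a)) :=
    fun x hx => ⟨hx.1, by simpa using hx.2⟩
  refine ⟨fun h => key m0 (h1 h), fun h => key m0 (h2 h), fun h => ?_⟩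
  obtain ⟨h4, h5, h6⟩ := h3 h
  exact ⟨h4, fun h => ⟨key m1 (h5 h).1, key m2 (h5 h).2⟩,
    fun h => ⟨key m1 (h6 h).1, key m2 (h6 h).2⟩⟩

lemma invol (hZ : Equivariant Z) (h : IsTrajectoryAt Z φ I t) :
    IsTrajectoryAt Z (fun s => invol (φ s)) I t := by
  obtain ⟨h1, h2, h3⟩ := h
  unfold IsTrajectoryAt
  simp only [invol_two_coord, Left.neg_pos_iff, Left.neg_neg_iff, neg_eq_zero, hZ _, hZ.eval_Y,
    hZ.lieZ_X]
  refine ⟨fun h => hasDerivWithinAt_invol (h2 h), fun h => hasDerivWithinAt_invol (h1 h),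
    fun h => ?_⟩
  obtain ⟨h4, h5, h6⟩ := h3 h
  refine ⟨hZ.invol_mem_crossingRegion h4, fun h => ?_, fun h => ?_⟩
  · have : lieZ Z.X (φ t) < 0 := by
      by_contra hc
      nlinarith [h4.2]
    exact ⟨hasDerivWithinAt_invol (h6 this).1, hasDerivWithinAt_invol (h6 this).2⟩
  · have : 0 < lieZ Z.X (φ t) := by
      by_contra hc
      nlinarith [h4.2]
    exact ⟨hasDerivWithinAt_invol (h5 this).1, hasDerivWithinAt_invol (h5 this).2⟩

end IsTrajectoryAt

namespace IsTrajectoryOn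

variable {Z : PiecewiseField} {φ ψ : ℝ → R3} {I J : Set ℝ}

lemma mono (h : IsTrajectoryOn Z φ I) (hJ : J ⊆ I) : IsTrajectoryOn Z φ J :=
  fun t ht => IsTrajectoryAt.mono (h t (hJ ht)) hJ

lemma congr (h : IsTrajectoryOn Z φ I) (he : Set.EqOn ψ φ I) : IsTrajectoryOn Z ψ I :=
  fun t ht => IsTrajectoryAt.congr (h t ht) he ht

lemma of_forall_nhds (h : ∀ t ∈ I, ∃ J ∈ 𝓝 t, IsTrajectoryOn Z φ (I ∩ J)) :
    IsTrajectoryOn Z φ I := by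
  intro t ht
  obtain ⟨J, hJ, h⟩ := h t ht
  exact IsTrajectoryAt.of_inter_nhds hJ (h t ⟨ht, mem_of_mem_nhds hJ⟩)

lemma union (a : ℝ) (h : IsTrajectoryOn Z φ (I ∩ Set.Iic a))
    (h' : IsTrajectoryOn Z φ (I ∩ Set.Ici a)) : IsTrajectoryOn Z φ I := by
  intro t ht
  rcases lt_trichotomy t a with hta | rfl | hta
  · exact IsTrajectoryAt.of_inter_nhds (Iic_mem_nhds hta) (h t ⟨ht, hta.le⟩)
  · exact IsTrajectoryAt.union (h t ⟨ht, Set.self_mem_Iic⟩) (h' t ⟨ht, Set.self_mem_Ici⟩)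
  · exact IsTrajectoryAt.of_inter_nhds (Ici_mem_nhds hta) (h' t ⟨ht, hta.le⟩)

lemma continuousOn (h : IsTrajectoryOn Z φ I) : ContinuousOn φ I :=
  fun t ht => IsTrajectoryAt.continuousWithinAt (h t ht)

lemma comp_add (a : ℝ) (h : IsTrajectoryOn Z φ I) :
    IsTrajectoryOn Z (fun s => φ (s + a)) ((· + a) ⁻¹' I) :=
  fun t ht => IsTrajectoryAt.comp_add (h (t + a) ht)

lemma shift_Ici {a : ℝ} (ha : 0 ≤ a) (h : IsTrajectoryOn Z φ (Set.Ici 0)) :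
    IsTrajectoryOn Z (fun s => φ (s + a)) (Set.Ici 0) :=
  (h.comp_add a).mono fun t ht => by
    simp only [Set.mem_preimage, Set.mem_Ici] at ht ⊢; linarith

lemma invol (hZ : Equivariant Z) (h : IsTrajectoryOn Z φ I) :
    IsTrajectoryOn Z (fun s => invol (φ s)) I :=
  fun t ht => IsTrajectoryAt.invol hZ (h t ht)

end IsTrajectoryOn

lemma eventually_pos_right_of_hasDerivWithinAt {f : ℝ → ℝ} {d a : ℝ} {s : Set ℝ}
    (hs : s ∈ 𝓝[>] a) (h : HasDerivWithinAt f d s a) (ha : f a = 0) (hd : 0 < d) :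
    ∀ᶠ t in 𝓝[>] a, 0 < f t := by
  have h1 : HasDerivWithinAt f d (s ∩ Set.Ioi a) a := h.mono Set.inter_subset_left
  rw [hasDerivWithinAt_iff_tendsto_slope' (by simp)] at h1
  have h2 : 𝓝[s ∩ Set.Ioi a] a = 𝓝[>] a := by
    rw [Set.inter_comm, nhdsWithin_inter_of_mem' hs]
  rw [h2] at h1
  filter_upwards [h1.eventually (lt_mem_nhds hd), self_mem_nhdsWithin] with t ht hta
  have hta' : 0 < t - a := sub_pos.2 hta
  rw [slope_def_field, ha, sub_zero] at ht
  exact (div_pos_iff_of_pos_right hta').1 ht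

lemma eventually_neg_left_of_hasDerivWithinAt {f : ℝ → ℝ} {d a : ℝ} {s : Set ℝ}
    (hs : s ∈ 𝓝[<] a) (h : HasDerivWithinAt f d s a) (ha : f a = 0) (hd : 0 < d) :
    ∀ᶠ t in 𝓝[<] a, f t < 0 := by
  have h1 : HasDerivWithinAt f d (s ∩ Set.Iio a) a := h.mono Set.inter_subset_left
  rw [hasDerivWithinAt_iff_tendsto_slope' (by simp)] at h1
  have h2 : 𝓝[s ∩ Set.Iio a] a = 𝓝[<] a := by
    rw [Set.inter_comm, nhdsWithin_inter_of_mem' hs]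
  rw [h2] at h1
  filter_upwards [h1.eventually (lt_mem_nhds hd), self_mem_nhdsWithin] with t ht hta
  have hta' : t - a < 0 := sub_neg.2 hta
  rw [slope_def_field, ha, sub_zero] at ht
  by_contra hc
  exact absurd ht (not_lt.2 (div_nonpos_of_nonneg_of_nonpos (not_lt.1 hc) hta'.le))

lemma pos_on_Ioo_of_ne_zero {f : ℝ → ℝ} {a b : ℝ} (hf : ContinuousOn f (Set.Ioo a b))
    (hne : ∀ t ∈ Set.Ioo a b, f t ≠ 0) {c : ℝ} (hc : c ∈ Set.Ioo a b) (hfc : 0 < f c) :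
    ∀ t ∈ Set.Ioo a b, 0 < f t := by
  intro t ht
  by_contra hcon
  have hlt : f t < 0 := lt_of_le_of_ne (not_lt.1 hcon) (hne t ht)
  obtain ⟨s, hs, hs0⟩ :=
    isPreconnected_Ioo.intermediate_value ht hc hf ⟨hlt.le, hfc.le⟩
  exact hne s hs hs0

variable {Z : PiecewiseField} {φ : ℝ → R3}

lemma hasDerivWithinAt_height {v : R3} {I : Set ℝ} {t : ℝ} (h : HasDerivWithinAt φ v I t) :
    HasDerivWithinAt (fun s => φ s 2) (v 2) I t := (hasDerivWithinAt_pi.1 h) 2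

lemma lieZ_X_ne_zero {p : R3} (hp : p ∈ crossingRegion Z) : lieZ Z.X p ≠ 0 :=
  fun h0 => by simpa [h0] using hp.2

lemma lieZ_Y_pos_of_crossing {p : R3} (hp : p ∈ crossingRegion Z) (h : 0 < lieZ Z.X p) :
    0 < lieZ Z.Y p := (pos_iff_pos_of_mul_pos hp.2).1 h

/-- After an upward crossing, a trajectory stays above the switching plane until it crosses it
downwards. -/
lemma IsTrajectoryOn.height_pos {t₀ t₁ : ℝ} (ht : t₀ < t₁)
    (h : IsTrajectoryOn Z φ (Set.Icc t₀ t₁)) (h0 : φ t₀ ∈ switchingPlane)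
    (hX : 0 < lieZ Z.X (φ t₀)) (hne : ∀ t ∈ Set.Ioo t₀ t₁, φ t ∉ switchingPlane) :
    (∀ t ∈ Set.Ioo t₀ t₁, 0 < φ t 2) ∧ (φ t₁ ∈ switchingPlane → lieZ Z.X (φ t₁) < 0) := by
  have hd := hasDerivWithinAt_height
    (((h t₀ (Set.left_mem_Icc.2 ht.le)).2.2 h0).2.1 hX).2
  have hnear : ∀ᶠ t in 𝓝[>] t₀, 0 < φ t 2 :=
    eventually_pos_right_of_hasDerivWithinAt
      (inter_mem (Icc_mem_nhdsGT ht) (mem_of_superset self_mem_nhdsWithin Set.Ioi_subset_Ici_self))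
      hd h0 hX
  obtain ⟨c, hc, hct⟩ := (hnear.and (Ioo_mem_nhdsGT ht)).exists
  have hcont : ContinuousOn (fun t => φ t 2) (Set.Ioo t₀ t₁) :=
    (continuous_apply 2).comp_continuousOn (h.continuousOn.mono Set.Ioo_subset_Icc_self)
  have hpos := pos_on_Ioo_of_ne_zero hcont hne hct hc
  refine ⟨hpos, fun h1 => ?_⟩
  have h2 := (h t₁ (Set.right_mem_Icc.2 ht.le)).2.2 h1
  by_contra hcon
  have hX1 : 0 < lieZ Z.X (φ t₁) :=
    lt_of_le_of_ne (not_lt.1 hcon) (lieZ_X_ne_zero h2.1).symm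
  have hY1 := lieZ_Y_pos_of_crossing h2.1 hX1
  have hneg : ∀ᶠ t in 𝓝[<] t₁, φ t 2 < 0 :=
    eventually_neg_left_of_hasDerivWithinAt
      (inter_mem (Icc_mem_nhdsLT ht) (mem_of_superset self_mem_nhdsWithin Set.Iio_subset_Iic_self))
      (hasDerivWithinAt_height (h2.2.1 hX1).1) h1 hY1
  obtain ⟨c, hc, hct⟩ := (hneg.and (Ioo_mem_nhdsLT ht)).exists
  exact lt_asymm hc (hpos c hct)

/-- The direction of crossing is reversed between two successive crossings. -/
lemma IsTrajectoryOn.endpoints_ne (hZ : Equivariant Z) {t₀ t₁ : ℝ} (ht : t₀ < t₁)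
    (h : IsTrajectoryOn Z φ (Set.Icc t₀ t₁)) (h0 : φ t₀ ∈ switchingPlane)
    (h1 : φ t₁ ∈ switchingPlane) (hne : ∀ t ∈ Set.Ioo t₀ t₁, φ t ∉ switchingPlane) :
    φ t₁ ≠ φ t₀ := by
  have hcr := ((h t₀ (Set.left_mem_Icc.2 ht.le)).2.2 h0).1
  rcases lt_or_gt_of_ne (lieZ_X_ne_zero hcr) with hX | hX
  · intro he
    have hY : lieZ Z.Y (φ t₀) < 0 := (neg_iff_neg_of_mul_pos hcr.2).1 hX
    have := ((h.invol hZ).height_pos ht (invol_mem_switchingPlane.2 h0)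
      (by rw [hZ.lieZ_X]; linarith)
      (fun t ht' hm => hne t ht' (invol_mem_switchingPlane.1 hm))).2 (invol_mem_switchingPlane.2 h1)
    rw [hZ.lieZ_X, he] at this
    linarith
  · intro he
    have := (h.height_pos ht h0 hX hne).2 h1
    rw [he] at this
    linarith

lemma invol_ne_of_crossing (hZ : Equivariant Z) {p : R3} (hp : p ∈ crossingRegion Z) :
    invol p ≠ p := by
  intro he
  have := hZ.lieZ_X p
  rw [he] at this
  have h2 := hp.2
  rw [this] at h2
  nlinarith [sq_nonneg (lieZ Z.Y p)]

open Classical in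
/-- The extension of a segment on `[0, τ]` to the whole line by `φ (t + τ) = S (φ t)`. -/
noncomputable def symmetricExtension (φ : ℝ → R3) (τ t : ℝ) : R3 :=
  if Even ⌊t / τ⌋ then φ (t - ⌊t / τ⌋ * τ) else invol (φ (t - ⌊t / τ⌋ * τ))

section Extension

variable {τ : ℝ}

lemma symmetricExtension_add (hτ : 0 < τ) (t : ℝ) :
    symmetricExtension φ τ (t + τ) = invol (symmetricExtension φ τ t) := by
  have e : ⌊(t + τ) / τ⌋ = ⌊t / τ⌋ + 1 := by
    rw [add_div, div_self hτ.ne', Int.floor_add_one]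
  have e2 : t + τ - ((⌊t / τ⌋ + 1 : ℤ) : ℝ) * τ = t - ⌊t / τ⌋ * τ := by push_cast; ring
  unfold symmetricExtension
  rw [e, e2]
  by_cases h : Even ⌊t / τ⌋
  · have h' : ¬Even (⌊t / τ⌋ + 1) := by rw [Int.even_add_one]; exact not_not.2 h
    rw [if_pos h, if_neg h']
  · have h' : Even (⌊t / τ⌋ + 1) := by rw [Int.even_add_one]; exact h
    rw [if_neg h, if_pos h', invol_invol]

lemma symmetricExtension_eqOn (hτ : 0 < τ) (hφ : φ τ = invol (φ 0)) :
    Set.EqOn (symmetricExtension φ τ) φ (Set.Icc 0 τ) := by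
  have key : ∀ t, 0 ≤ t → t < τ → symmetricExtension φ τ t = φ t := by
    intro t h0 h1
    have e : ⌊t / τ⌋ = 0 := by
      rw [Int.floor_eq_zero_iff]
      exact ⟨by positivity, (div_lt_one hτ).2 h1⟩
    simp [symmetricExtension, e]
  intro t ht
  rcases lt_or_eq_of_le ht.2 with h | h
  · exact key t ht.1 h
  · have := symmetricExtension_add (φ := φ) hτ 0
    rw [zero_add, key 0 le_rfl hτ, ← hφ] at this
    rw [h, this]

lemma symmetricExtension_periodic (hτ : 0 < τ) :
    Function.Periodic (symmetricExtension φ τ) (2 * τ) := by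
  intro t
  rw [two_mul, ← add_assoc, symmetricExtension_add hτ, symmetricExtension_add hτ, invol_invol]

lemma range_symmetricExtension (hτ : 0 < τ) (hφ : φ τ = invol (φ 0)) :
    Set.range (symmetricExtension φ τ) =
      φ '' Set.Icc 0 τ ∪ invol '' (φ '' Set.Icc 0 τ) := by
  have heq := symmetricExtension_eqOn hτ hφ
  apply Set.Subset.antisymm
  · rintro _ ⟨t, rfl⟩
    have h0 : 0 ≤ t - ⌊t / τ⌋ * τ := by
      have := (le_div_iff₀ hτ).1 (Int.floor_le (t / τ)); linarith
    have h1 : t - ⌊t / τ⌋ * τ ≤ τ := by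
      have := (div_lt_iff₀ hτ).1 (Int.lt_floor_add_one (t / τ)); linarith
    unfold symmetricExtension
    split_ifs
    · exact Or.inl ⟨_, ⟨h0, h1⟩, rfl⟩
    · exact Or.inr ⟨_, ⟨_, ⟨h0, h1⟩, rfl⟩, rfl⟩
  · rintro _ (⟨t, ht, rfl⟩ | ⟨_, ⟨t, ht, rfl⟩, rfl⟩)
    · exact ⟨t, heq ht⟩
    · exact ⟨t + τ, by rw [symmetricExtension_add hτ, heq ht]⟩

lemma isTrajectoryOn_symmetricExtension (hZ : Equivariant Z) (hτ : 0 < τ)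
    (hφ : φ τ = invol (φ 0)) (h : IsTrajectoryOn Z φ (Set.Icc 0 τ)) :
    IsTrajectoryOn Z (symmetricExtension φ τ) Set.univ := by
  set ψ := symmetricExtension φ τ
  have h0 : IsTrajectoryOn Z ψ (Set.Icc 0 τ) := h.congr (symmetricExtension_eqOn hτ hφ)
  have step : ∀ n : ℤ, IsTrajectoryOn Z ψ (Set.Icc (n * τ) (n * τ + τ)) := by
    intro n
    induction n using Int.induction_on with
    | zero => simpa using h0
    | succ n ih =>
      have h1 := (ih.comp_add (-τ)).invol hZ
      refine (h1.mono ?_).congr ?_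
      · intro t ht
        push_cast at ht ⊢
        simp only [Set.mem_Icc, Set.mem_preimage] at ht ⊢
        constructor <;> linarith [ht.1, ht.2]
      · intro t _
        have := symmetricExtension_add (φ := φ) hτ (t + -τ)
        rw [neg_add_cancel_right] at this
        exact this
    | pred n ih =>
      have h1 := (ih.comp_add τ).invol hZ
      refine (h1.mono ?_).congr ?_
      · intro t ht
        push_cast at ht ⊢
        simp only [Set.mem_Icc, Set.mem_preimage] at ht ⊢
        constructor <;> linarith [ht.1, ht.2]
      · intro t _
        have := symmetricExtension_add (φ := φ) hτ t
        change ψ t = PWL.invol (symmetricExtension φ τ (t + τ))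
        rw [this, invol_invol]
  refine IsTrajectoryOn.of_forall_nhds fun t _ => ?_
  set n := ⌊t / τ⌋
  have h1 : n * τ ≤ t := (le_div_iff₀ hτ).1 (Int.floor_le (t / τ))
  have h2 : t < n * τ + τ := by
    have := (div_lt_iff₀ hτ).1 (Int.lt_floor_add_one (t / τ)); linarith
  refine ⟨Set.Icc (n * τ - τ) (n * τ + τ), Icc_mem_nhds (by linarith) h2, ?_⟩
  rw [Set.univ_inter]
  refine IsTrajectoryOn.union (n * τ) ((step (n - 1)).mono ?_) ((step n).mono ?_)
  · rintro s ⟨⟨hs, -⟩, hs'⟩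
    simp only [Set.mem_Iic] at hs'
    push_cast
    constructor <;> linarith
  · rintro s ⟨⟨-, hs⟩, hs'⟩
    exact ⟨hs', hs⟩

/-- A segment between two successive crossings whose endpoints are exchanged by `S` generates
a crossing symmetric periodic orbit. -/
theorem isCrossingSymmetricPeriodicOrbit_of_segment (hZ : Equivariant Z) (hτ : 0 < τ)
    (hφ : φ τ = invol (φ 0)) (h : IsTrajectoryOn Z φ (Set.Icc 0 τ)) (h0 : φ 0 ∈ switchingPlane)
    (hne : ∀ t ∈ Set.Ioo 0 τ, φ t ∉ switchingPlane) :
    IsCrossingSymmetricPeriodicOrbit Z (φ '' Set.Icc 0 τ ∪ invol '' (φ '' Set.Icc 0 τ)) ∧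
    (φ '' Set.Icc 0 τ ∪ invol '' (φ '' Set.Icc 0 τ)) ∩ switchingPlane =
      {φ 0, invol (φ 0)} := by
  have hcr := ((h 0 (Set.left_mem_Icc.2 hτ.le)).2.2 h0).1
  have hpq := invol_ne_of_crossing hZ hcr
  have hinter : (φ '' Set.Icc 0 τ ∪ invol '' (φ '' Set.Icc 0 τ)) ∩ switchingPlane =
      {φ 0, invol (φ 0)} := by
    have key : ∀ t ∈ Set.Icc 0 τ, φ t ∈ switchingPlane → φ t = φ 0 ∨ φ t = invol (φ 0) := by
      intro t ht hs
      rcases eq_or_lt_of_le ht.1 with h1 | h1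
      · exact Or.inl (by rw [h1])
      · rcases eq_or_lt_of_le ht.2 with h2 | h2
        · exact Or.inr (by rw [h2, hφ])
        · exact absurd hs (hne t ⟨h1, h2⟩)
    ext p
    constructor
    · rintro ⟨⟨t, ht, rfl⟩ | ⟨_, ⟨t, ht, rfl⟩, rfl⟩, hs⟩
      · exact key t ht hs
      · rcases key t ht (invol_mem_switchingPlane.1 hs) with h1 | h1
        · exact Or.inr (by rw [h1]; rfl)
        · exact Or.inl (by rw [h1, invol_invol])
    · have hm : φ 0 ∈ φ '' Set.Icc 0 τ := ⟨0, Set.left_mem_Icc.2 hτ.le, rfl⟩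
      rintro (rfl | rfl)
      · exact ⟨Or.inl hm, h0⟩
      · exact ⟨Or.inr ⟨_, hm, rfl⟩, invol_mem_switchingPlane.2 h0⟩
  refine ⟨⟨⟨symmetricExtension φ τ, 2 * τ, by linarith,
    isTrajectoryOn_symmetricExtension hZ hτ hφ h, symmetricExtension_periodic hτ, ⟨τ, 0, ?_⟩,
    range_symmetricExtension hτ hφ⟩, ⟨φ 0, invol (φ 0), hpq.symm, hinter⟩, ?_⟩, hinter⟩
  · have heq := symmetricExtension_eqOn hτ hφ
    rw [heq (Set.left_mem_Icc.2 hτ.le), heq (Set.right_mem_Icc.2 hτ.le), hφ]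
    exact hpq
  · rw [Set.image_union, ← Set.image_comp invol invol]
    have : invol ∘ invol = id := funext invol_invol
    rw [this, Set.image_id, Set.union_comm]

end Extension

/-- Successive crossings on a crossing symmetric periodic orbit are exchanged by `S`. -/
theorem mem_crossingSymmetricPeriodicOrbit_iff (hZ : Equivariant Z) {t₀ t₁ : ℝ} (ht : t₀ < t₁)
    (h : IsTrajectoryOn Z φ (Set.Icc t₀ t₁)) (h0 : φ t₀ ∈ switchingPlane)
    (h1 : φ t₁ ∈ switchingPlane) (hne : ∀ t ∈ Set.Ioo t₀ t₁, φ t ∉ switchingPlane) :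
    (∃ γ, IsCrossingSymmetricPeriodicOrbit Z γ ∧ φ '' Set.Icc t₀ t₁ ⊆ γ) ↔
      φ t₁ = invol (φ t₀) := by
  have l0 := Set.left_mem_Icc.2 ht.le
  have l1 := Set.right_mem_Icc.2 ht.le
  have hcr := ((h t₀ l0).2.2 h0).1
  constructor
  · rintro ⟨γ, ⟨-, ⟨p, q, -, hγ⟩, hS⟩, hsub⟩
    have m0 : φ t₀ ∈ γ := hsub ⟨_, l0, rfl⟩
    have m1 : φ t₁ ∈ γ := hsub ⟨_, l1, rfl⟩
    have mS : invol (φ t₀) ∈ γ := by rw [← hS]; exact ⟨_, m0, rfl⟩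
    have e0 : φ t₀ ∈ ({p, q} : Set R3) := hγ ▸ ⟨m0, h0⟩
    have e1 : φ t₁ ∈ ({p, q} : Set R3) := hγ ▸ ⟨m1, h1⟩
    have eS : invol (φ t₀) ∈ ({p, q} : Set R3) := hγ ▸ ⟨mS, invol_mem_switchingPlane.2 h0⟩
    have n1 := h.endpoints_ne hZ ht h0 h1 hne
    have n2 := invol_ne_of_crossing hZ hcr
    rcases e0 with e0 | e0 <;> rcases e1 with e1 | e1 <;> rcases eS with eS | eS <;>
      simp_all
  · intro he
    have hτ : 0 < t₁ - t₀ := sub_pos.2 ht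
    have htraj : IsTrajectoryOn Z (fun s => φ (s + t₀)) (Set.Icc 0 (t₁ - t₀)) :=
      (h.comp_add t₀).mono fun s hs => ⟨by linarith [hs.1], by linarith [hs.2]⟩
    refine ⟨_, (isCrossingSymmetricPeriodicOrbit_of_segment hZ hτ (by simpa using he) htraj
      (by simpa using h0) fun s hs => hne _ ⟨by linarith [hs.1], by linarith [hs.2]⟩).1, ?_⟩
    rintro _ ⟨t, ht, rfl⟩
    exact Or.inl ⟨t - t₀, ⟨by linarith [ht.1], by linarith [ht.2]⟩, by simp⟩

/-- The time-reversing symmetry `(x, y, z) ↦ (-x, -y, z)`. -/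
def reversal (p : R3) : R3 := ![-p 0, -p 1, p 2]

@[simp] lemma reversal_zero_coord (p : R3) : reversal p 0 = -p 0 := rfl
@[simp] lemma reversal_one_coord (p : R3) : reversal p 1 = -p 1 := rfl
@[simp] lemma reversal_two_coord (p : R3) : reversal p 2 = p 2 := rfl

@[simp] lemma reversal_reversal (p : R3) : reversal (reversal p) = p := by
  ext i; fin_cases i <;> simp

lemma reversal_invol (p : R3) : reversal (invol p) = invol (reversal p) := by
  ext i; fin_cases i <;> simp

lemma continuous_reversal : Continuous reversal := by
  refine continuous_pi fun i => ?_
  fin_cases i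
  · exact (continuous_apply 0).neg
  · exact (continuous_apply 1).neg
  · exact continuous_apply 2

lemma reversal_image_reversal_image (γ : Set R3) : reversal '' (reversal '' γ) = γ := by
  rw [← Set.image_comp, show reversal ∘ reversal = id from funext reversal_reversal, Set.image_id]

lemma norm_reversal (p : R3) : ‖reversal p‖ = ‖p‖ := by
  have key : ∀ p : R3, ‖reversal p‖ ≤ ‖p‖ := by
    intro p
    refine (pi_norm_le_iff_of_nonneg (norm_nonneg _)).2 fun i => ?_
    fin_cases i
    · simpa using norm_le_pi_norm p 0
    · simpa using norm_le_pi_norm p 1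
    · simpa using norm_le_pi_norm p 2
  refine le_antisymm (key p) ?_
  simpa using key (reversal p)

/-- The relation that one piecewise field is the time reversal of another one. -/
def IsReversalOf (Z' Z : PiecewiseField) : Prop :=
  ∀ p, Z'.X.eval (reversal p) = -reversal (Z.X.eval p) ∧
    Z'.Y.eval (reversal p) = -reversal (Z.Y.eval p)

lemma hasDerivWithinAt_reversal {φ : ℝ → R3} {v : R3} {I J : Set ℝ} {t : ℝ}
    (h : HasDerivWithinAt φ v I (-t)) (hJ : Set.MapsTo Neg.neg J I) :
    HasDerivWithinAt (fun s => reversal (φ (-s))) (-reversal v) J t := by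
  have h1 : HasDerivWithinAt (fun s => φ (-s)) (-v) J t := by
    have := HasDerivWithinAt.scomp t h (hasDerivAt_neg t).hasDerivWithinAt hJ
    rw [neg_smul, one_smul] at this
    exact this
  rw [hasDerivWithinAt_pi] at h1 ⊢
  intro i
  fin_cases i
  · exact (h1 0).neg
  · exact (h1 1).neg
  · exact h1 2

namespace IsReversalOf

variable {Z Z' : PiecewiseField}

lemma symm (h : IsReversalOf Z' Z) : IsReversalOf Z Z' := by
  have key : ∀ p v : R3, v = -reversal p → p = -reversal v := by
    rintro p _ rfl
    ext i; fin_cases i <;> simp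
  intro p
  have := h (reversal p)
  rw [reversal_reversal] at this
  exact ⟨key _ _ this.1, key _ _ this.2⟩

lemma lieZ_X (h : IsReversalOf Z' Z) (p : R3) : lieZ Z'.X (reversal p) = -lieZ Z.X p := by
  simp [lieZ, (h p).1]

lemma lieZ_Y (h : IsReversalOf Z' Z) (p : R3) : lieZ Z'.Y (reversal p) = -lieZ Z.Y p := by
  simp [lieZ, (h p).2]

lemma isTrajectoryOn (h : IsReversalOf Z' Z) {φ : ℝ → R3} (hφ : IsTrajectoryOn Z φ Set.univ) :
    IsTrajectoryOn Z' (fun t => reversal (φ (-t))) Set.univ := by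
  intro t _
  obtain ⟨h1, h2, h3⟩ := hφ (-t) trivial
  simp only [reversal_two_coord, h.lieZ_X, (h _).1, (h _).2, Left.neg_pos_iff, Left.neg_neg_iff]
  have m1 : Set.MapsTo Neg.neg (Set.univ ∩ Set.Iic t) (Set.univ ∩ Set.Ici (-t)) :=
    fun s hs => ⟨trivial, by simpa using hs.2⟩
  have m2 : Set.MapsTo Neg.neg (Set.univ ∩ Set.Ici t) (Set.univ ∩ Set.Iic (-t)) :=
    fun s hs => ⟨trivial, by simpa using hs.2⟩
  refine ⟨fun h => hasDerivWithinAt_reversal (h1 h) (Set.mapsTo_univ _ _),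
    fun h => hasDerivWithinAt_reversal (h2 h) (Set.mapsTo_univ _ _), fun h0 => ?_⟩
  obtain ⟨h4, h5, h6⟩ := h3 h0
  refine ⟨⟨h0, ?_⟩, fun hl => ?_, fun hl => ?_⟩
  · rw [h.lieZ_X, h.lieZ_Y, neg_mul_neg]
    exact h4.2
  · exact ⟨hasDerivWithinAt_reversal (h6 hl).2 m1, hasDerivWithinAt_reversal (h6 hl).1 m2⟩
  · exact ⟨hasDerivWithinAt_reversal (h5 hl).2 m1, hasDerivWithinAt_reversal (h5 hl).1 m2⟩

lemma isPeriodicOrbit (h : IsReversalOf Z' Z) {γ : Set R3} (hγ : IsPeriodicOrbit Z γ) :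
    IsPeriodicOrbit Z' (reversal '' γ) := by
  obtain ⟨φ, T, hT, hφ, hper, ⟨s, t, hst⟩, rfl⟩ := hγ
  refine ⟨fun t => reversal (φ (-t)), T, hT, h.isTrajectoryOn hφ, fun t => ?_, ⟨-s, -t, ?_⟩, ?_⟩
  · simp only [neg_add]
    rw [← sub_eq_add_neg, hper.sub_eq]
  · simp only [neg_neg]
    exact fun he => hst (Function.LeftInverse.injective reversal_reversal he)
  · ext p
    constructor
    · rintro ⟨t, rfl⟩; exact ⟨_, ⟨-t, rfl⟩, rfl⟩
    · rintro ⟨_, ⟨t, rfl⟩, rfl⟩; exact ⟨-t, by simp⟩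

/-- Symmetric limit cycles correspond to each other under time reversal. -/
theorem isSymmetricLimitCycle (h : IsReversalOf Z' Z) {γ : Set R3}
    (hγ : IsSymmetricLimitCycle Z γ) : IsSymmetricLimitCycle Z' (reversal '' γ) := by
  obtain ⟨⟨hper, ⟨p, q, hpq, hinter⟩, hS⟩, U, hU, hsub, huniq⟩ := hγ
  refine ⟨⟨h.isPeriodicOrbit hper, ⟨reversal p, reversal q, ?_, ?_⟩, ?_⟩,
    reversal ⁻¹' U, hU.preimage continuous_reversal, ?_, fun γ' hγ' hsub' => ?_⟩
  · exact fun he => hpq (Function.LeftInverse.injective reversal_reversal he)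
  · rw [← Set.image_pair, ← hinter]
    ext r
    constructor
    · rintro ⟨⟨r, hr, rfl⟩, hs⟩; exact ⟨r, ⟨hr, hs⟩, rfl⟩
    · rintro ⟨r, ⟨hr, hs⟩, rfl⟩; exact ⟨⟨r, hr, rfl⟩, hs⟩
  · conv_rhs => rw [← hS]
    rw [← Set.image_comp, ← Set.image_comp]
    exact Set.image_congr fun p _ => (reversal_invol p).symm
  · rintro _ ⟨r, hr, rfl⟩
    simpa using hsub hr
  · have := huniq _ (h.symm.isPeriodicOrbit hγ') (by
      rintro _ ⟨r, hr, rfl⟩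
      exact hsub' hr)
    rw [← this, reversal_image_reversal_image]

end IsReversalOf

section Canonical

variable (A C H Λ : ℝ) (p : R3)

@[simp] lemma canonicalField_X_zero : (canonicalField A C H Λ).X.eval p 0 =
    A * p 0 - H * (((A - C) ^ 2 + 1) * p 2 - Λ) := by
  simp [AffineField.eval_coord, canonicalField]; ring

@[simp] lemma canonicalField_X_one : (canonicalField A C H Λ).X.eval p 1 =
    Λ - (1 + C ^ 2) * p 2 := by
  simp [AffineField.eval_coord, canonicalField]; ring

@[simp] lemma canonicalField_X_two : (canonicalField A C H Λ).X.eval p 2 =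
    2 * C * p 2 + p 1 := by
  simp [AffineField.eval_coord, canonicalField]; ring

@[simp] lemma canonicalField_Y_zero : (canonicalField A C H Λ).Y.eval p 0 =
    -Λ - (1 + C ^ 2) * p 2 := by
  simp [AffineField.eval_coord, canonicalField]; ring

@[simp] lemma canonicalField_Y_one : (canonicalField A C H Λ).Y.eval p 1 =
    A * p 1 - H * (((A - C) ^ 2 + 1) * p 2 + Λ) := by
  simp [AffineField.eval_coord, canonicalField]; ring

@[simp] lemma canonicalField_Y_two : (canonicalField A C H Λ).Y.eval p 2 =
    2 * C * p 2 + p 0 := by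
  simp [AffineField.eval_coord, canonicalField]; ring

lemma equivariant_canonicalField : Equivariant (canonicalField A C H Λ) := by
  intro p
  ext i
  fin_cases i <;> simp <;> ring

lemma isReversalOf_canonicalField :
    IsReversalOf (canonicalField (-A) (-C) H Λ) (canonicalField A C H Λ) := by
  intro p
  have e : (-A + C) ^ 2 = (A - C) ^ 2 := by ring
  constructor <;> ext i <;> fin_cases i <;> simp [e] <;> ring

lemma lieZ_canonicalField_X : lieZ (canonicalField A C H Λ).X p = 2 * C * p 2 + p 1 := by
  simp [lieZ]

lemma lieZ_canonicalField_Y : lieZ (canonicalField A C H Λ).Y p = 2 * C * p 2 + p 0 := by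
  simp [lieZ]

variable {A C}

lemma hasFocalSpectrum_of_det {M : Matrix (Fin 3) (Fin 3) ℝ} (hA : A ≠ 0)
    (h : ∀ μ : ℂ, (algebraMap ℂ (Matrix (Fin 3) (Fin 3) ℂ) μ - M.map (algebraMap ℝ ℂ)).det =
      (μ - A) * (μ ^ 2 - 2 * C * μ + (1 + C ^ 2))) : HasFocalSpectrum M A C 1 := by
  refine ⟨hA, one_ne_zero, ?_⟩
  ext μ
  have e : (μ - A) * (μ ^ 2 - 2 * C * μ + (1 + C ^ 2)) =
      (μ - A) * ((μ - (C + (1 : ℝ) * Complex.I)) * (μ - (C - (1 : ℝ) * Complex.I))) := by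
    push_cast
    linear_combination (μ - A) * Complex.I_sq
  rw [spectrum.mem_iff, Matrix.isUnit_iff_isUnit_det, isUnit_iff_ne_zero, not_not, h μ, e]
  simp only [mul_eq_zero, sub_eq_zero, Set.mem_insert_iff, Set.mem_singleton_iff]

lemma hasFocalSpectrum_canonicalField_X (hA : A ≠ 0) :
    HasFocalSpectrum (canonicalField A C H Λ).X.lin A C 1 := by
  refine hasFocalSpectrum_of_det hA fun μ => ?_
  rw [Matrix.det_fin_three]
  simp [canonicalField, Matrix.algebraMap_matrix_apply]
  ring

lemma hasFocalSpectrum_canonicalField_Y (hA : A ≠ 0) :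
    HasFocalSpectrum (canonicalField A C H Λ).Y.lin A C 1 := by
  refine hasFocalSpectrum_of_det hA fun μ => ?_
  rw [Matrix.det_fin_three]
  simp [canonicalField, Matrix.algebraMap_matrix_apply]
  ring

lemma classS_canonicalField (hA : A ≠ 0) : ClassS (canonicalField A C H Λ) := by
  refine ⟨⟨⟨⟨A, C, 1, hasFocalSpectrum_canonicalField_X H Λ hA⟩,
    ⟨A, C, 1, hasFocalSpectrum_canonicalField_Y H Λ hA⟩⟩, ?_⟩,
    fun p _ => equivariant_canonicalField A C H Λ p⟩
  ext p
  simp only [tangencySet, switchingPlane, lieZ_canonicalField_X, lieZ_canonicalField_Y,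
    Set.mem_inter_iff, Set.mem_ofPred_eq, Set.mem_singleton_iff]
  constructor
  · rintro ⟨⟨h2, h1⟩, -, h0⟩
    rw [h2] at h1 h0
    ext i
    fin_cases i
    · simpa using h0
    · simpa using h1
    · simpa using h2
  · rintro rfl
    simp

lemma isResonant_canonicalField (hC : C ≠ 0) : IsResonant (canonicalField (-2 * C) C H Λ) :=
  have hA : -2 * C ≠ 0 := mul_ne_zero (by norm_num) hC
  ⟨⟨_, C, 1, hasFocalSpectrum_canonicalField_X H Λ hA, rfl⟩,
    ⟨_, C, 1, hasFocalSpectrum_canonicalField_Y H Λ hA, rfl⟩⟩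

end Canonical

/-- `Φ` is the flow of the affine field `X`. -/
structure IsFlow (X : AffineField) (Φ : ℝ → R3 → R3) : Prop where
  zero : ∀ p, Φ 0 p = p
  add : ∀ s t p, Φ s (Φ t p) = Φ (s + t) p
  deriv : ∀ t p, HasDerivAt (fun s => Φ s p) (X.eval (Φ t p)) t
  cont : Continuous (Function.uncurry Φ)

lemma AffineField.exists_lipschitzWith (X : AffineField) : ∃ K, LipschitzWith K X.eval := by
  let L : R3 →L[ℝ] R3 := (Matrix.mulVecLin X.lin).toContinuousLinearMap
  refine ⟨‖L‖₊, LipschitzWith.of_dist_le_mul fun p q => ?_⟩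
  have := L.lipschitz.dist_le_mul p q
  simpa [AffineField.eval, L, dist_add_right] using this

lemma exists_near_inter_of_infDist {K F : Set R3} (hK : IsCompact K) (hF : IsClosed F)
    (hne : K.Nonempty) {ε : ℝ} (hε : 0 < ε) :
    ∃ δ > 0, ∀ p ∈ F, Metric.infDist p K < δ → ∃ q ∈ K ∩ F, dist p q < ε := by
  set D : Set R3 := F \ Metric.thickening ε (K ∩ F)
  have hD : IsClosed D := hF.sdiff Metric.isOpen_thickening
  have hdis : Disjoint K D := by
    rw [Set.disjoint_left]
    exact fun p hp hpD => hpD.2 (Metric.self_subset_thickening hε _ ⟨hp, hpD.1⟩)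
  obtain ⟨r, hr, h⟩ := Metric.exists_pos_forall_lt_edist hK hD hdis
  refine ⟨r, hr, fun p hpF hp => ?_⟩
  obtain ⟨q, hq, hpq⟩ := (Metric.infDist_lt_iff hne).1 hp
  by_contra hcon
  push Not at hcon
  have hpD : p ∈ D := by
    refine ⟨hpF, fun hth => ?_⟩
    obtain ⟨q', hq', hd⟩ := Metric.mem_thickening_iff.1 hth
    exact absurd hd (not_lt.2 (hcon q' hq'))
  have h1 := h q hq p hpD
  rw [edist_comm, edist_dist, ← ENNReal.ofReal_coe_nnreal] at h1
  exact lt_asymm hpq ((ENNReal.ofReal_lt_ofReal_iff_of_nonneg r.2).1 h1)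

namespace IsFlow

variable {Z : PiecewiseField} {Φ : ℝ → R3 → R3} {φ : ℝ → R3}

lemma continuous_time {X : AffineField} (h : IsFlow X Φ) (p : R3) : Continuous fun t => Φ t p :=
  h.cont.comp (by fun_prop : Continuous fun t : ℝ => (t, p))

lemma hasDerivAt_height {X : AffineField} (h : IsFlow X Φ) (t : ℝ) (p : R3) :
    HasDerivAt (fun s => Φ s p 2) (lieZ X (Φ t p)) t := (hasDerivAt_pi.1 (h.deriv t p)) 2

lemma eqOn_of_height_pos (h : IsFlow Z.X Φ) (hφ : IsTrajectoryOn Z φ (Set.Ici 0))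
    (h0 : 0 < φ 0 2 ∨ φ 0 2 = 0 ∧ 0 < lieZ Z.X (φ 0)) {b : ℝ}
    (hpos : ∀ t ∈ Set.Ioo 0 b, 0 < φ t 2) :
    Set.EqOn φ (fun t => Φ t (φ 0)) (Set.Icc 0 b) := by
  obtain ⟨K, hK⟩ := Z.X.exists_lipschitzWith
  refine ODE_solution_unique (v := fun _ => Z.X.eval) (K := K) (fun _ => hK)
    (hφ.continuousOn.mono Set.Icc_subset_Ici_self) (fun t ht => ?_)
    (h.continuous_time _).continuousOn (fun t _ => (h.deriv t _).hasDerivWithinAt)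
    (h.zero _).symm
  rcases eq_or_lt_of_le ht.1 with rfl | ht0
  · rcases h0 with h0 | ⟨h0, h1⟩
    · exact (hφ 0 Set.self_mem_Ici).1 h0
    · exact (((hφ 0 Set.self_mem_Ici).2.2 h0).2.1 h1).2.mono (by simp)
  · exact ((hφ t ht.1).1 (hpos t ⟨ht0, ht.2⟩)).mono (Set.Ici_subset_Ici.2 ht.1)

/-- A trajectory follows the flow of `X` as long as the latter stays above the plane. -/
lemma eqOn_trajectory (h : IsFlow Z.X Φ) (hφ : IsTrajectoryOn Z φ (Set.Ici 0))
    (h0 : 0 < φ 0 2 ∨ φ 0 2 = 0 ∧ 0 < lieZ Z.X (φ 0)) {σ : ℝ}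
    (hpos : ∀ t ∈ Set.Ioo 0 σ, 0 < Φ t (φ 0) 2) :
    Set.EqOn φ (fun t => Φ t (φ 0)) (Set.Icc 0 σ) := by
  refine h.eqOn_of_height_pos hφ h0 fun b hb => ?_
  by_contra hcon
  have hcont : ContinuousOn (fun t => φ t 2) (Set.Ici 0) :=
    (continuous_apply 2).comp_continuousOn hφ.continuousOn
  have hnear : ∀ᶠ t in 𝓝[>] (0 : ℝ), 0 < φ t 2 := by
    rcases h0 with h0 | ⟨h0, h1⟩
    · have := (hcont 0 Set.self_mem_Ici).mono Set.Ioi_subset_Ici_self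
      exact this.eventually (lt_mem_nhds h0)
    · exact eventually_pos_right_of_hasDerivWithinAt
        (inter_mem (mem_of_superset self_mem_nhdsWithin Set.Ioi_subset_Ici_self)
          (mem_of_superset self_mem_nhdsWithin Set.Ioi_subset_Ici_self))
        (hasDerivWithinAt_height (((hφ 0 Set.self_mem_Ici).2.2 h0).2.1 h1).2) h0 h1
  obtain ⟨c, hc, hcpos⟩ := mem_nhdsGT_iff_exists_Ioo_subset.1 hnear
  have hc0 : 0 < c := hc
  set K : Set ℝ := Set.Icc (min c b) b ∩ {t | φ t 2 ≤ 0}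
  have hmin : 0 < min c b := lt_min hc0 hb.1
  have hKc : IsCompact K := by
    refine isCompact_Icc.of_isClosed_subset ?_ Set.inter_subset_left
    exact (hcont.mono fun t ht => hmin.le.trans ht.1).preimage_isClosed_of_isClosed isClosed_Icc
      isClosed_Iic
  obtain ⟨t₁, ht₁, hmin₁⟩ := hKc.exists_isLeast ⟨b, ⟨min_le_right _ _, le_rfl⟩, not_lt.1 hcon⟩
  have ht₁0 : 0 < t₁ := hmin.trans_le ht₁.1.1
  have hbefore : ∀ t ∈ Set.Ioo 0 t₁, 0 < φ t 2 := by
    intro t ht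
    by_contra hn
    rcases lt_or_ge t (min c b) with h1 | h1
    · exact hn (hcpos ⟨ht.1, h1.trans_le (min_le_left _ _)⟩)
    · exact absurd (hmin₁ ⟨⟨h1, ht.2.le.trans ht₁.1.2⟩, not_lt.1 hn⟩) (not_le.2 ht.2)
  have := h.eqOn_of_height_pos hφ h0 hbefore (Set.right_mem_Icc.2 ht₁0.le)
  have h2 := hpos t₁ ⟨ht₁0, ht₁.1.2.trans_lt hb.2⟩
  have h3 : φ t₁ 2 ≤ 0 := ht₁.2
  rw [this] at h3
  exact absurd h2 (not_lt.2 h3)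

/-- A flow segment above the plane that ends with a downward crossing is a trajectory. -/
lemma isTrajectoryOn_Icc (h : IsFlow Z.X Φ) {p : R3} {σ : ℝ} (hσ : 0 < σ)
    (h0 : 0 < p 2 ∨ p ∈ crossingRegion Z ∧ 0 < lieZ Z.X p)
    (hpos : ∀ t ∈ Set.Ioo 0 σ, 0 < Φ t p 2)
    (h1 : Φ σ p ∈ crossingRegion Z) (h1' : lieZ Z.X (Φ σ p) < 0) :
    IsTrajectoryOn Z (fun t => Φ t p) (Set.Icc 0 σ) := by
  have hX : ∀ t I, HasDerivWithinAt (fun t => Φ t p) (Z.X.eval (Φ t p)) I t :=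
    fun t I => (h.deriv t p).hasDerivWithinAt
  have hsing : ∀ (t : ℝ) (v : R3), HasDerivWithinAt (fun t => Φ t p) v {t} t := fun t v =>
    hasDerivWithinAt_iff_hasFDerivWithinAt.2 (HasFDerivWithinAt.of_subsingleton
      Set.subsingleton_singleton)
  intro t ht
  refine ⟨fun _ => hX _ _, fun hneg => ?_, fun hz => ?_⟩
  · exfalso
    rcases eq_or_lt_of_le ht.1 with rfl | ht0
    · simp only [h.zero] at hneg
      rcases h0 with h0 | ⟨h0, -⟩
      · exact lt_asymm h0 hneg
      · have h0 : p 2 = 0 := h0.1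
        linarith
    · rcases eq_or_lt_of_le ht.2 with rfl | ht1
      · have h1 : Φ t p 2 = 0 := h1.1
        linarith
      · exact lt_asymm hneg (hpos t ⟨ht0, ht1⟩)
  · rcases eq_or_lt_of_le ht.1 with rfl | ht0
    · simp only [h.zero] at hz
      obtain ⟨h0, h0'⟩ : p ∈ crossingRegion Z ∧ 0 < lieZ Z.X p :=
        h0.resolve_left fun h => by linarith
      have e : Set.Icc 0 σ ∩ Set.Iic 0 = {(0 : ℝ)} := by
        ext s; simp only [Set.mem_inter_iff, Set.mem_Icc, Set.mem_Iic, Set.mem_singleton_iff]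
        constructor
        · rintro ⟨⟨h1, -⟩, h2⟩; exact le_antisymm h2 h1
        · rintro rfl; exact ⟨⟨le_rfl, hσ.le⟩, le_rfl⟩
      refine ⟨by simpa only [h.zero] using h0, fun _ => ⟨?_, hX _ _⟩, fun hn => ?_⟩
      · rw [e]; exact hsing _ _
      · simp only [h.zero] at hn; exact absurd h0' hn.not_gt
    · rcases eq_or_lt_of_le ht.2 with rfl | ht1
      · have e : Set.Icc 0 t ∩ Set.Ici t = {t} := by
          ext s; simp only [Set.mem_inter_iff, Set.mem_Icc, Set.mem_Ici, Set.mem_singleton_iff]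
          constructor
          · rintro ⟨⟨-, h1⟩, h2⟩; exact le_antisymm h1 h2
          · rintro rfl; exact ⟨⟨hσ.le, le_rfl⟩, le_rfl⟩
        refine ⟨h1, fun hn => absurd h1' hn.not_gt, fun _ => ⟨hX _ _, ?_⟩⟩
        rw [e]; exact hsing _ _
      · exact absurd hz (hpos t ⟨ht0, ht1⟩).ne'

end IsFlow

/-- A flow segment of `X` between two crossings exchanged by `S`, such that the half return map
`p ↦ S (Φ (s p) p)` contracts the Lyapunov function `W` near the initial point `p₀`. -/
structure AttractingSegment (Z : PiecewiseField) (Φ : ℝ → R3 → R3) (p₀ : R3) (τ : ℝ)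
    (s : R3 → ℝ) (W : R3 → ℝ) (k : ℝ) : Prop where
  equivariant : Equivariant Z
  flow : IsFlow Z.X Φ
  mem : p₀ ∈ crossingRegion Z
  upward : 0 < lieZ Z.X p₀
  pos : 0 < τ
  endpoint : Φ τ p₀ = invol p₀
  height_pos : ∀ t ∈ Set.Ioo 0 τ, 0 < Φ t p₀ 2
  k_nonneg : 0 ≤ k
  k_lt_one : k < 1
  W_nonneg : ∀ p, 0 ≤ W p
  W_tendsto : Tendsto W (𝓝 p₀) (𝓝 0)
  W_small : ∀ ε > 0, ∃ δ > 0, ∀ p ∈ switchingPlane, W p < δ → dist p p₀ < ε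
  s_tendsto : Tendsto s (𝓝[switchingPlane] p₀) (𝓝 τ)
  return_map : ∀ᶠ p in 𝓝[switchingPlane] p₀, Φ (s p) p 2 = 0 ∧
    (∀ t ∈ Set.Ioo 0 (s p), 0 < Φ t p 2) ∧ W (invol (Φ (s p) p)) ≤ k * W p

/-- The closed orbit generated by the flow segment on `[0, τ]` from `p₀`. -/
def orbitSet (Φ : ℝ → R3 → R3) (p₀ : R3) (τ : ℝ) : Set R3 :=
  (fun t => Φ t p₀) '' Set.Icc 0 τ ∪ invol '' ((fun t => Φ t p₀) '' Set.Icc 0 τ)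

/-- The first `n` half turns of the trajectory from `p`, with return times `s`. -/
noncomputable def iteratedTrajectory (Φ : ℝ → R3 → R3) (s : R3 → ℝ) : ℕ → R3 → ℝ → R3
  | 0, p, _ => p
  | n + 1, p, t =>
    open Classical in
    if t ≤ s p then Φ t p else invol (iteratedTrajectory Φ s n (invol (Φ (s p) p)) (t - s p))

/-- A point of the switching plane at which the half return map is defined and contracting. -/
structure IsReturning (Z : PiecewiseField) (Φ : ℝ → R3 → R3) (τ : ℝ) (s : R3 → ℝ)
    (W : R3 → ℝ) (k r : ℝ) (p : R3) : Prop where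
  mem : p ∈ crossingRegion Z
  upward : 0 < lieZ Z.X p
  W_lt : W p < r
  time : τ / 2 < s p
  return_mem : Φ (s p) p ∈ crossingRegion Z
  downward : lieZ Z.X (Φ (s p) p) < 0
  height_pos : ∀ t ∈ Set.Ioo 0 (s p), 0 < Φ t p 2
  contract : W (invol (Φ (s p) p)) ≤ k * W p

namespace AttractingSegment

variable {Z : PiecewiseField} {Φ : ℝ → R3 → R3} {p₀ : R3} {τ : ℝ} {s W : R3 → ℝ} {k : ℝ}

lemma isCompact_orbitSet (h : AttractingSegment Z Φ p₀ τ s W k) :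
    IsCompact (orbitSet Φ p₀ τ) := by
  have := isCompact_Icc.image (h.flow.continuous_time p₀) (s := Set.Icc 0 τ)
  exact this.union (this.image continuous_invol)

lemma mem_orbitSet {t : ℝ} (ht : t ∈ Set.Icc 0 τ) : Φ t p₀ ∈ orbitSet Φ p₀ τ :=
  Or.inl ⟨t, ht, rfl⟩

lemma invol_image_orbitSet : invol '' orbitSet Φ p₀ τ = orbitSet Φ p₀ τ := by
  rw [orbitSet, Set.image_union, ← Set.image_comp invol invol,
    show invol ∘ invol = id from funext invol_invol, Set.image_id, Set.union_comm]

lemma nonempty_orbitSet (h : AttractingSegment Z Φ p₀ τ s W k) :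
    (orbitSet Φ p₀ τ).Nonempty := ⟨_, mem_orbitSet (Set.left_mem_Icc.2 h.pos.le)⟩

lemma endpoint_mem (h : AttractingSegment Z Φ p₀ τ s W k) :
    Φ τ p₀ ∈ crossingRegion Z := by
  rw [h.endpoint]; exact h.equivariant.invol_mem_crossingRegion h.mem

lemma endpoint_downward (h : AttractingSegment Z Φ p₀ τ s W k) :
    lieZ Z.X (Φ τ p₀) < 0 := by
  rw [h.endpoint, h.equivariant.lieZ_X]
  linarith [lieZ_Y_pos_of_crossing h.mem h.upward]

lemma isTrajectoryOn_segment (h : AttractingSegment Z Φ p₀ τ s W k) :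
    IsTrajectoryOn Z (fun t => Φ t p₀) (Set.Icc 0 τ) :=
  h.flow.isTrajectoryOn_Icc h.pos (Or.inr ⟨h.mem, h.upward⟩) h.height_pos h.endpoint_mem
    h.endpoint_downward

lemma isCrossingSymmetricPeriodicOrbit (h : AttractingSegment Z Φ p₀ τ s W k) :
    IsCrossingSymmetricPeriodicOrbit Z (orbitSet Φ p₀ τ) ∧
      orbitSet Φ p₀ τ ∩ switchingPlane = {p₀, invol p₀} := by
  have := isCrossingSymmetricPeriodicOrbit_of_segment h.equivariant h.pos
    (by rw [h.flow.zero, h.endpoint]) h.isTrajectoryOn_segment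
    (by rw [h.flow.zero]; exact h.mem.1) fun t ht hs => (h.height_pos t ht).ne' hs
  rwa [h.flow.zero] at this

lemma exists_radius (h : AttractingSegment Z Φ p₀ τ s W k) :
    ∃ r > 0, (∀ p ∈ switchingPlane, W p < r → IsReturning Z Φ τ s W k r p) := by
  have hX : ∀ᶠ p in 𝓝 p₀, 0 < lieZ Z.X p :=
    (continuous_lieZ Z.X).continuousAt.eventually (lt_mem_nhds h.upward)
  have hY : ∀ᶠ p in 𝓝 p₀, 0 < lieZ Z.Y p :=
    (continuous_lieZ Z.Y).continuousAt.eventually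
      (lt_mem_nhds (lieZ_Y_pos_of_crossing h.mem h.upward))
  have hs : ∀ᶠ p in 𝓝[switchingPlane] p₀, τ / 2 < s p :=
    h.s_tendsto.eventually (lt_mem_nhds (half_lt_self h.pos))
  obtain ⟨ε, hε, hball⟩ := Metric.mem_nhdsWithin_iff.1
    (((hX.and hY).filter_mono nhdsWithin_le_nhds).and (hs.and h.return_map))
  obtain ⟨r, hr, hsmall⟩ := h.W_small ε hε
  have key : ∀ p ∈ switchingPlane, W p < r → _ := fun p hp hW => hball ⟨hsmall p hp hW, hp⟩
  refine ⟨r, hr, fun p hp hW => ?_⟩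
  obtain ⟨⟨hXp, hYp⟩, hsp, hz, hpos, hcon⟩ := key p hp hW
  have hW' : W (invol (Φ (s p) p)) < r :=
    (hcon.trans (mul_le_of_le_one_left (h.W_nonneg p) h.k_lt_one.le)).trans_lt hW
  obtain ⟨⟨hXq, hYq⟩, -⟩ := key _ (invol_mem_switchingPlane.2 hz) hW'
  rw [h.equivariant.lieZ_X] at hXq
  rw [h.equivariant.lieZ_Y] at hYq
  exact ⟨⟨hp, mul_pos hXp hYp⟩, hXp, hW, hsp, ⟨hz, by nlinarith⟩, by linarith, hpos, hcon⟩

/-- Flow lines of `X` from near `p₀` stay near the orbit, slightly beyond the time `τ`. -/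
lemma exists_flow_near (h : AttractingSegment Z Φ p₀ τ s W k) {ε : ℝ} (hε : 0 < ε) :
    ∃ η > 0, ∀ p, dist p p₀ < η → ∀ t ∈ Set.Icc 0 (τ + η),
      Metric.infDist (Φ t p) (orbitSet Φ p₀ τ) < ε ∧
      (τ - η ≤ t → dist (Φ t p) (invol p₀) < ε) := by
  have h1 : ∀ᶠ p in 𝓝 p₀, ∀ t ∈ Set.Icc 0 (τ + 1), dist (Φ t p) (Φ t p₀) < ε / 2 := by
    refine isCompact_Icc.eventually_forall_of_forall_eventually fun t _ => ?_
    have hc : Continuous fun q : R3 × ℝ => dist (Φ q.2 q.1) (Φ q.2 p₀) :=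
      (h.flow.cont.comp (by fun_prop : Continuous fun q : R3 × ℝ => (q.2, q.1))).dist
        (h.flow.cont.comp (by fun_prop : Continuous fun q : R3 × ℝ => (q.2, p₀)))
    exact hc.continuousAt.eventually (gt_mem_nhds (by simpa using hε))
  have h2 : ∀ᶠ t in 𝓝 τ, dist (Φ t p₀) (invol p₀) < ε / 2 := by
    rw [← h.endpoint]
    exact ((h.flow.continuous_time p₀).dist continuous_const).continuousAt.eventually
      (gt_mem_nhds (by simpa using hε))
  obtain ⟨η₁, hη₁, h1⟩ := Metric.eventually_nhds_iff.1 h1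
  obtain ⟨η₂, hη₂, h2⟩ := Metric.eventually_nhds_iff.1 h2
  obtain ⟨η, hη, hlt⟩ := exists_between (lt_min (lt_min hη₁ hη₂) one_pos)
  have l1 : η < η₁ := hlt.trans_le ((min_le_left _ _).trans (min_le_left _ _))
  have l2 : η < η₂ := hlt.trans_le ((min_le_left _ _).trans (min_le_right _ _))
  have l3 : η < 1 := hlt.trans_le (min_le_right _ _)
  refine ⟨η, hη, fun p hp t ht => ?_⟩
  have hd := h1 (hp.trans l1) t ⟨ht.1, by linarith [ht.2]⟩
  have hnear : τ - η ≤ t → dist (Φ t p) (invol p₀) < ε := by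
    intro hle
    have : dist (Φ t p₀) (invol p₀) < ε / 2 :=
      h2 (by rw [Real.dist_eq, abs_lt]; constructor <;> linarith [ht.2])
    linarith [dist_triangle (Φ t p) (Φ t p₀) (invol p₀)]
  refine ⟨?_, hnear⟩
  rcases le_or_gt t τ with htt | htt
  · linarith [Metric.infDist_le_dist_of_mem (x := Φ t p) (mem_orbitSet (Φ := Φ) (p₀ := p₀)
      ⟨ht.1, htt⟩)]
  · have hm : invol p₀ ∈ orbitSet Φ p₀ τ :=
      Or.inr ⟨p₀, ⟨0, Set.left_mem_Icc.2 h.pos.le, h.flow.zero _⟩, rfl⟩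
    exact (Metric.infDist_le_dist_of_mem hm).trans_lt (hnear (by linarith))

lemma exists_near (h : AttractingSegment Z Φ p₀ τ s W k) {ε : ℝ} (hε : 0 < ε) :
    ∃ δ > 0, ∀ p ∈ switchingPlane, W p < δ →
      ∀ t ∈ Set.Icc 0 (s p), Metric.infDist (Φ t p) (orbitSet Φ p₀ τ) < ε := by
  obtain ⟨η, hη, hnear⟩ := h.exists_flow_near hε
  have hs : ∀ᶠ p in 𝓝[switchingPlane] p₀, s p < τ + η :=
    h.s_tendsto.eventually (gt_mem_nhds (by linarith))
  obtain ⟨ε', hε', hball⟩ := Metric.mem_nhdsWithin_iff.1 hs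
  obtain ⟨δ, hδ, hsmall⟩ := h.W_small (min η ε') (lt_min hη hε')
  refine ⟨δ, hδ, fun p hp hW t ht => ?_⟩
  have hd := hsmall p hp hW
  have hsp : s p < τ + η := hball ⟨hd.trans_le (min_le_right _ _), hp⟩
  exact (hnear p (hd.trans_le (min_le_left _ _)) t ⟨ht.1, ht.2.trans hsp.le⟩).1

/-- Near `p₀` the height function along flow lines has the same sign structure as along the
segment from `p₀`. -/
lemma exists_sign_structure (h : AttractingSegment Z Φ p₀ τ s W k) {ε : ℝ} (hε : 0 < ε) :
    ∃ δ > 0, ∀ p, dist p p₀ < δ → ∃ σ, |σ - τ| < ε ∧ Φ σ p 2 = 0 ∧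
      ∀ a ∈ Set.Icc 0 τ, 0 ≤ Φ a p 2 → a ≤ σ ∧ ∀ t ∈ Set.Ioo a σ, 0 < Φ t p 2 := by
  have hc : Continuous fun q : R3 × ℝ => Φ q.2 q.1 :=
    h.flow.cont.comp (by fun_prop : Continuous fun q : R3 × ℝ => (q.2, q.1))
  have hz : Continuous fun q : R3 × ℝ => Φ q.2 q.1 2 := (continuous_apply 2).comp hc
  have hl : Continuous fun q : R3 × ℝ => lieZ Z.X (Φ q.2 q.1) := (continuous_lieZ _).comp hc
  have hup : ∀ᶠ q in 𝓝 (p₀, (0 : ℝ)), 0 < lieZ Z.X (Φ q.2 q.1) :=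
    hl.continuousAt.eventually (lt_mem_nhds (by simpa [h.flow.zero] using h.upward))
  have hdown : ∀ᶠ q in 𝓝 (p₀, τ), lieZ Z.X (Φ q.2 q.1) < 0 :=
    hl.continuousAt.eventually (gt_mem_nhds h.endpoint_downward)
  obtain ⟨r₁, hr₁, hup⟩ := Metric.eventually_nhds_iff.1 hup
  obtain ⟨r₂, hr₂, hdown⟩ := Metric.eventually_nhds_iff.1 hdown
  have hτ := h.pos
  obtain ⟨η, hη, hlt⟩ := exists_between
    (lt_min (lt_min hr₁ hr₂) (lt_min hε (by positivity : 0 < τ / 3)))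
  have l1 : η < r₁ := hlt.trans_le ((min_le_left _ _).trans (min_le_left _ _))
  have l2 : η < r₂ := hlt.trans_le ((min_le_left _ _).trans (min_le_right _ _))
  have l3 : η < ε := hlt.trans_le ((min_le_right _ _).trans (min_le_left _ _))
  have l4 : η < τ / 3 := hlt.trans_le ((min_le_right _ _).trans (min_le_right _ _))
  have mono : ∀ p, dist p p₀ < r₁ → StrictMonoOn (fun t => Φ t p 2) (Set.Icc 0 η) := by
    intro p hp
    refine strictMonoOn_of_deriv_pos (convex_Icc _ _)
      (((continuous_apply 2).comp (h.flow.continuous_time p)).continuousOn) fun t ht => ?_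
    rw [interior_Icc] at ht
    rw [(h.flow.hasDerivAt_height t p).deriv]
    refine @hup (p, t) ?_
    rw [Prod.dist_eq]
    refine max_lt hp ?_
    rw [Real.dist_eq, abs_lt]
    constructor <;> linarith [ht.1, ht.2]
  have anti : ∀ p, dist p p₀ < r₂ →
      StrictAntiOn (fun t => Φ t p 2) (Set.Icc (τ - η) (τ + η)) := by
    intro p hp
    refine strictAntiOn_of_deriv_neg (convex_Icc _ _)
      (((continuous_apply 2).comp (h.flow.continuous_time p)).continuousOn) fun t ht => ?_
    rw [interior_Icc] at ht
    rw [(h.flow.hasDerivAt_height t p).deriv]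
    refine @hdown (p, t) ?_
    rw [Prod.dist_eq]
    refine max_lt hp ?_
    rw [Real.dist_eq, abs_lt]
    constructor <;> linarith [ht.1, ht.2]
  have hmid : ∀ᶠ p in 𝓝 p₀, ∀ t ∈ Set.Icc η (τ - η), 0 < Φ t p 2 := by
    refine isCompact_Icc.eventually_forall_of_forall_eventually fun t ht => ?_
    exact hz.continuousAt.eventually
      (lt_mem_nhds (h.height_pos t ⟨hη.trans_le ht.1, by linarith [ht.2]⟩))
  have hend : ∀ᶠ p in 𝓝 p₀, Φ (τ + η) p 2 < 0 := by
    have h1 : Φ τ p₀ 2 = 0 := h.endpoint_mem.1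
    have h2 := anti p₀ (by simpa using hr₂) (a := τ) (b := τ + η)
      ⟨by linarith, by linarith⟩ ⟨by linarith, le_rfl⟩ (by linarith)
    have h3 : Φ (τ + η) p₀ 2 < 0 := h1 ▸ h2
    have hcont : Continuous fun p => Φ (τ + η) p 2 :=
      hz.comp (by fun_prop : Continuous fun p : R3 => (p, τ + η))
    exact hcont.continuousAt.eventually (gt_mem_nhds h3)
  obtain ⟨r₃, hr₃, hme⟩ := Metric.eventually_nhds_iff.1 (hmid.and hend)
  refine ⟨min (min r₁ r₂) r₃, lt_min (lt_min hr₁ hr₂) hr₃, fun p hp => ?_⟩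
  have mono := mono p (hp.trans_le ((min_le_left _ _).trans (min_le_left _ _)))
  have anti := anti p (hp.trans_le ((min_le_left _ _).trans (min_le_right _ _)))
  obtain ⟨hmid, hend⟩ := hme (hp.trans_le (min_le_right _ _))
  have hcont : ContinuousOn (fun t => Φ t p 2) (Set.Icc (τ - η) (τ + η)) :=
    ((continuous_apply 2).comp (h.flow.continuous_time p)).continuousOn
  obtain ⟨σ, hσ, hσ0⟩ := intermediate_value_Icc' (by linarith) hcont
    ⟨hend.le, (hmid (τ - η) ⟨by linarith, le_rfl⟩).le⟩
  have hσ0 : Φ σ p 2 = 0 := hσ0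
  refine ⟨σ, by rw [abs_lt]; constructor <;> linarith [hσ.1, hσ.2], hσ0, fun a ha h0 => ?_⟩
  have hle : a ≤ σ := by
    by_contra hcon
    push Not at hcon
    have := anti hσ ⟨by linarith [hσ.1], by linarith [ha.2]⟩ hcon
    simp only [hσ0] at this
    linarith
  refine ⟨hle, fun t ht => ?_⟩
  rcases le_or_gt t η with ht1 | ht1
  · exact h0.trans_lt (mono ⟨ha.1, ht.1.le.trans ht1⟩ ⟨ha.1.trans ht.1.le, ht1⟩ ht.1)
  rcases le_or_gt t (τ - η) with ht2 | ht2
  · exact hmid t ⟨ht1.le, ht2⟩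
  · have := anti ⟨ht2.le, ht.2.le.trans hσ.2⟩ hσ ht.2
    simp only [hσ0] at this
    exact this

/-- Flow lines from points above the plane and near the orbit reach the plane near `S p₀`. -/
lemma exists_tube (h : AttractingSegment Z Φ p₀ τ s W k) {ε : ℝ} (hε : 0 < ε) :
    ∃ δ > 0, ∀ p, 0 < p 2 → Metric.infDist p (orbitSet Φ p₀ τ) < δ →
      ∃ σ > 0, Φ σ p 2 = 0 ∧ (∀ t ∈ Set.Ioo 0 σ, 0 < Φ t p 2) ∧ dist (Φ σ p) (invol p₀) < ε ∧
        ∀ t ∈ Set.Icc 0 σ, Metric.infDist (Φ t p) (orbitSet Φ p₀ τ) < ε := by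
  obtain ⟨η, hη, hnear⟩ := h.exists_flow_near hε
  obtain ⟨δ₁, hδ₁, hsign⟩ := h.exists_sign_structure hη
  -- points near the upper half of the orbit flow back to points near `p₀`
  have hback : ∃ δ₂ > 0, ∀ p a, a ∈ Set.Icc 0 τ → dist p (Φ a p₀) < δ₂ →
      dist (Φ (-a) p) p₀ < min δ₁ η := by
    have hc : Continuous fun q : R3 × ℝ => Φ (-q.2) (Φ q.2 p₀ + q.1) := by
      refine h.flow.cont.comp (Continuous.prodMk (by fun_prop) (Continuous.add ?_ continuous_fst))
      exact (h.flow.continuous_time p₀).comp continuous_snd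
    have : ∀ᶠ v in 𝓝 (0 : R3), ∀ a ∈ Set.Icc 0 τ, dist (Φ (-a) (Φ a p₀ + v)) p₀ < min δ₁ η := by
      refine isCompact_Icc.eventually_forall_of_forall_eventually fun a _ => ?_
      refine (hc.dist continuous_const).continuousAt.eventually (gt_mem_nhds ?_)
      simp only [add_zero, h.flow.add, neg_add_cancel, h.flow.zero, dist_self]
      exact lt_min hδ₁ hη
    obtain ⟨δ₂, hδ₂, hb⟩ := Metric.eventually_nhds_iff.1 this
    refine ⟨δ₂, hδ₂, fun p a ha hd => ?_⟩
    have := hb (y := p - Φ a p₀) (by rwa [dist_zero_right, ← dist_eq_norm]) a ha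
    rwa [add_sub_cancel] at this
  obtain ⟨δ₂, hδ₂, hback⟩ := hback
  have hF : IsClosed {p : R3 | 0 ≤ p 2} := isClosed_le continuous_const (continuous_apply 2)
  obtain ⟨δ, hδ, hclose⟩ :=
    exists_near_inter_of_infDist h.isCompact_orbitSet hF h.nonempty_orbitSet hδ₂
  refine ⟨δ, hδ, fun p hp hd => ?_⟩
  obtain ⟨q, ⟨hqγ, hq2⟩, hpq⟩ := hclose p hp.le hd
  obtain ⟨a, ha, rfl⟩ : ∃ a ∈ Set.Icc 0 τ, Φ a p₀ = q := by
    rcases hqγ with ⟨a, ha, rfl⟩ | ⟨_, ⟨a, ha, rfl⟩, rfl⟩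
    · exact ⟨a, ha, rfl⟩
    · have hq2 : 0 ≤ -Φ a p₀ 2 := hq2
      rcases eq_or_lt_of_le ha.1 with rfl | h0
      · exact ⟨τ, Set.right_mem_Icc.2 h.pos.le, by simp [h.flow.zero, h.endpoint]⟩
      · rcases eq_or_lt_of_le ha.2 with rfl | h1
        · exact ⟨0, Set.left_mem_Icc.2 h.pos.le, by simp [h.flow.zero, h.endpoint]⟩
        · linarith [h.height_pos a ⟨h0, h1⟩]
  have hp' := hback p a ha hpq
  set p' := Φ (-a) p
  have hflow : ∀ t, Φ t p = Φ (t + a) p' := by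
    intro t; rw [h.flow.add, add_neg_cancel_right]
  obtain ⟨σ, hσ, hσ0, hpos⟩ := hsign p' (hp'.trans_le (min_le_left _ _))
  have hpa : Φ a p' = p := by simpa [h.flow.zero] using (hflow 0).symm
  obtain ⟨hle, hpos⟩ := hpos a ha (by rw [hpa]; exact hp.le)
  have hne : a ≠ σ := by
    rintro rfl
    rw [hpa] at hσ0
    exact hp.ne' hσ0
  have hlt := lt_of_le_of_ne hle hne
  rw [abs_lt] at hσ
  have hnear := hnear p' (hp'.trans_le (min_le_right _ _))
  refine ⟨σ - a, sub_pos.2 hlt, by rw [hflow, sub_add_cancel, hσ0], fun t ht => ?_, ?_,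
    fun t ht => ?_⟩
  · rw [hflow]; exact hpos _ ⟨by linarith [ht.1], by linarith [ht.2]⟩
  · rw [hflow, sub_add_cancel]
    exact (hnear σ ⟨ha.1.trans hle, by linarith⟩).2 (by linarith)
  · rw [hflow]
    exact (hnear _ ⟨by linarith [ht.1, ha.1], by linarith [ht.2]⟩).1

end AttractingSegment

namespace AttractingSegment

variable {Z : PiecewiseField} {Φ : ℝ → R3 → R3} {p₀ : R3} {τ : ℝ} {s W : R3 → ℝ} {k : ℝ}

lemma infDist_invol_orbitSet (p : R3) :
    Metric.infDist (invol p) (orbitSet Φ p₀ τ) = Metric.infDist p (orbitSet Φ p₀ τ) :=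
  infDist_invol invol_image_orbitSet p

lemma isReturning_next {r : ℝ} (h : AttractingSegment Z Φ p₀ τ s W k)
    (hr : ∀ p ∈ switchingPlane, W p < r → IsReturning Z Φ τ s W k r p) {p : R3}
    (hp : IsReturning Z Φ τ s W k r p) : IsReturning Z Φ τ s W k r (invol (Φ (s p) p)) :=
  hr _ (invol_mem_switchingPlane.2 hp.return_mem.1)
    ((hp.contract.trans (mul_le_of_le_one_left (h.W_nonneg p) h.k_lt_one.le)).trans_lt hp.W_lt)

lemma eqOn_of_isReturning {r : ℝ} (h : AttractingSegment Z Φ p₀ τ s W k) {φ : ℝ → R3}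
    (hφ : IsTrajectoryOn Z φ (Set.Ici 0)) (hp : IsReturning Z Φ τ s W k r (φ 0)) :
    Set.EqOn φ (fun t => Φ t (φ 0)) (Set.Icc 0 (s (φ 0))) :=
  h.flow.eqOn_trajectory hφ (Or.inr ⟨hp.mem.1, hp.upward⟩) hp.height_pos

/-- Trajectories that start in the plane near `p₀` stay near the orbit. -/
lemma exists_stay (h : AttractingSegment Z Φ p₀ τ s W k) {ε : ℝ} (hε : 0 < ε) :
    ∃ δ > 0, ∀ φ, IsTrajectoryOn Z φ (Set.Ici 0) → φ 0 ∈ switchingPlane → W (φ 0) < δ →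
      ∀ t, 0 ≤ t → Metric.infDist (φ t) (orbitSet Φ p₀ τ) < ε := by
  obtain ⟨r, hr, hret⟩ := h.exists_radius
  obtain ⟨δ, hδ, hnear⟩ := h.exists_near hε
  refine ⟨min δ r, lt_min hδ hr, ?_⟩
  have key : ∀ n : ℕ, ∀ φ, IsTrajectoryOn Z φ (Set.Ici 0) → φ 0 ∈ switchingPlane →
      W (φ 0) < min δ r → ∀ t, 0 ≤ t → t < n * (τ / 2) →
      Metric.infDist (φ t) (orbitSet Φ p₀ τ) < ε := by
    intro n
    induction n with
    | zero =>
      intro φ _ _ _ t ht ht'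
      simp only [Nat.cast_zero, zero_mul] at ht'
      linarith
    | succ n ih =>
      intro φ hφ h0 hW t ht ht'
      have hp := hret _ h0 (hW.trans_le (min_le_right _ _))
      have heq := eqOn_of_isReturning h hφ hp
      rcases le_or_gt t (s (φ 0)) with hts | hts
      · rw [heq ⟨ht, hts⟩]
        exact hnear _ h0 (hW.trans_le (min_le_left _ _)) t ⟨ht, hts⟩
      · have hs0 : 0 ≤ s (φ 0) := by linarith [hp.time, h.pos]
        have e1 : φ (s (φ 0)) = Φ (s (φ 0)) (φ 0) := heq ⟨hs0, le_rfl⟩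
        have := ih (fun u => invol (φ (u + s (φ 0)))) ((hφ.shift_Ici hs0).invol h.equivariant)
          (by rw [zero_add, e1]; exact invol_mem_switchingPlane.2 hp.return_mem.1)
          (by
            rw [zero_add, e1]
            exact (hp.contract.trans
              (mul_le_of_le_one_left (h.W_nonneg _) h.k_lt_one.le)).trans_lt hW)
          (t - s (φ 0)) (by linarith) (by
            push_cast at ht'
            linarith [hp.time])
        rwa [infDist_invol_orbitSet, sub_add_cancel] at this
  intro φ hφ h0 hW t ht
  obtain ⟨n, hn⟩ := exists_nat_gt (t / (τ / 2))
  exact key n φ hφ h0 hW t ht ((div_lt_iff₀ (half_pos h.pos)).1 hn)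

/-- Successive returns of a trajectory approach `p₀` up to the involution. -/
lemma exists_return_le {r : ℝ} (h : AttractingSegment Z Φ p₀ τ s W k)
    (hret : ∀ p ∈ switchingPlane, W p < r → IsReturning Z Φ τ s W k r p) (n : ℕ) :
    ∀ φ, IsTrajectoryOn Z φ (Set.Ici 0) → φ 0 ∈ switchingPlane → W (φ 0) < r →
      ∃ t, 0 ≤ t ∧ φ t ∈ switchingPlane ∧
        (W (φ t) ≤ k ^ n * W (φ 0) ∨ W (invol (φ t)) ≤ k ^ n * W (φ 0)) := by
  induction n with
  | zero => exact fun φ _ h0 _ => ⟨0, le_rfl, h0, Or.inl (by simp)⟩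
  | succ n ih =>
    intro φ hφ h0 hW
    have hp := hret _ h0 hW
    have hs0 : 0 ≤ s (φ 0) := by linarith [hp.time, h.pos]
    have e1 : φ (s (φ 0)) = Φ (s (φ 0)) (φ 0) := eqOn_of_isReturning h hφ hp ⟨hs0, le_rfl⟩
    obtain ⟨t, ht, hts, hWt⟩ := ih (fun u => invol (φ (u + s (φ 0))))
      ((hφ.shift_Ici hs0).invol h.equivariant)
      (by rw [zero_add, e1]; exact (isReturning_next h hret hp).mem.1)
      (by rw [zero_add, e1]; exact (isReturning_next h hret hp).W_lt)
    have hle : k ^ n * W (invol (φ (0 + s (φ 0)))) ≤ k ^ (n + 1) * W (φ 0) := by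
      rw [zero_add, e1, pow_succ, mul_assoc]
      exact mul_le_mul_of_nonneg_left hp.contract (pow_nonneg h.k_nonneg n)
    refine ⟨t + s (φ 0), by linarith, invol_mem_switchingPlane.1 hts, ?_⟩
    rw [invol_invol] at hWt
    exact (hWt.imp (fun h => h.trans hle) fun h => h.trans hle).symm

lemma exists_tendsto (h : AttractingSegment Z Φ p₀ τ s W k) :
    ∃ δ > 0, ∀ φ, IsTrajectoryOn Z φ (Set.Ici 0) → φ 0 ∈ switchingPlane → W (φ 0) < δ →
      Tendsto (fun t => Metric.infDist (φ t) (orbitSet Φ p₀ τ)) atTop (𝓝 0) := by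
  obtain ⟨r, hr, hret⟩ := h.exists_radius
  refine ⟨r, hr, fun φ hφ h0 hW => ?_⟩
  rw [Metric.tendsto_atTop]
  intro ε hε
  obtain ⟨δ, hδ, hstay⟩ := h.exists_stay hε
  have hlim : Tendsto (fun n : ℕ => k ^ n * W (φ 0)) atTop (𝓝 0) := by
    simpa using (tendsto_pow_atTop_nhds_zero_of_lt_one h.k_nonneg h.k_lt_one).mul_const (W (φ 0))
  obtain ⟨n, hn⟩ := (hlim.eventually (gt_mem_nhds hδ)).exists
  obtain ⟨t₀, ht₀, hts, hWt⟩ := h.exists_return_le hret n φ hφ h0 hW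
  refine ⟨t₀, fun t ht => ?_⟩
  rw [Real.dist_eq, sub_zero, abs_of_nonneg Metric.infDist_nonneg]
  have htraj := hφ.shift_Ici ht₀
  rcases hWt with hWt | hWt
  · have := hstay _ htraj (by simpa using hts) (by simpa using hWt.trans_lt hn) (t - t₀)
      (by linarith)
    rwa [sub_add_cancel] at this
  · have := hstay _ (htraj.invol h.equivariant)
      (by simpa using invol_mem_switchingPlane.2 hts) (by simpa using hWt.trans_lt hn) (t - t₀)
      (by linarith)
    rwa [infDist_invol_orbitSet, sub_add_cancel] at this

section Existence

variable {r : ℝ}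

lemma iteratedTrajectory_zero (h : AttractingSegment Z Φ p₀ τ s W k) {p : R3}
    (hp : IsReturning Z Φ τ s W k r p) (n : ℕ) : iteratedTrajectory Φ s n p 0 = p := by
  cases n with
  | zero => rfl
  | succ n =>
    have : 0 ≤ s p := by linarith [hp.time, h.pos]
    rw [iteratedTrajectory, if_pos this, h.flow.zero]

lemma isTrajectoryOn_iterated (h : AttractingSegment Z Φ p₀ τ s W k)
    (hret : ∀ p ∈ switchingPlane, W p < r → IsReturning Z Φ τ s W k r p) (n : ℕ) :
    ∀ p, IsReturning Z Φ τ s W k r p →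
      IsTrajectoryOn Z (iteratedTrajectory Φ s n p) (Set.Ico 0 (n * (τ / 2))) := by
  induction n with
  | zero => intro p _; simp [IsTrajectoryOn]
  | succ n ih =>
    intro p hp
    have hs : 0 < s p := by linarith [hp.time, h.pos]
    have hp' := isReturning_next h hret hp
    refine IsTrajectoryOn.union (s p) ?_ ?_
    · refine ((h.flow.isTrajectoryOn_Icc hs (Or.inr ⟨hp.mem, hp.upward⟩) hp.height_pos
        hp.return_mem hp.downward).mono fun t ht => ⟨ht.1.1, ht.2⟩).congr fun t ht => ?_
      rw [iteratedTrajectory, if_pos (show t ≤ s p from ht.2)]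
    · refine ((((ih _ hp').comp_add (-s p)).invol h.equivariant).mono fun t ht => ?_).congr
        fun t ht => ?_
      · obtain ⟨⟨-, h1⟩, h2⟩ := ht
        have h2 : s p ≤ t := h2
        push_cast at h1
        exact ⟨by linarith, by linarith [hp.time]⟩
      · rcases eq_or_lt_of_le (show s p ≤ t from ht.2) with he | hlt
        · rw [iteratedTrajectory, if_pos he.ge, ← he]
          simp only [add_neg_cancel, h.iteratedTrajectory_zero hp', invol_invol]
        · rw [iteratedTrajectory, if_neg hlt.not_ge, sub_eq_add_neg]

lemma iteratedTrajectory_eq (h : AttractingSegment Z Φ p₀ τ s W k)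
    (hret : ∀ p ∈ switchingPlane, W p < r → IsReturning Z Φ τ s W k r p) (n : ℕ) :
    ∀ m p t, IsReturning Z Φ τ s W k r p → n ≤ m → 0 ≤ t → t < n * (τ / 2) →
      iteratedTrajectory Φ s n p t = iteratedTrajectory Φ s m p t := by
  induction n with
  | zero =>
    intro m p t _ _ h0 h1
    simp only [Nat.cast_zero, zero_mul] at h1
    linarith
  | succ n ih =>
    intro m p t hp hm h0 h1
    obtain ⟨m, rfl⟩ : ∃ m', m = m' + 1 := ⟨m - 1, by omega⟩
    rw [iteratedTrajectory, iteratedTrajectory]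
    split_ifs with hts
    · rfl
    · rw [ih m _ _ (isReturning_next h hret hp) (by omega) (by linarith)
        (by push_cast at h1; linarith [hp.time])]

/-- Every returning point is the initial point of a trajectory defined for all future times. -/
lemma exists_trajectory (h : AttractingSegment Z Φ p₀ τ s W k)
    (hret : ∀ p ∈ switchingPlane, W p < r → IsReturning Z Φ τ s W k r p) {p : R3}
    (hp : IsReturning Z Φ τ s W k r p) : ∃ φ, φ 0 = p ∧ IsTrajectoryOn Z φ (Set.Ici 0) := by
  have hτ : 0 < τ / 2 := half_pos h.pos
  refine ⟨fun t => iteratedTrajectory Φ s (⌊t / (τ / 2)⌋₊ + 1) p t,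
    h.iteratedTrajectory_zero hp _, ?_⟩
  refine IsTrajectoryOn.of_forall_nhds fun t _ => ?_
  obtain ⟨n, hn⟩ := exists_nat_gt (t / (τ / 2))
  refine ⟨Set.Iio (n * (τ / 2)), Iio_mem_nhds ((div_lt_iff₀ hτ).1 hn), ?_⟩
  refine (h.isTrajectoryOn_iterated hret n p hp).congr fun u hu => ?_
  have h1 : u < (⌊u / (τ / 2)⌋₊ + 1 : ℕ) * (τ / 2) := by
    have := Nat.lt_floor_add_one (u / (τ / 2))
    push_cast
    exact (div_lt_iff₀ hτ).1 this
  rcases le_total (⌊u / (τ / 2)⌋₊ + 1) n with hle | hle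
  · exact h.iteratedTrajectory_eq hret _ _ p u hp hle hu.1 h1
  · exact (h.iteratedTrajectory_eq hret _ _ p u hp hle hu.1 hu.2).symm

/-- Prepending a flow segment above the plane to a trajectory. -/
lemma exists_trajectory_of_tube (h : AttractingSegment Z Φ p₀ τ s W k)
    (hret : ∀ p ∈ switchingPlane, W p < r → IsReturning Z Φ τ s W k r p) {p : R3} {σ : ℝ}
    (hp : 0 < p 2) (hσ : 0 < σ) (hpos : ∀ t ∈ Set.Ioo 0 σ, 0 < Φ t p 2)
    (hq : IsReturning Z Φ τ s W k r (invol (Φ σ p))) :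
    ∃ φ, φ 0 = p ∧ IsTrajectoryOn Z φ (Set.Ici 0) := by
  obtain ⟨ψ, hψ0, hψ⟩ := h.exists_trajectory hret hq
  have hmem : Φ σ p ∈ crossingRegion Z := by
    have := h.equivariant.invol_mem_crossingRegion hq.mem
    rwa [invol_invol] at this
  have hdown : lieZ Z.X (Φ σ p) < 0 := by
    have := lieZ_Y_pos_of_crossing hq.mem hq.upward
    rw [h.equivariant.lieZ_Y] at this
    linarith
  classical
  refine ⟨fun t => if t ≤ σ then Φ t p else invol (ψ (t + -σ)), ?_,
    IsTrajectoryOn.union σ ?_ ?_⟩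
  · simp only [if_pos hσ.le, h.flow.zero]
  · refine ((h.flow.isTrajectoryOn_Icc hσ (Or.inl hp) hpos hmem hdown).mono
      fun t ht => ⟨ht.1, ht.2⟩).congr fun t ht => ?_
    simp only [if_pos (show t ≤ σ from ht.2)]
  · refine (((hψ.comp_add (-σ)).invol h.equivariant).mono fun t ht => ?_).congr fun t ht => ?_
    · have h2 : σ ≤ t := ht.2
      simp only [Set.mem_preimage, Set.mem_Ici]
      linarith
    · rcases eq_or_lt_of_le (show σ ≤ t from ht.2) with rfl | hlt
      · simp only [le_refl, if_true, add_neg_cancel, hψ0, invol_invol]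
      · simp only [if_neg hlt.not_ge]

end Existence

/-- Points of the plane near the orbit are near `p₀` or near `S p₀`. -/
lemma exists_W_lt_of_plane (h : AttractingSegment Z Φ p₀ τ s W k) {δ' : ℝ} (hδ' : 0 < δ') :
    ∃ δ > 0, ∀ p ∈ switchingPlane, Metric.infDist p (orbitSet Φ p₀ τ) < δ →
      W p < δ' ∨ W (invol p) < δ' := by
  obtain ⟨ε, hε, hW⟩ := Metric.eventually_nhds_iff.1 (h.W_tendsto.eventually (gt_mem_nhds hδ'))
  have hF : IsClosed switchingPlane := isClosed_eq (continuous_apply 2) continuous_const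
  obtain ⟨δ, hδ, hclose⟩ :=
    exists_near_inter_of_infDist h.isCompact_orbitSet hF h.nonempty_orbitSet hε
  refine ⟨δ, hδ, fun p hp hd => ?_⟩
  obtain ⟨q, hq, hpq⟩ := hclose p hp hd
  rw [h.isCrossingSymmetricPeriodicOrbit.2] at hq
  rcases hq with rfl | rfl
  · exact Or.inl (hW hpq)
  · refine Or.inr (hW ?_)
    rwa [← dist_invol, invol_invol]

/-- Points above the plane near the orbit flow to points of the plane near `S p₀`. -/
lemma exists_tube_W_lt (h : AttractingSegment Z Φ p₀ τ s W k) {ε δ' : ℝ} (hε : 0 < ε)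
    (hδ' : 0 < δ') :
    ∃ δ > 0, ∀ p, 0 < p 2 → Metric.infDist p (orbitSet Φ p₀ τ) < δ →
      ∃ σ > 0, Φ σ p ∈ switchingPlane ∧ (∀ t ∈ Set.Ioo 0 σ, 0 < Φ t p 2) ∧
        W (invol (Φ σ p)) < δ' ∧
        ∀ t ∈ Set.Icc 0 σ, Metric.infDist (Φ t p) (orbitSet Φ p₀ τ) < ε := by
  obtain ⟨ε', hε', hW⟩ := Metric.eventually_nhds_iff.1 (h.W_tendsto.eventually (gt_mem_nhds hδ'))
  obtain ⟨δ, hδ, htube⟩ := h.exists_tube (lt_min hε hε')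
  refine ⟨δ, hδ, fun p hp hd => ?_⟩
  obtain ⟨σ, hσ, hz, hpos, hdist, hnear⟩ := htube p hp hd
  refine ⟨σ, hσ, hz, hpos, hW ?_, fun t ht => (hnear t ht).trans_le (min_le_left _ _)⟩
  rw [← dist_invol, invol_invol]
  exact hdist.trans_le (min_le_right _ _)

/-- Trajectories that start near the orbit reach the plane near `p₀` or near `S p₀`. -/
lemma exists_entry (h : AttractingSegment Z Φ p₀ τ s W k) {ε δ' : ℝ} (hε : 0 < ε)
    (hδ' : 0 < δ') :
    ∃ δ > 0, ∀ φ, IsTrajectoryOn Z φ (Set.Ici 0) →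
      Metric.infDist (φ 0) (orbitSet Φ p₀ τ) < δ →
      ∃ σ, 0 ≤ σ ∧ φ σ ∈ switchingPlane ∧ (W (φ σ) < δ' ∨ W (invol (φ σ)) < δ') ∧
        ∀ t ∈ Set.Icc 0 σ, Metric.infDist (φ t) (orbitSet Φ p₀ τ) < ε := by
  obtain ⟨δ₁, hδ₁, hplane⟩ := h.exists_W_lt_of_plane hδ'
  obtain ⟨δ₂, hδ₂, htube⟩ := h.exists_tube_W_lt hε hδ'
  have key : ∀ φ, IsTrajectoryOn Z φ (Set.Ici 0) → 0 < φ 0 2 →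
      Metric.infDist (φ 0) (orbitSet Φ p₀ τ) < δ₂ →
      ∃ σ, 0 ≤ σ ∧ φ σ ∈ switchingPlane ∧ W (invol (φ σ)) < δ' ∧
        ∀ t ∈ Set.Icc 0 σ, Metric.infDist (φ t) (orbitSet Φ p₀ τ) < ε := by
    intro φ hφ h0 hd
    obtain ⟨σ, hσ, hz, hpos, hW, hnear⟩ := htube _ h0 hd
    have heq := h.flow.eqOn_trajectory hφ (Or.inl h0) hpos
    have e1 : φ σ = Φ σ (φ 0) := heq ⟨hσ.le, le_rfl⟩
    refine ⟨σ, hσ.le, by rwa [e1], by rwa [e1], fun t ht => ?_⟩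
    rw [heq ht]
    exact hnear t ht
  refine ⟨min (min δ₁ δ₂) ε, lt_min (lt_min hδ₁ hδ₂) hε, fun φ hφ hd => ?_⟩
  have hd1 := hd.trans_le ((min_le_left _ _).trans (min_le_left _ _))
  have hd2 := hd.trans_le ((min_le_left _ _).trans (min_le_right _ _))
  have hd3 := hd.trans_le (min_le_right _ _)
  rcases lt_trichotomy (φ 0 2) 0 with h0 | h0 | h0
  · obtain ⟨σ, hσ, hz, hW, hnear⟩ := key (fun t => invol (φ t)) (hφ.invol h.equivariant)
      (by simpa using h0) (by rwa [infDist_invol_orbitSet])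
    refine ⟨σ, hσ, invol_mem_switchingPlane.1 hz, Or.inl (by simpa using hW), fun t ht => ?_⟩
    simpa only [infDist_invol_orbitSet] using hnear t ht
  · refine ⟨0, le_rfl, h0, hplane _ h0 hd1, fun t ht => ?_⟩
    rwa [le_antisymm ht.2 ht.1]
  · obtain ⟨σ, hσ, hz, hW, hnear⟩ := key φ hφ h0 hd2
    exact ⟨σ, hσ, hz, Or.inr hW, hnear⟩

theorem isAsymptoticallyStable (h : AttractingSegment Z Φ p₀ τ s W k) :
    IsAsymptoticallyStable Z (orbitSet Φ p₀ τ) := by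
  refine ⟨?_, fun ε hε => ?_, ?_⟩
  · obtain ⟨r, hr, hret⟩ := h.exists_radius
    obtain ⟨δ₁, hδ₁, hplane⟩ := h.exists_W_lt_of_plane hr
    obtain ⟨δ₂, hδ₂, htube⟩ := h.exists_tube_W_lt one_pos hr
    have hinv : ∀ p, (∃ φ, φ 0 = invol p ∧ IsTrajectoryOn Z φ (Set.Ici 0)) →
        ∃ φ, φ 0 = p ∧ IsTrajectoryOn Z φ (Set.Ici 0) := by
      rintro p ⟨φ, h0, hφ⟩
      exact ⟨fun t => invol (φ t), by simp [h0], hφ.invol h.equivariant⟩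
    have key : ∀ p, 0 < p 2 → Metric.infDist p (orbitSet Φ p₀ τ) < δ₂ →
        ∃ φ, φ 0 = p ∧ IsTrajectoryOn Z φ (Set.Ici 0) := by
      intro p hp hd
      obtain ⟨σ, hσ, hz, hpos, hW, -⟩ := htube p hp hd
      exact h.exists_trajectory_of_tube hret hp hσ hpos
        (hret _ (invol_mem_switchingPlane.2 hz) hW)
    refine ⟨min δ₁ δ₂, lt_min hδ₁ hδ₂, fun p hd => ?_⟩
    have hd1 := hd.trans_le (min_le_left _ _)
    have hd2 := hd.trans_le (min_le_right _ _)
    rcases lt_trichotomy (p 2) 0 with h0 | h0 | h0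
    · exact hinv p (key _ (by simpa using h0) (by rwa [infDist_invol_orbitSet]))
    · rcases hplane p h0 hd1 with hW | hW
      · exact h.exists_trajectory hret (hret p h0 hW)
      · exact hinv p (h.exists_trajectory hret (hret _ (invol_mem_switchingPlane.2 h0) hW))
    · exact key p h0 hd2
  · obtain ⟨δ', hδ', hstay⟩ := h.exists_stay hε
    obtain ⟨δ, hδ, hentry⟩ := h.exists_entry hε hδ'
    refine ⟨δ, hδ, fun φ hφ hd t ht => ?_⟩
    obtain ⟨σ, hσ, hz, hW, hnear⟩ := hentry φ hφ hd
    rcases le_or_gt t σ with hts | hts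
    · exact hnear t ⟨ht, hts⟩
    have htraj := hφ.shift_Ici hσ
    rcases hW with hW | hW
    · have := hstay _ htraj (by simpa using hz) (by simpa using hW) (t - σ) (by linarith)
      rwa [sub_add_cancel] at this
    · have := hstay _ (htraj.invol h.equivariant) (by simpa using invol_mem_switchingPlane.2 hz)
        (by simpa using hW) (t - σ) (by linarith)
      rwa [infDist_invol_orbitSet, sub_add_cancel] at this
  · obtain ⟨δ', hδ', hlim⟩ := h.exists_tendsto
    obtain ⟨δ, hδ, hentry⟩ := h.exists_entry one_pos hδ'
    refine ⟨δ, hδ, fun φ hφ hd => ?_⟩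
    obtain ⟨σ, hσ, hz, hW, -⟩ := hentry φ hφ hd
    have htraj := hφ.shift_Ici hσ
    have hshift : Tendsto (fun t => Metric.infDist (φ (t + σ)) (orbitSet Φ p₀ τ)) atTop (𝓝 0) := by
      rcases hW with hW | hW
      · exact hlim _ htraj (by simpa using hz) (by simpa using hW)
      · have := hlim _ (htraj.invol h.equivariant)
          (by simpa using invol_mem_switchingPlane.2 hz) (by simpa using hW)
        simpa only [infDist_invol_orbitSet] using this
    have := hshift.comp (tendsto_atTop_add_const_right atTop (-σ) tendsto_id)
    simpa [Function.comp_def] using this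

lemma orbitSet_subset_range (h : AttractingSegment Z Φ p₀ τ s W k) {φ : ℝ → R3}
    (hφ : IsTrajectoryOn Z φ (Set.Ici 0)) (h0 : φ 0 = p₀) : orbitSet Φ p₀ τ ⊆ Set.range φ := by
  have key : ∀ ψ : ℝ → R3, IsTrajectoryOn Z ψ (Set.Ici 0) → ψ 0 = p₀ →
      Set.EqOn ψ (fun t => Φ t p₀) (Set.Icc 0 τ) := by
    intro ψ hψ h0
    have h2 : ψ 0 2 = 0 := by rw [h0]; exact h.mem.1
    have := h.flow.eqOn_trajectory hψ (Or.inr ⟨h2, by rw [h0]; exact h.upward⟩) (σ := τ)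
      (by rw [h0]; exact h.height_pos)
    rwa [h0] at this
  have h1 := key φ hφ h0
  have e1 : φ τ = invol p₀ := by rw [h1 (Set.right_mem_Icc.2 h.pos.le)]; exact h.endpoint
  have h2 := key (fun t => invol (φ (t + τ))) ((hφ.shift_Ici h.pos.le).invol h.equivariant)
    (by simp [e1])
  rintro _ (⟨t, ht, rfl⟩ | ⟨_, ⟨t, ht, rfl⟩, rfl⟩)
  · exact ⟨t, h1 ht⟩
  · exact ⟨t + τ, by simp only [← h2 ht, invol_invol]⟩

theorem isSymmetricLimitCycle (h : AttractingSegment Z Φ p₀ τ s W k) :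
    IsSymmetricLimitCycle Z (orbitSet Φ p₀ τ) := by
  refine ⟨h.isCrossingSymmetricPeriodicOrbit.1, ?_⟩
  obtain ⟨δ, hδ, hlim⟩ := h.isAsymptoticallyStable.2.2
  refine ⟨{p | Metric.infDist p (orbitSet Φ p₀ τ) < δ},
    isOpen_lt (Metric.continuous_infDist_pt _) continuous_const, fun p hp => ?_, ?_⟩
  · change Metric.infDist p _ < δ
    rwa [Metric.infDist_zero_of_mem hp]
  rintro γ' ⟨φ, T, hT, hφ, hper, -, rfl⟩ hsub
  have hφ0 : IsTrajectoryOn Z φ (Set.Ici 0) := hφ.mono (Set.subset_univ _)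
  have hmem : ∀ t, φ t ∈ orbitSet Φ p₀ τ := by
    intro t
    have hseq : Tendsto (fun n : ℕ => t + n * T) atTop atTop :=
      tendsto_atTop_add_const_left _ _ (tendsto_natCast_atTop_atTop.atTop_mul_const hT)
    have h1 := (hlim φ hφ0 (hsub ⟨0, rfl⟩)).comp hseq
    have h2 : (fun t => Metric.infDist (φ t) (orbitSet Φ p₀ τ)) ∘ (fun n : ℕ => t + n * T) =
        fun _ => Metric.infDist (φ t) (orbitSet Φ p₀ τ) := by
      funext n
      simp only [Function.comp_apply]
      rw [hper.nat_mul n t]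
    rw [h2] at h1
    have h3 := tendsto_nhds_unique tendsto_const_nhds h1
    exact (h.isCompact_orbitSet.isClosed.mem_iff_infDist_zero h.nonempty_orbitSet).2 h3
  refine Set.Subset.antisymm (by rintro _ ⟨t, rfl⟩; exact hmem t) ?_
  obtain ⟨δ', hδ', hentry⟩ := h.exists_entry one_pos one_pos
  obtain ⟨σ, hσ, hz, -, -⟩ := hentry φ hφ0 (by rwa [Metric.infDist_zero_of_mem (hmem 0)])
  have hin : φ σ ∈ ({p₀, invol p₀} : Set R3) :=
    h.isCrossingSymmetricPeriodicOrbit.2 ▸ ⟨hmem σ, hz⟩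
  have htraj := hφ0.shift_Ici hσ
  rcases hin with he | he
  · have := h.orbitSet_subset_range htraj (by simpa using he)
    refine this.trans ?_
    rintro _ ⟨t, rfl⟩
    exact ⟨_, rfl⟩
  · have he : φ σ = invol p₀ := he
    have := h.orbitSet_subset_range (htraj.invol h.equivariant) (by simp [he])
    rw [← invol_image_orbitSet]
    rintro _ ⟨p, hp, rfl⟩
    obtain ⟨t, rfl⟩ := this hp
    exact ⟨t + σ, by simp⟩

end AttractingSegment

section Lyapunov

/-- A positive 2-homogeneous function that decreases along a linear map contracts, with a uniform
factor, along small perturbations of the map. -/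
lemma exists_contraction_of_homogeneous {E : Type*} [NormedAddCommGroup E] [NormedSpace ℝ E]
    [ProperSpace E] [Nontrivial E] {W : E → ℝ} (hc : Continuous W)
    (hhom : ∀ (a : ℝ) v, W (a • v) = a ^ 2 * W v) (hpos : ∀ v ≠ 0, 0 < W v) {M : E →L[ℝ] E}
    (hM : ∀ v ≠ 0, W (M v) < W v) :
    ∃ k η : ℝ, 0 ≤ k ∧ k < 1 ∧ 0 < η ∧ ∀ v e, ‖e‖ ≤ η * ‖v‖ → W (M v + e) ≤ k * W v := by
  have hne : ∀ v ∈ Metric.sphere (0 : E) 1, v ≠ 0 := fun v hv => by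
    rintro rfl
    simp at hv
  have hS : (Metric.sphere (0 : E) 1).Nonempty := NormedSpace.sphere_nonempty.2 zero_le_one
  have hcont : ContinuousOn (fun v => W (M v) / W v) (Metric.sphere (0 : E) 1) :=
    (hc.comp M.continuous).continuousOn.div hc.continuousOn fun v hv => (hpos v (hne v hv)).ne'
  obtain ⟨v₀, hv₀, hmax⟩ := (isCompact_sphere (0 : E) 1).exists_isMaxOn hS hcont
  have hlt : W (M v₀) / W v₀ < 1 :=
    (div_lt_one (hpos v₀ (hne v₀ hv₀))).2 (hM v₀ (hne v₀ hv₀))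
  obtain ⟨k, hk, hk1⟩ := exists_between (max_lt hlt one_pos)
  have hk0 : 0 < k := (le_max_right _ _).trans_lt hk
  have hsph : ∀ᶠ e in 𝓝 (0 : E), ∀ v ∈ Metric.sphere (0 : E) 1, W (M v + e) < k * W v := by
    refine (isCompact_sphere (0 : E) 1).eventually_forall_of_forall_eventually fun v hv => ?_
    have h1 : Continuous fun q : E × E => k * W q.2 - W (M q.2 + q.1) := by fun_prop
    have h2 : 0 < k * W v - W (M v + 0) := by
      have h3 := hpos v (hne v hv)
      have h4 : W (M v) / W v ≤ W (M v₀) / W v₀ := hmax hv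
      have h5 : W (M v) / W v < k := h4.trans_lt ((le_max_left _ _).trans_lt hk)
      rw [add_zero, sub_pos]
      exact (div_lt_iff₀ h3).1 h5
    exact (h1.continuousAt.eventually (lt_mem_nhds h2)).mono fun q hq => sub_pos.1 hq
  obtain ⟨ρ, hρ, hsph⟩ := Metric.eventually_nhds_iff.1 hsph
  refine ⟨k, ρ / 2, hk0.le, hk1, half_pos hρ, fun v e he => ?_⟩
  have hW0 : W 0 = 0 := by simpa using hhom 0 0
  rcases eq_or_ne v 0 with rfl | hv
  · have : e = 0 := by simpa using he
    simp [this, hW0]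
  · have hn : 0 < ‖v‖ := norm_pos_iff.2 hv
    have h1 := @hsph (‖v‖⁻¹ • e) (by
      rw [dist_zero_right, norm_smul, norm_inv, norm_norm, inv_mul_lt_iff₀ hn]
      nlinarith) (‖v‖⁻¹ • v) (by
      rw [mem_sphere_zero_iff_norm, norm_smul, norm_inv, norm_norm, inv_mul_cancel₀ hn.ne'])
    rw [map_smul, ← smul_add, hhom, hhom] at h1
    have h2 : 0 < (‖v‖⁻¹) ^ 2 := by positivity
    nlinarith

/-- The linear part of a second order recurrence with trace `T` and determinant `d`. -/
noncomputable def companionMap (T d : ℝ) : ℝ × ℝ →L[ℝ] ℝ × ℝ :=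
  (ContinuousLinearMap.snd ℝ ℝ ℝ).prod
    (T • ContinuousLinearMap.snd ℝ ℝ ℝ - d • ContinuousLinearMap.fst ℝ ℝ ℝ)

@[simp] lemma companionMap_apply (T d : ℝ) (q : ℝ × ℝ) :
    companionMap T d q = (q.2, T * q.2 - d * q.1) := rfl

/-- A quadratic form that does not increase under `companionMap T d`. -/
def companionForm (T d : ℝ) (q : ℝ × ℝ) : ℝ := (1 + d) * (q.1 ^ 2 + q.2 ^ 2) - 2 * T * q.1 * q.2

variable {T d : ℝ}

lemma companionForm_pos (hT : |T| < 1 + d) {q : ℝ × ℝ} (hq : q ≠ 0) : 0 < companionForm T d q := by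
  obtain ⟨u, v⟩ := q
  rw [abs_lt] at hT
  have h0 : 0 < u ^ 2 + v ^ 2 := by
    by_contra hcon
    apply hq
    have hu : u = 0 := by nlinarith [sq_nonneg u, sq_nonneg v]
    have hv : v = 0 := by nlinarith [sq_nonneg u, sq_nonneg v]
    simp [hu, hv]
  simp only [companionForm]
  rcases le_or_gt 0 (u * v) with h | h
  · nlinarith [sq_nonneg (u - v)]
  · nlinarith [sq_nonneg (u + v)]

lemma companionForm_companionMap (q : ℝ × ℝ) :
    companionForm T d (companionMap T d q) =
      companionForm T d q - (1 - d) * (T * q.2 - d * q.1 - q.1) ^ 2 := by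
  simp only [companionForm, companionMap_apply]
  ring

lemma companionForm_two_lt (hd : d < 1) (hT : |T| < 1 + d) {q : ℝ × ℝ} (hq : q ≠ 0) :
    companionForm T d (companionMap T d (companionMap T d q)) < companionForm T d q := by
  rw [companionForm_companionMap, companionForm_companionMap]
  by_contra hcon
  push Not at hcon
  have hd' : 0 < 1 - d := by linarith
  have h1 := mul_nonneg hd'.le (sq_nonneg (T * q.2 - d * q.1 - q.1))
  have h2 := mul_nonneg hd'.le (sq_nonneg (T * (companionMap T d q).2 -
    d * (companionMap T d q).1 - (companionMap T d q).1))
  have h3 : (1 - d) * (T * q.2 - d * q.1 - q.1) ^ 2 = 0 := by linarith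
  have h4 : (1 - d) * (T * (companionMap T d q).2 -
    d * (companionMap T d q).1 - (companionMap T d q).1) ^ 2 = 0 := by linarith
  have e1 : T * q.2 - d * q.1 - q.1 = 0 := by simpa [hd'.ne'] using h3
  have e2 : T * (T * q.2 - d * q.1) - d * q.2 - q.2 = 0 := by
    simpa [hd'.ne', companionMap_apply] using h4
  have e3 : (1 + d) * q.1 = T * q.2 := by linarith
  have e4 : (1 + d) * q.2 = T * q.1 := by
    have : T * q.2 - d * q.1 = q.1 := by linarith
    rw [this] at e2
    linarith
  rw [abs_lt] at hT
  have hpos : 0 < (1 + d) ^ 2 - T ^ 2 := by nlinarith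
  have e5 : ((1 + d) ^ 2 - T ^ 2) * q.1 = 0 := by linear_combination (1 + d) * e3 + T * e4
  have e6 : ((1 + d) ^ 2 - T ^ 2) * q.2 = 0 := by linear_combination (1 + d) * e4 + T * e3
  refine hq (Prod.ext ?_ ?_)
  · simpa [hpos.ne'] using e5
  · simpa [hpos.ne'] using e6

/-- Existence of a Lyapunov function for planar maps whose derivative at a fixed point satisfies
the Jury conditions. -/
theorem exists_lyapunov (hd : d < 1) (hT : |T| < 1 + d) :
    ∃ W : ℝ × ℝ → ℝ, Continuous W ∧ (∀ q, 0 ≤ W q) ∧ W 0 = 0 ∧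
      (∃ c > 0, ∀ q, c * ‖q‖ ^ 2 ≤ W q) ∧
      ∀ N : ℝ × ℝ → ℝ × ℝ, N 0 = 0 → HasFDerivAt N (companionMap T d) 0 →
        ∃ k : ℝ, 0 ≤ k ∧ k < 1 ∧ ∀ᶠ q in 𝓝 0, W (N q) ≤ k * W q := by
  set W : ℝ × ℝ → ℝ := fun q => companionForm T d q + companionForm T d (companionMap T d q)
  have hc : Continuous W := by
    simp only [W, companionForm, companionMap_apply]
    fun_prop
  have hhom : ∀ (a : ℝ) v, W (a • v) = a ^ 2 * W v := by
    intro a v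
    simp only [W, companionForm, companionMap_apply, Prod.smul_fst, Prod.smul_snd, smul_eq_mul]
    ring
  have hform0 : ∀ q, 0 ≤ companionForm T d q := by
    intro q
    rcases eq_or_ne q 0 with rfl | hq
    · simp [companionForm]
    · exact (companionForm_pos hT hq).le
  have hpos : ∀ v ≠ 0, 0 < W v := fun v hv =>
    add_pos_of_pos_of_nonneg (companionForm_pos hT hv) (hform0 _)
  have hM : ∀ v ≠ 0, W (companionMap T d v) < W v := by
    intro v hv
    have := companionForm_two_lt hd hT hv
    simp only [W]
    linarith
  have hW0 : W 0 = 0 := by simp [W, companionForm]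
  obtain ⟨k, η, hk0, hk1, hη, hcon⟩ := exists_contraction_of_homogeneous hc hhom hpos hM
  refine ⟨W, hc, fun q => ?_, hW0, ?_, fun N hN0 hN => ⟨k, hk0, hk1, ?_⟩⟩
  · exact add_nonneg (hform0 _) (hform0 _)
  · have hS : (Metric.sphere (0 : ℝ × ℝ) 1).Nonempty := NormedSpace.sphere_nonempty.2 zero_le_one
    obtain ⟨v₀, hv₀, hmin⟩ := (isCompact_sphere (0 : ℝ × ℝ) 1).exists_isMinOn hS hc.continuousOn
    refine ⟨W v₀, hpos v₀ (by rintro rfl; simp at hv₀), fun q => ?_⟩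
    rcases eq_or_ne q 0 with rfl | hq
    · simp [hW0]
    · have hn : 0 < ‖q‖ := norm_pos_iff.2 hq
      have h1 : W v₀ ≤ W (‖q‖⁻¹ • q) := hmin (by
        rw [mem_sphere_zero_iff_norm, norm_smul, norm_inv, norm_norm, inv_mul_cancel₀ hn.ne'])
      rw [hhom, inv_pow, inv_mul_eq_div, le_div_iff₀ (by positivity)] at h1
      exact h1
  · have hlittle := (hasFDerivAt_iff_isLittleO_nhds_zero.1 hN).def hη
    filter_upwards [hlittle] with q hq
    rw [zero_add, hN0, sub_zero] at hq
    have := hcon q (N q - companionMap T d q) hq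
    rwa [add_sub_cancel] at this

end Lyapunov

/-- The function `e^{Ct} - cos t - C sin t`, which governs the half return map of a focus. -/
noncomputable def focal (C t : ℝ) : ℝ := Real.exp (C * t) - Real.cos t - C * Real.sin t

/-- The crossing coordinate of the planar focus at distance `K` as a function of the flight time:
`crossing K (-C)` at departure and `crossing K C` at arrival. -/
noncomputable def crossing (K C t : ℝ) : ℝ := K * focal C t / -Real.sin t

/-- The value of the parameter `H` for which there is a symmetric orbit with half period `t`. -/
noncomputable def branchH (C t : ℝ) : ℝ :=
  (focal C t * Real.exp (-C * t) + focal (-C) t * Real.exp (C * t)) /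
    (focal C t * Real.exp (C * t) + focal (-C) t * Real.exp (-C * t))

/-- The right end of the range of half periods that we use. -/
noncomputable def maxTime (C : ℝ) : ℝ := Real.pi + 1 / (1 + 2 * C)

section Scalar

variable {C K t : ℝ}

lemma sin_neg_of_mem (h : t ∈ Set.Ioo Real.pi (2 * Real.pi)) : Real.sin t < 0 := by
  have := Real.sin_pos_of_pos_of_lt_pi (x := t - Real.pi) (by linarith [h.1]) (by linarith [h.2])
  rw [Real.sin_sub_pi] at this
  linarith

lemma hasStrictDerivAt_focal (C t : ℝ) :
    HasStrictDerivAt (focal C) (C * Real.exp (C * t) + Real.sin t - C * Real.cos t) t := by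
  have h1 : HasStrictDerivAt (fun t => Real.exp (C * t)) (C * Real.exp (C * t)) t := by
    have := ((hasStrictDerivAt_id t).const_mul C).exp
    simpa [mul_comm] using this
  exact ((h1.fun_sub (Real.hasStrictDerivAt_cos t)).fun_sub
    ((Real.hasStrictDerivAt_sin t).const_mul C)).congr_deriv (by ring)

lemma hasStrictDerivAt_crossing (K C : ℝ) (ht : Real.sin t ≠ 0) :
    HasStrictDerivAt (crossing K C)
      (-(K * Real.exp (C * t) * focal (-C) t / Real.sin t ^ 2)) t := by
  have h1 := ((hasStrictDerivAt_focal C t).const_mul K).fun_div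
    (Real.hasStrictDerivAt_sin t).fun_neg (neg_ne_zero.2 ht)
  refine h1.congr_deriv ?_
  have h2 : Real.exp (C * t) * Real.exp (-C * t) = 1 := by
    rw [← Real.exp_add]; simp
  have h3 := Real.sin_sq_add_cos_sq t
  rw [neg_sq, ← neg_div, focal, focal]
  congr 1
  linear_combination K * h2 - K * h3

lemma focal_pos (hC : 0 < C) (ht : t ∈ Set.Ioo Real.pi (2 * Real.pi)) : 0 < focal C t := by
  have h1 := sin_neg_of_mem ht
  have h2 := Real.cos_le_one t
  have h3 : 1 < Real.exp (C * t) := Real.one_lt_exp_iff.2 (mul_pos hC (Real.pi_pos.trans ht.1))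
  unfold focal
  nlinarith [mul_neg_of_pos_of_neg hC h1]

lemma focal_pi (C : ℝ) : focal C Real.pi = Real.exp (C * Real.pi) + 1 := by
  simp [focal]

lemma focal_neg_pos_of_le_pi (h0 : 0 < t) (h1 : t ≤ Real.pi) :
    0 < focal (-C) t := by
  have hd : ∀ u, HasDerivAt (fun u => Real.exp (C * u) * focal (-C) u)
      ((1 + C ^ 2) * Real.exp (C * u) * Real.sin u) u := by
    intro u
    have h1 : HasDerivAt (fun t => Real.exp (C * t)) (C * Real.exp (C * u)) u := by
      have := ((hasDerivAt_id u).const_mul C).exp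
      simpa [mul_comm] using this
    refine (h1.fun_mul (hasStrictDerivAt_focal (-C) u).hasDerivAt).congr_deriv ?_
    rw [focal]
    ring
  have hmono : StrictMonoOn (fun u => Real.exp (C * u) * focal (-C) u) (Set.Icc 0 Real.pi) := by
    refine strictMonoOn_of_deriv_pos (convex_Icc _ _)
      (fun u _ => (hd u).continuousAt.continuousWithinAt) fun u hu => ?_
    rw [interior_Icc] at hu
    rw [(hd u).deriv]
    have := Real.sin_pos_of_pos_of_lt_pi hu.1 hu.2
    positivity
  have := hmono (Set.left_mem_Icc.2 Real.pi_pos.le) ⟨h0.le, h1⟩ h0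
  have e0 : focal (-C) 0 = 0 := by simp [focal]
  simp only [e0, mul_zero] at this
  exact (pos_iff_pos_of_mul_pos this).1 (Real.exp_pos _)

lemma maxTime_lt (hC : 0 < C) : maxTime C < 2 * Real.pi := by
  have h1 : 1 / (1 + 2 * C) < 1 := by rw [div_lt_one (by positivity)]; linarith
  have := Real.pi_gt_three
  unfold maxTime
  linarith

lemma pi_lt_maxTime (hC : 0 < C) : Real.pi < maxTime C := by
  unfold maxTime
  have : 0 < 1 / (1 + 2 * C) := by positivity
  linarith

lemma focal_neg_pos (hC : 0 < C) (ht : t ∈ Set.Icc Real.pi (maxTime C)) : 0 < focal (-C) t := by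
  obtain ⟨θ, rfl⟩ : ∃ θ, t = θ + Real.pi := ⟨t - Real.pi, by ring⟩
  have h0 : 0 ≤ θ := by linarith [ht.1]
  have h1 : θ ≤ 1 / (1 + 2 * C) := by have := ht.2; unfold maxTime at this; linarith
  rw [le_div_iff₀ (by positivity)] at h1
  have h2 : θ ≤ 1 := by nlinarith
  have h3 := Real.one_sub_sq_div_two_le_cos (x := θ)
  have h4 := Real.sin_le h0
  have h5 := Real.exp_pos (-C * (θ + Real.pi))
  rw [focal, Real.cos_add_pi, Real.sin_add_pi]
  nlinarith

lemma focal_neg_lt (hC : 0 < C) (ht : t ∈ Set.Icc Real.pi (2 * Real.pi)) :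
    focal (-C) t < focal C t := by
  have h1 : Real.sin t ≤ 0 := by
    have := Real.sin_nonneg_of_nonneg_of_le_pi (x := t - Real.pi) (by linarith [ht.1])
      (by linarith [ht.2])
    rw [Real.sin_sub_pi] at this
    linarith
  have h2 : Real.exp (-C * t) < Real.exp (C * t) := by
    have := mul_pos hC (Real.pi_pos.trans_le ht.1)
    exact Real.exp_lt_exp.2 (by linarith)
  unfold focal
  nlinarith [mul_nonneg hC.le (neg_nonneg.2 h1)]

lemma focal_neg_mul_exp_lt (hC : 0 < C) (ht : t ∈ Set.Ioo Real.pi (2 * Real.pi)) :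
    focal (-C) t * Real.exp (C * t) < focal C t := by
  have h1 := sin_neg_of_mem ht
  have h2 := Real.neg_one_le_cos t
  have h3 : 1 < Real.exp (C * t) := Real.one_lt_exp_iff.2 (mul_pos hC (Real.pi_pos.trans ht.1))
  have h4 : Real.exp (-C * t) * Real.exp (C * t) = 1 := by
    rw [← Real.exp_add]; simp
  have h5 : focal (-C) t * Real.exp (C * t) =
      1 + (C * Real.sin t - Real.cos t) * Real.exp (C * t) := by
    rw [focal]; linear_combination h4
  rw [h5, focal]
  nlinarith [mul_pos hC (neg_pos.2 h1)]

lemma crossing_neg_strictAntiOn (hC : 0 < C) (hK : 0 < K) :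
    StrictAntiOn (crossing K (-C)) (Set.Ioo Real.pi (2 * Real.pi)) := by
  have hd : ∀ t ∈ Set.Ioo Real.pi (2 * Real.pi), HasStrictDerivAt (crossing K (-C)) _ t :=
    fun t ht => hasStrictDerivAt_crossing K (-C) (sin_neg_of_mem ht).ne
  refine strictAntiOn_of_deriv_neg (convex_Ioo _ _)
    (fun t ht => (hd t ht).hasDerivAt.continuousAt.continuousWithinAt) fun t ht => ?_
  rw [interior_Ioo] at ht
  rw [(hd t ht).hasDerivAt.deriv, neg_neg]
  have h1 := focal_pos hC ht
  have h2 := sq_pos_of_neg (sin_neg_of_mem ht)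
  have : 0 < K * Real.exp (-C * t) * focal C t / Real.sin t ^ 2 := by positivity
  linarith

/-- The height along the planar flow line with flight time `τ` is positive before `τ`. -/
lemma height_pos_of_crossing (hC : 0 < C) (hK : 0 < K) {τ : ℝ}
    (hτ : τ ∈ Set.Ioo Real.pi (2 * Real.pi)) (hy : 0 ≤ crossing K (-C) τ)
    (ht : t ∈ Set.Ioo 0 τ) :
    0 < K * focal (-C) t + crossing K (-C) τ * Real.sin t := by
  rcases le_or_gt t Real.pi with h | h
  · have h1 := focal_neg_pos_of_le_pi (C := C) ht.1 h
    have h2 := Real.sin_nonneg_of_nonneg_of_le_pi ht.1.le h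
    have := mul_nonneg hy h2
    have := mul_pos hK h1
    linarith
  · have ht' : t ∈ Set.Ioo Real.pi (2 * Real.pi) := ⟨h, ht.2.trans hτ.2⟩
    have h1 := crossing_neg_strictAntiOn hC hK ht' hτ ht.2
    have h2 := sin_neg_of_mem ht'
    have h3 : crossing K (-C) t * (-Real.sin t) = K * focal (-C) t :=
      div_mul_cancel₀ _ (by linarith)
    nlinarith

lemma branchH_pi (C : ℝ) : branchH C Real.pi = criticalH C := by
  have h2 : Real.exp (C * Real.pi) * Real.exp (-(C * Real.pi)) = 1 := by
    rw [← Real.exp_add]; simp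
  have hp := Real.exp_pos (C * Real.pi)
  have hq := Real.exp_pos (-(C * Real.pi))
  rw [branchH, criticalH, focal_pi, focal_pi, Real.cosh_eq, mul_comm Real.pi C]
  simp only [neg_mul]
  set a := Real.exp (C * Real.pi)
  set b := Real.exp (-(C * Real.pi))
  have h3 : 0 < 2 * ((a + b) / 2) - 1 := by nlinarith [sq_nonneg (a - b)]
  rw [div_eq_div_iff (by positivity) h3.ne']
  linear_combination (2 * a + 2 * b) * h2

lemma hasDerivAt_branchH (hC : 0 < C) (ht : t ∈ Set.Icc Real.pi (maxTime C)) :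
    ∃ D, D < 0 ∧ HasDerivAt (branchH C) D t := by
  have ht2 : t ∈ Set.Icc Real.pi (2 * Real.pi) := ⟨ht.1, ht.2.trans (maxTime_lt hC).le⟩
  have hψ := focal_neg_pos hC ht
  have hlt := focal_neg_lt hC ht2
  have hφ := hψ.trans hlt
  have e1 : ∀ c : ℝ, HasDerivAt (fun t => Real.exp (c * t)) (c * Real.exp (c * t)) t := by
    intro c
    have := ((hasDerivAt_id t).const_mul c).exp
    simpa [mul_comm] using this
  have f1 := (hasStrictDerivAt_focal C t).hasDerivAt
  have f2 := (hasStrictDerivAt_focal (-C) t).hasDerivAt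
  have hN := ((f1.fun_mul (e1 (-C))).fun_add (f2.fun_mul (e1 C))).congr_deriv (g' :=
    (1 + C ^ 2) * Real.sin t * (Real.exp (C * t) + Real.exp (-C * t))) (by
      rw [focal, focal]; ring)
  have hD := ((f1.fun_mul (e1 C)).fun_add (f2.fun_mul (e1 (-C)))).congr_deriv (g' :=
    (1 + C ^ 2) * Real.sin t * (Real.exp (C * t) + Real.exp (-C * t)) +
      2 * C * (focal C t * Real.exp (C * t) - focal (-C) t * Real.exp (-C * t))) (by
      rw [focal, focal]; ring)
  have hpos : 0 < focal C t * Real.exp (C * t) + focal (-C) t * Real.exp (-C * t) := by positivity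
  have hfin := hN.fun_div hD hpos.ne'
  have hab : Real.exp (C * t) * Real.exp (-C * t) = 1 := by
    rw [← Real.exp_add]; simp
  have hba : Real.exp (-C * t) < Real.exp (C * t) := by
    have := mul_pos hC (Real.pi_pos.trans_le ht.1)
    exact Real.exp_lt_exp.2 (by linarith)
  have hs : Real.sin t ≤ 0 := by
    have := Real.sin_nonneg_of_nonneg_of_le_pi (x := t - Real.pi) (by linarith [ht2.1])
      (by linarith [ht2.2])
    rw [Real.sin_sub_pi] at this
    linarith
  have hneg : ∀ D0 : ℝ, D0 = (1 + C ^ 2) * Real.sin t * (Real.exp (C * t) + Real.exp (-C * t)) *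
      (focal C t - focal (-C) t) * (Real.exp (C * t) - Real.exp (-C * t)) -
      2 * C * (focal C t * Real.exp (-C * t) + focal (-C) t * Real.exp (C * t)) *
      (focal C t * Real.exp (C * t) - focal (-C) t * Real.exp (-C * t)) → D0 < 0 := by
    rintro D0 rfl
    have h1 : 0 ≤ (1 + C ^ 2) * (-Real.sin t) * (Real.exp (C * t) + Real.exp (-C * t)) *
      (focal C t - focal (-C) t) * (Real.exp (C * t) - Real.exp (-C * t)) := by
      have := sub_pos.2 hlt
      have := sub_pos.2 hba
      have := neg_nonneg.2 hs
      positivity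
    have h2 : 0 < focal C t * Real.exp (C * t) - focal (-C) t * Real.exp (-C * t) := by
      have := mul_lt_mul'' hlt hba hψ.le (Real.exp_pos _).le
      linarith
    have h3 : 0 < 2 * C * (focal C t * Real.exp (-C * t) + focal (-C) t * Real.exp (C * t)) *
      (focal C t * Real.exp (C * t) - focal (-C) t * Real.exp (-C * t)) := by positivity
    nlinarith
  refine ⟨_, div_neg_of_neg_of_pos (hneg _ ?_) (by positivity), hfin⟩
  ring

lemma branchH_strictAntiOn (hC : 0 < C) :
    StrictAntiOn (branchH C) (Set.Icc Real.pi (maxTime C)) := by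
  refine strictAntiOn_of_deriv_neg (convex_Icc _ _) (fun t ht => ?_) fun t ht => ?_
  · obtain ⟨D, -, hD⟩ := hasDerivAt_branchH hC ht
    exact hD.continuousAt.continuousWithinAt
  · obtain ⟨D, hD0, hD⟩ := hasDerivAt_branchH hC (interior_subset ht)
    rwa [hD.deriv]

lemma branchH_continuousOn (hC : 0 < C) :
    ContinuousOn (branchH C) (Set.Icc Real.pi (maxTime C)) := fun t ht => by
  obtain ⟨D, -, hD⟩ := hasDerivAt_branchH hC ht
  exact hD.continuousAt.continuousWithinAt

/-- The Jury conditions for the half return map, in terms of `a = e^{Ct}`, `φ = focal C t`,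
`ψ = focal (-C) t` and `S = sin t`. -/
lemma jury_of_focal {C H a φ ψ S : ℝ} (hC : 0 < C) (ha : 1 < a) (haC : 2 * C < a) (hS : S < 0)
    (hS1 : -1 ≤ S) (hψ : 0 < ψ) (hψφ : ψ < φ) (hψa : ψ * a < φ) (hH : 0 < H)
    (heq : H * (φ * a + ψ * a⁻¹) = φ * a⁻¹ + ψ * a) :
    |H * (a ^ 2 * ψ / φ) + H * (a⁻¹) ^ 2 + 2 * C * a⁻¹ * S * (φ - H * ψ) / φ| < 1 + ψ / φ := by
  have hφ : 0 < φ := hψ.trans hψφ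
  have ha0 : 0 < a := one_pos.trans ha
  obtain ⟨b, hb⟩ : ∃ b, b = a⁻¹ := ⟨_, rfl⟩
  have hab : a * b = 1 := by rw [hb]; exact mul_inv_cancel₀ ha0.ne'
  rw [← hb] at heq ⊢
  have hb0 : 0 < b := by rw [hb]; positivity
  have hb1 : b < 1 := by nlinarith
  have e : H * (a ^ 2 * ψ / φ) + H * b ^ 2 + 2 * C * b * S * (φ - H * ψ) / φ =
      (H * a ^ 2 * ψ + H * b ^ 2 * φ + 2 * C * b * S * (φ - H * ψ)) / φ := by
    field_simp
  have e2 : 1 + ψ / φ = (φ + ψ) / φ := by field_simp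
  rw [e, e2, abs_div, abs_of_pos hφ, div_lt_div_iff_of_pos_right hφ, abs_lt]
  constructor
  · have h1 : 2 * C * b < 1 := by nlinarith
    have h2 : 0 < 2 * C * b := by positivity
    have h3 : 2 * C * b * (-S) < 1 := by nlinarith
    have h4 : 0 < 2 * C * b * (-S) := mul_pos h2 (neg_pos.2 hS)
    have h5 : 0 < H * ψ := by positivity
    have h6 : 0 < H * a ^ 2 * ψ + H * b ^ 2 * φ := by positivity
    nlinarith
  · have hD : 0 < φ * a + ψ * b := by positivity
    have key : 0 < (φ + ψ - (H * a ^ 2 * ψ + H * b ^ 2 * φ + 2 * C * b * S * (φ - H * ψ))) *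
        (φ * a + ψ * b) := by
      have e3 : (φ + ψ - (H * a ^ 2 * ψ + H * b ^ 2 * φ + 2 * C * b * S * (φ - H * ψ))) *
        (φ * a + ψ * b) = (a ^ 2 - b ^ 2) * (φ ^ 2 * b - ψ ^ 2 * a) +
          2 * C * (-S) * (φ ^ 2 - ψ ^ 2) := by
        linear_combination (2 * C * b * S * ψ - (a ^ 2 * ψ + b ^ 2 * φ)) * heq -
          (2 * C * S * (φ ^ 2 - ψ ^ 2) + (φ ^ 2 * a + φ * ψ * b + φ * ψ * a + ψ ^ 2 * b)) * hab
      rw [e3]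
      have h1 : 0 < a ^ 2 - b ^ 2 := by nlinarith
      have h2 : 0 < φ ^ 2 * b - ψ ^ 2 * a := by
        have : φ ^ 2 * b - ψ ^ 2 * a = b * (φ ^ 2 - (ψ * a) ^ 2) := by
          linear_combination (ψ ^ 2 * a) * hab
        rw [this]
        have h3 : 0 < ψ * a := by positivity
        have : 0 < φ ^ 2 - (ψ * a) ^ 2 := by nlinarith
        positivity
      have h3 : 0 < φ ^ 2 - ψ ^ 2 := by nlinarith
      have h4 : 0 < -S := by linarith
      positivity
    have := (pos_iff_pos_of_mul_pos key).2 hD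
    linarith

end Scalar

section Flow

/-- The flow of the upper field of the canonical form. -/
noncomputable def canonicalFlow (A C H Λ t : ℝ) (p : R3) : R3 :=
  let K := Λ / (1 + C ^ 2)
  let u := p 2 - K
  let v := p 1 + C * p 2 + C * K
  let z := K + Real.exp (C * t) * (u * Real.cos t + v * Real.sin t)
  let y := -2 * C * K + Real.exp (C * t) *
    ((v - C * u) * Real.cos t - (C * v + u) * Real.sin t)
  ![H * (y + A * z) + Real.exp (A * t) * (p 0 - H * (p 1 + A * p 2)), y, z]

variable (A C H Λ : ℝ)

lemma canonicalFlow_two (t : ℝ) (p : R3) : canonicalFlow A C H Λ t p 2 =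
    Λ / (1 + C ^ 2) + Real.exp (C * t) * ((p 2 - Λ / (1 + C ^ 2)) * Real.cos t +
      (p 1 + C * p 2 + C * (Λ / (1 + C ^ 2))) * Real.sin t) := rfl

lemma canonicalFlow_one (t : ℝ) (p : R3) : canonicalFlow A C H Λ t p 1 =
    -2 * C * (Λ / (1 + C ^ 2)) + Real.exp (C * t) *
      ((p 1 + C * p 2 + C * (Λ / (1 + C ^ 2)) - C * (p 2 - Λ / (1 + C ^ 2))) * Real.cos t -
      (C * (p 1 + C * p 2 + C * (Λ / (1 + C ^ 2))) + (p 2 - Λ / (1 + C ^ 2))) * Real.sin t) := rfl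

lemma canonicalFlow_zero (t : ℝ) (p : R3) : canonicalFlow A C H Λ t p 0 =
    H * (canonicalFlow A C H Λ t p 1 + A * canonicalFlow A C H Λ t p 2) +
      Real.exp (A * t) * (p 0 - H * (p 1 + A * p 2)) := rfl

lemma isFlow_canonicalFlow : IsFlow (canonicalField A C H Λ).X (canonicalFlow A C H Λ) where
  zero p := by
    have h2 : canonicalFlow A C H Λ 0 p 2 = p 2 := by rw [canonicalFlow_two]; simp
    have h1 : canonicalFlow A C H Λ 0 p 1 = p 1 := by rw [canonicalFlow_one]; simp; ring
    ext i
    fin_cases i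
    · simp only [Fin.zero_eta, canonicalFlow_zero, h1, h2, mul_zero, Real.exp_zero]; ring
    · exact h1
    · exact h2
  add s t p := by
    have h2 : canonicalFlow A C H Λ s (canonicalFlow A C H Λ t p) 2 =
        canonicalFlow A C H Λ (s + t) p 2 := by
      simp only [canonicalFlow_two, canonicalFlow_one, mul_add, Real.exp_add, Real.cos_add,
        Real.sin_add]
      ring
    have h1 : canonicalFlow A C H Λ s (canonicalFlow A C H Λ t p) 1 =
        canonicalFlow A C H Λ (s + t) p 1 := by
      simp only [canonicalFlow_two, canonicalFlow_one, mul_add, Real.exp_add, Real.cos_add,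
        Real.sin_add]
      ring
    ext i
    fin_cases i
    · simp only [Fin.zero_eta, canonicalFlow_zero A C H Λ s, canonicalFlow_zero A C H Λ (s + t),
        h1, h2]
      rw [canonicalFlow_zero A C H Λ t, mul_add A s t, Real.exp_add]
      ring
    · exact h1
    · exact h2
  deriv t p := by
    have e1 : ∀ c : ℝ, HasDerivAt (fun t => Real.exp (c * t)) (c * Real.exp (c * t)) t := by
      intro c
      have := ((hasDerivAt_id t).const_mul c).exp
      simpa [mul_comm] using this
    have hc : (1 + C ^ 2) * (Λ / (1 + C ^ 2)) = Λ := mul_div_cancel₀ _ (by positivity)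
    have osc : ∀ m n k : ℝ, HasDerivAt
        (fun t => k + Real.exp (C * t) * (m * Real.cos t + n * Real.sin t))
        (Real.exp (C * t) * ((C * m + n) * Real.cos t + (C * n - m) * Real.sin t)) t := by
      intro m n k
      refine (((e1 C).fun_mul (((Real.hasDerivAt_cos t).const_mul m).fun_add
        ((Real.hasDerivAt_sin t).const_mul n))).const_add k).congr_deriv ?_
      ring
    have h2 : HasDerivAt (fun s => canonicalFlow A C H Λ s p 2)
        ((canonicalField A C H Λ).X.eval (canonicalFlow A C H Λ t p) 2) t := by
      refine (osc _ _ _).congr_deriv ?_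
      rw [canonicalField_X_two, canonicalFlow_two, canonicalFlow_one]
      ring
    have h1 : HasDerivAt (fun s => canonicalFlow A C H Λ s p 1)
        ((canonicalField A C H Λ).X.eval (canonicalFlow A C H Λ t p) 1) t := by
      have := osc (p 1 + C * p 2 + C * (Λ / (1 + C ^ 2)) - C * (p 2 - Λ / (1 + C ^ 2)))
        (-(C * (p 1 + C * p 2 + C * (Λ / (1 + C ^ 2))) + (p 2 - Λ / (1 + C ^ 2))))
        (-2 * C * (Λ / (1 + C ^ 2)))
      simp only [neg_mul, ← sub_eq_add_neg] at this
      have e : (fun s => canonicalFlow A C H Λ s p 1) = _ := funext fun s => by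
        rw [canonicalFlow_one]
      rw [e]
      simp only [neg_mul]
      refine this.congr_deriv ?_
      rw [canonicalField_X_one, canonicalFlow_two]
      linear_combination hc
    rw [hasDerivAt_pi]
    intro i
    fin_cases i
    · have h0 := ((h1.fun_add (h2.const_mul A)).const_mul H).fun_add
        ((e1 A).mul_const (p 0 - H * (p 1 + A * p 2)))
      refine h0.congr_deriv ?_
      simp only [Fin.zero_eta, canonicalField_X_zero, canonicalField_X_one, canonicalField_X_two,
        canonicalFlow_zero]
      ring
    · exact h1
    · exact h2
  cont := by
    refine continuous_pi fun i => ?_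
    fin_cases i
    · simp only [Fin.zero_eta, Function.uncurry_def, canonicalFlow_zero, canonicalFlow_one,
        canonicalFlow_two]
      fun_prop
    · simp only [Fin.mk_one, Function.uncurry_def, canonicalFlow_one]
      fun_prop
    · simp only [Fin.reduceFinMk, Function.uncurry_def, canonicalFlow_two]
      fun_prop

variable {A C H Λ} {p : R3} {t : ℝ}

lemma canonicalFlow_two_of_plane (hp : p 2 = 0) : canonicalFlow A C H Λ t p 2 =
    Real.exp (C * t) * (Λ / (1 + C ^ 2) * focal (-C) t + p 1 * Real.sin t) := by
  have h : Real.exp (C * t) * Real.exp (-C * t) = 1 := by rw [← Real.exp_add]; simp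
  rw [canonicalFlow_two, hp, focal]
  linear_combination (-(Λ / (1 + C ^ 2))) * h

/-- The height vanishes at the flight time. -/
lemma canonicalFlow_two_eq_zero (hp : p 2 = 0) (ht : Real.sin t ≠ 0)
    (hy : p 1 = crossing (Λ / (1 + C ^ 2)) (-C) t) : canonicalFlow A C H Λ t p 2 = 0 := by
  have h : crossing (Λ / (1 + C ^ 2)) (-C) t * (-Real.sin t) = Λ / (1 + C ^ 2) * focal (-C) t :=
    div_mul_cancel₀ _ (neg_ne_zero.2 ht)
  rw [canonicalFlow_two_of_plane hp, hy]
  linear_combination -Real.exp (C * t) * h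

lemma canonicalFlow_one_eq (hp : p 2 = 0) (ht : Real.sin t ≠ 0)
    (hy : p 1 = crossing (Λ / (1 + C ^ 2)) (-C) t) :
    canonicalFlow A C H Λ t p 1 = -crossing (Λ / (1 + C ^ 2)) C t := by
  have h : Real.exp (C * t) * Real.exp (-C * t) = 1 := by rw [← Real.exp_add]; simp
  have h3 := Real.sin_sq_add_cos_sq t
  have h1 : crossing (Λ / (1 + C ^ 2)) (-C) t * (-Real.sin t) = Λ / (1 + C ^ 2) * focal (-C) t :=
    div_mul_cancel₀ _ (neg_ne_zero.2 ht)
  have h2 : crossing (Λ / (1 + C ^ 2)) C t * (-Real.sin t) = Λ / (1 + C ^ 2) * focal C t :=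
    div_mul_cancel₀ _ (neg_ne_zero.2 ht)
  rw [canonicalFlow_one, hp, hy]
  apply mul_right_cancel₀ (neg_ne_zero.2 ht)
  rw [focal] at h1 h2
  linear_combination Real.exp (C * t) * (Real.cos t - C * Real.sin t) * h1 + h2 +
    Λ / (1 + C ^ 2) * (Real.cos t - C * Real.sin t) * h -
    Real.exp (C * t) * (Λ / (1 + C ^ 2)) * h3

/-- The half return map in terms of the flight time. -/
lemma invol_canonicalFlow (hp : p 2 = 0) (ht : Real.sin t ≠ 0)
    (hy : p 1 = crossing (Λ / (1 + C ^ 2)) (-C) t) :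
    invol (canonicalFlow A C H Λ t p) = ![crossing (Λ / (1 + C ^ 2)) C t,
      H * crossing (Λ / (1 + C ^ 2)) C t - Real.exp (A * t) * (p 0 - H * p 1), 0] := by
  have h2 := canonicalFlow_two_eq_zero (A := A) (H := H) hp ht hy
  have h1 := canonicalFlow_one_eq (A := A) (H := H) hp ht hy
  ext i
  fin_cases i
  · simp [h1]
  · simp [canonicalFlow_zero A C H Λ t, h1, h2, hp]; ring
  · simp [h2]

end Flow

/-- The crossing point of the symmetric orbit with half period `t`. -/
noncomputable def crossingPoint (Λ C t : ℝ) : R3 :=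
  ![crossing (Λ / (1 + C ^ 2)) C t, crossing (Λ / (1 + C ^ 2)) (-C) t, 0]

lemma crossing_pos {K C t : ℝ} (hK : 0 < K) (hf : 0 < focal C t) (hs : Real.sin t < 0) :
    0 < crossing K C t := div_pos (mul_pos hK hf) (neg_pos.2 hs)

/-- The equation of symmetric orbits: the half return map fixes the crossing point. -/
lemma crossing_fixed {K C H t : ℝ} (hs : Real.sin t ≠ 0)
    (heq : H * (focal C t * Real.exp (C * t) + focal (-C) t * Real.exp (-C * t)) =
      focal C t * Real.exp (-C * t) + focal (-C) t * Real.exp (C * t)) :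
    H * crossing K C t - Real.exp (-2 * C * t) * (crossing K C t - H * crossing K (-C) t) =
      crossing K (-C) t := by
  have h : Real.exp (C * t) * Real.exp (-C * t) = 1 := by rw [← Real.exp_add]; simp
  have h2 : Real.exp (-2 * C * t) = Real.exp (-C * t) ^ 2 := by
    rw [← Real.exp_nat_mul]; congr 1; push_cast; ring
  have e1 : crossing K C t * (-Real.sin t) = K * focal C t :=
    div_mul_cancel₀ _ (neg_ne_zero.2 hs)
  have e2 : crossing K (-C) t * (-Real.sin t) = K * focal (-C) t :=
    div_mul_cancel₀ _ (neg_ne_zero.2 hs)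
  apply mul_right_cancel₀ (neg_ne_zero.2 hs)
  rw [h2]
  set a := Real.exp (C * t)
  set b := Real.exp (-C * t)
  linear_combination (H - b ^ 2) * e1 + (b ^ 2 * H - 1) * e2 + K * b * heq +
    (K * focal (-C) t - H * K * focal C t) * h

lemma hasFDerivAt_halfReturn {f e : ℝ → ℝ} {x₀ y₀ H b c e' : ℝ} (hb : b ≠ 0)
    (hf : HasDerivAt f b 0) (he : HasDerivAt e e' 0) (he0 : e 0 = c) :
    HasFDerivAt (fun q : ℝ × ℝ => ((f q.2 - x₀) / b,
      H * f q.2 - e q.2 * (x₀ + b * q.1 - H * (y₀ + q.2)) - y₀))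
      (companionMap (H * b + H * c - e' * (x₀ - H * y₀)) (b * c)) 0 := by
  have hsnd : HasFDerivAt (Prod.snd : ℝ × ℝ → ℝ) (ContinuousLinearMap.snd ℝ ℝ ℝ) 0 :=
    hasFDerivAt_snd
  have hfst : HasFDerivAt (Prod.fst : ℝ × ℝ → ℝ) (ContinuousLinearMap.fst ℝ ℝ ℝ) 0 :=
    hasFDerivAt_fst
  have hα2 := HasDerivAt.comp_hasFDerivAt (0 : ℝ × ℝ) (f := Prod.snd) hf hsnd
  have hβ2 := HasDerivAt.comp_hasFDerivAt (0 : ℝ × ℝ) (f := Prod.snd) he hsnd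
  have h1 := (hα2.sub_const x₀).mul_const b⁻¹
  have h2 := ((hα2.const_mul H).sub (hβ2.mul (((hfst.const_mul b).const_add x₀).sub
    ((hsnd.const_add y₀).const_mul H)))).sub_const y₀
  refine (h1.prodMk h2).congr_fderiv ?_
  ext
  · simp [companionMap]
  · simp [companionMap, he0, mul_comm]
  · simp [companionMap, hb]
  · simp [companionMap, he0]
    ring

/-- On the range of half periods the symmetric orbit is an attracting segment. -/
theorem exists_attractingSegment {C H Λ t : ℝ} (hC : 0 < C) (hΛ : 0 < Λ)
    (ht : t ∈ Set.Ioo Real.pi (maxTime C)) (hH : branchH C t = H) :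
    ∃ s W k, AttractingSegment (canonicalField (-2 * C) C H Λ) (canonicalFlow (-2 * C) C H Λ)
      (crossingPoint Λ C t) t s W k := by
  have ht2 : t ∈ Set.Ioo Real.pi (2 * Real.pi) := ⟨ht.1, ht.2.trans (maxTime_lt hC)⟩
  set K := Λ / (1 + C ^ 2) with hKdef
  have hK : 0 < K := by positivity
  have hsin := sin_neg_of_mem ht2
  have hψ : 0 < focal (-C) t := focal_neg_pos hC ⟨ht.1.le, ht.2.le⟩
  have hφ : 0 < focal C t := focal_pos hC ht2
  have hψφ := focal_neg_lt hC ⟨ht2.1.le, ht2.2.le⟩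
  set x₀ := crossing K C t with hx₀
  set y₀ := crossing K (-C) t with hy₀
  have hx₀pos : 0 < x₀ := crossing_pos hK hφ hsin
  have hy₀pos : 0 < y₀ := crossing_pos hK hψ hsin
  have hDpos : 0 < focal C t * Real.exp (C * t) + focal (-C) t * Real.exp (-C * t) := by
    positivity
  have heq : H * (focal C t * Real.exp (C * t) + focal (-C) t * Real.exp (-C * t)) =
      focal C t * Real.exp (-C * t) + focal (-C) t * Real.exp (C * t) := by
    rw [← hH, branchH, div_mul_cancel₀ _ hDpos.ne']
  have hHpos : 0 < H := by rw [← hH, branchH]; positivity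
  have hfix : H * x₀ - Real.exp (-2 * C * t) * (x₀ - H * y₀) = y₀ := crossing_fixed hsin.ne heq
  -- the flight time as a function of the departure coordinate
  have hY := hasStrictDerivAt_crossing K (-C) hsin.ne
  have hF := hasStrictDerivAt_crossing K C hsin.ne
  rw [neg_neg] at hY
  set Y' := -(K * Real.exp (-C * t) * focal C t / Real.sin t ^ 2) with hY'
  set F' := -(K * Real.exp (C * t) * focal (-C) t / Real.sin t ^ 2) with hF'
  have hsq : 0 < Real.sin t ^ 2 := sq_pos_of_neg hsin
  have hYneg : Y' < 0 := neg_neg_of_pos (by positivity)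
  have hFneg : F' < 0 := neg_neg_of_pos (by positivity)
  set σ := hY.localInverse _ _ _ hYneg.ne with hσ
  have hσd : HasStrictDerivAt σ Y'⁻¹ y₀ := hY.to_localInverse hYneg.ne
  have hσ0 : σ y₀ = t := (hY.eventually_left_inverse hYneg.ne).self_of_nhds
  have hσr : ∀ᶠ y in 𝓝 y₀, crossing K (-C) (σ y) = y := hY.eventually_right_inverse hYneg.ne
  have hσc : Tendsto σ (𝓝 y₀) (𝓝 t) := by
    have := hσd.hasDerivAt.continuousAt.tendsto
    rwa [hσ0] at this
  -- the linear part of the half return map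
  set b := F' * Y'⁻¹ with hb
  set c := Real.exp (-2 * C * t) with hc
  set T := H * b + H * c + 2 * C * c * Y'⁻¹ * (x₀ - H * y₀) with hT
  have hbpos : 0 < b := mul_pos_of_neg_of_neg hFneg (inv_lt_zero.2 hYneg)
  set a := Real.exp (C * t) with ha
  have hainv : Real.exp (-C * t) = a⁻¹ := by rw [ha, ← Real.exp_neg]; congr 1; ring
  have hcval : c = (a⁻¹) ^ 2 := by
    rw [← hainv, hc, ← Real.exp_nat_mul]; congr 1; push_cast; ring
  have ha0 : 0 < a := Real.exp_pos _
  have hbval : b = a ^ 2 * focal (-C) t / focal C t := by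
    have := hsin.ne
    rw [hb, hF', hY', hainv]
    field_simp
  have hd : b * c = focal (-C) t / focal C t := by
    rw [hbval, hcval]
    field_simp
  have hTval : T = H * (a ^ 2 * focal (-C) t / focal C t) + H * (a⁻¹) ^ 2 +
      2 * C * a⁻¹ * Real.sin t * (focal C t - H * focal (-C) t) / focal C t := by
    rw [hT, hbval, hcval, hY', hainv, hx₀, hy₀, crossing, crossing]
    have := hsin.ne
    field_simp
    ring
  have hd1 : b * c < 1 := by rw [hd]; exact (div_lt_one hφ).2 hψφ
  have hjury : |T| < 1 + b * c := by
    rw [hTval, hd]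
    have hCt : 0 < C * t := mul_pos hC (Real.pi_pos.trans ht.1)
    refine jury_of_focal hC (Real.one_lt_exp_iff.2 hCt) ?_ hsin (Real.neg_one_le_sin t) hψ hψφ
      (focal_neg_mul_exp_lt hC ht2) hHpos ?_
    · have h1 := Real.add_one_le_exp (C * t)
      have h2 := Real.pi_gt_three
      have h3 := ht.1
      nlinarith
    · rw [← hainv]; exact heq
  obtain ⟨V, hVc, hV0, hVz, ⟨m, hm, hVm⟩, hVcon⟩ := exists_lyapunov hd1 hjury
  -- the half return map in rescaled coordinates
  set N : ℝ × ℝ → ℝ × ℝ := fun q =>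
    ((crossing K C (σ (y₀ + q.2)) - x₀) / b,
      H * crossing K C (σ (y₀ + q.2)) -
        Real.exp (-2 * C * σ (y₀ + q.2)) * (x₀ + b * q.1 - H * (y₀ + q.2)) - y₀) with hN
  have hN0 : N 0 = 0 := by
    simp only [hN, Prod.snd_zero, Prod.fst_zero, add_zero, mul_zero, hσ0]
    rw [← hx₀, ← hc, hfix]
    simp
  have hNd : HasFDerivAt N (companionMap T (b * c)) 0 := by
    have hshift : HasDerivAt (fun v : ℝ => σ (y₀ + v)) Y'⁻¹ 0 := by
      have : HasDerivAt σ Y'⁻¹ (y₀ + 0) := by rw [add_zero]; exact hσd.hasDerivAt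
      exact this.comp_const_add y₀ 0
    have hα : HasDerivAt (fun v : ℝ => crossing K C (σ (y₀ + v))) b 0 := by
      have : HasDerivAt (crossing K C) F' (σ (y₀ + 0)) := by
        rw [add_zero, hσ0]; exact hF.hasDerivAt
      exact this.comp (0 : ℝ) hshift
    have hβ : HasDerivAt (fun v : ℝ => Real.exp (-2 * C * σ (y₀ + v)))
        (c * (-2 * C * Y'⁻¹)) 0 := by
      have := (hshift.const_mul (-2 * C)).exp
      rwa [add_zero, hσ0] at this
    refine (hasFDerivAt_halfReturn hbpos.ne' hα hβ (by rw [add_zero, hσ0])).congr_fderiv ?_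
    congr 1
    rw [hT]
    ring
  obtain ⟨k, hk0, hk1, hk⟩ := hVcon N hN0 hNd
  set L : R3 → ℝ × ℝ := fun p => ((p 0 - x₀) / b, p 1 - y₀) with hL
  have hLc : Continuous L := by
    simp only [hL]
    fun_prop
  have hp0 : crossingPoint Λ C t 0 = x₀ := rfl
  have hp1 : crossingPoint Λ C t 1 = y₀ := rfl
  have hp2 : crossingPoint Λ C t 2 = 0 := rfl
  have hL0 : L (crossingPoint Λ C t) = 0 := by simp [hL, hp0, hp1]
  have hLt : Tendsto L (𝓝 (crossingPoint Λ C t)) (𝓝 0) := hL0 ▸ hLc.tendsto _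
  have hp1t : Tendsto (fun p : R3 => p 1) (𝓝 (crossingPoint Λ C t)) (𝓝 y₀) :=
    (continuous_apply (A := fun _ : Fin 3 => ℝ) 1).tendsto (crossingPoint Λ C t)
  have hpos : ∀ (p : R3) (u : ℝ), p 2 = 0 → u ∈ Set.Ioo Real.pi (2 * Real.pi) → 0 ≤ p 1 →
      p 1 = crossing K (-C) u → ∀ r ∈ Set.Ioo 0 u, 0 < canonicalFlow (-2 * C) C H Λ r p 2 := by
    intro p u hp hu hp1 hpu r hr
    rw [canonicalFlow_two_of_plane hp]
    rw [hpu] at hp1 ⊢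
    exact mul_pos (Real.exp_pos _) (height_pos_of_crossing hC hK hu hp1 hr)
  refine ⟨fun p => σ (p 1), fun p => V (L p), k, ?_⟩
  refine
    { equivariant := equivariant_canonicalField _ _ _ _
      flow := isFlow_canonicalFlow _ _ _ _
      mem := ⟨hp2, ?_⟩
      upward := ?_
      pos := Real.pi_pos.trans ht.1
      endpoint := ?_
      height_pos := hpos _ t hp2 ht2 (hp1 ▸ hy₀pos.le) hp1
      k_nonneg := hk0
      k_lt_one := hk1
      W_nonneg := fun p => hV0 _
      W_tendsto := ?_
      W_small := fun ε hε => ?_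
      s_tendsto := (hσc.comp hp1t).mono_left nhdsWithin_le_nhds
      return_map := ?_ }
  · rw [lieZ_canonicalField_X, lieZ_canonicalField_Y, hp0, hp1, hp2]
    simpa using mul_pos hy₀pos hx₀pos
  · rw [lieZ_canonicalField_X, hp1, hp2]
    simpa using hy₀pos
  · rw [← invol_eq_iff, invol_canonicalFlow hp2 hsin.ne hp1, hp0, hp1, hfix]
    rfl
  · have := hVc.tendsto 0
    rw [hVz] at this
    exact this.comp hLt
  · have hρ : 0 < min ε (ε / b) := lt_min hε (div_pos hε hbpos)
    refine ⟨m * min ε (ε / b) ^ 2, by positivity, fun p hp hW => ?_⟩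
    have h1 : ‖L p‖ ^ 2 < min ε (ε / b) ^ 2 := lt_of_mul_lt_mul_left ((hVm _).trans_lt hW) hm.le
    have h2 := lt_of_pow_lt_pow_left₀ 2 hρ.le h1
    have h3 : |(p 0 - x₀) / b| < ε / b :=
      ((norm_fst_le (L p)).trans_lt h2).trans_le (min_le_right _ _)
    have h4 : |p 1 - y₀| < ε := ((norm_snd_le (L p)).trans_lt h2).trans_le (min_le_left _ _)
    rw [abs_div, abs_of_pos hbpos, div_lt_div_iff_of_pos_right hbpos] at h3
    rw [dist_pi_lt_iff hε]
    intro i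
    fin_cases i
    · exact h3
    · exact h4
    · have hp : p 2 = 0 := hp
      simpa [hp, hp2] using hε
  · have e1 : ∀ᶠ p in 𝓝 (crossingPoint Λ C t), crossing K (-C) (σ (p 1)) = p 1 :=
      hp1t.eventually hσr
    have e2 : ∀ᶠ p in 𝓝 (crossingPoint Λ C t), σ (p 1) ∈ Set.Ioo Real.pi (2 * Real.pi) :=
      (hσc.comp hp1t).eventually (Ioo_mem_nhds ht2.1 ht2.2)
    have e3 : ∀ᶠ p in 𝓝 (crossingPoint Λ C t), 0 < p 1 := hp1t.eventually (lt_mem_nhds hy₀pos)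
    have e4 : ∀ᶠ p in 𝓝 (crossingPoint Λ C t), V (N (L p)) ≤ k * V (L p) := hLt.eventually hk
    filter_upwards [(e1.and e2).filter_mono nhdsWithin_le_nhds,
      (e3.and e4).filter_mono nhdsWithin_le_nhds, self_mem_nhdsWithin] with p ⟨h1, h2⟩ ⟨h3, h4⟩ hp
    have hp : p 2 = 0 := hp
    have hs := (sin_neg_of_mem h2).ne
    refine ⟨canonicalFlow_two_eq_zero hp hs h1.symm, hpos p _ hp h2 h3.le h1.symm, ?_⟩
    convert h4 using 2
    rw [invol_canonicalFlow hp hs h1.symm]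
    simp only [hL, hN, Matrix.cons_val_zero, Matrix.cons_val_one, add_sub_cancel,
      mul_div_cancel₀ _ hbpos.ne']
    rfl

section Branch

/-- The half period of the symmetric orbit with parameters `C` and `H`. -/
noncomputable def halfPeriod (C H : ℝ) : ℝ :=
  Function.invFunOn (branchH C) (Set.Icc Real.pi (maxTime C)) H

/-- The region of parameters `(C, H)` covered by the branch of symmetric orbits for `C > 0`. -/
def stabilityRegion : Set (ℝ × ℝ) :=
  {q | 0 < q.1 ∧ branchH q.1 (maxTime q.1) < q.2 ∧ q.2 < criticalH q.1}

variable {C H : ℝ}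

lemma halfPeriod_mem (h : (C, H) ∈ stabilityRegion) :
    halfPeriod C H ∈ Set.Ioo Real.pi (maxTime C) ∧ branchH C (halfPeriod C H) = H := by
  obtain ⟨hC, h1, h2⟩ := h
  simp only at hC h1 h2
  rw [← branchH_pi] at h2
  have hex : ∃ t ∈ Set.Icc Real.pi (maxTime C), branchH C t = H :=
    intermediate_value_Icc' (pi_lt_maxTime hC).le (branchH_continuousOn hC) ⟨h1.le, h2.le⟩
  have hmem : halfPeriod C H ∈ Set.Icc Real.pi (maxTime C) := Function.invFunOn_mem hex
  have heq : branchH C (halfPeriod C H) = H := Function.invFunOn_eq hex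
  refine ⟨⟨lt_of_le_of_ne hmem.1 fun he => ?_, lt_of_le_of_ne hmem.2 fun he => ?_⟩, heq⟩
  · rw [← he] at heq
    exact h2.ne' heq
  · rw [he] at heq
    exact h1.ne heq

lemma halfPeriod_lt (h : (C, H) ∈ stabilityRegion) {t : ℝ}
    (ht : t ∈ Set.Icc Real.pi (maxTime C)) (hlt : branchH C t < H) : halfPeriod C H < t := by
  obtain ⟨h1, h2⟩ := halfPeriod_mem h
  by_contra hcon
  have := (branchH_strictAntiOn h.1).antitoneOn ht ⟨h1.1.le, h1.2.le⟩ (not_lt.1 hcon)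
  linarith

lemma lt_halfPeriod (h : (C, H) ∈ stabilityRegion) {t : ℝ}
    (ht : t ∈ Set.Icc Real.pi (maxTime C)) (hlt : H < branchH C t) : t < halfPeriod C H := by
  obtain ⟨h1, h2⟩ := halfPeriod_mem h
  by_contra hcon
  have := (branchH_strictAntiOn h.1).antitoneOn ⟨h1.1.le, h1.2.le⟩ ht (not_lt.1 hcon)
  linarith

lemma continuousAt_branchH {t : ℝ} (hC : 0 < C) (ht : t ∈ Set.Icc Real.pi (maxTime C)) :
    ContinuousAt (fun q : ℝ × ℝ => branchH q.1 q.2) (C, t) := by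
  have hψ := focal_neg_pos hC ht
  have hφ := hψ.trans (focal_neg_lt hC ⟨ht.1, ht.2.trans (maxTime_lt hC).le⟩)
  unfold branchH
  refine ContinuousAt.div ?_ ?_ (by positivity)
  · unfold focal
    fun_prop
  · unfold focal
    fun_prop

lemma continuous_criticalH : Continuous criticalH := by
  unfold criticalH
  refine continuous_const.div (by fun_prop) fun C => ?_
  linarith [Real.one_le_cosh (Real.pi * C)]

lemma criticalH_neg (C : ℝ) : criticalH (-C) = criticalH C := by
  rw [criticalH, criticalH, mul_neg, Real.cosh_neg]

lemma continuousAt_maxTime (hC : 0 < C) : ContinuousAt maxTime C := by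
  unfold maxTime
  exact continuousAt_const.add (continuousAt_const.div (by fun_prop) (by positivity))

lemma continuousAt_branchH_maxTime (hC : 0 < C) :
    ContinuousAt (fun C => branchH C (maxTime C)) C :=
  ContinuousAt.comp (g := fun q : ℝ × ℝ => branchH q.1 q.2) (f := fun C => (C, maxTime C))
    (continuousAt_branchH hC ⟨(pi_lt_maxTime hC).le, le_rfl⟩)
    (continuousAt_id.prodMk (continuousAt_maxTime hC))

lemma isOpen_stabilityRegion : IsOpen stabilityRegion := by
  rw [isOpen_iff_mem_nhds]
  rintro ⟨C, H⟩ ⟨hC, h1, h2⟩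
  have hfst : ContinuousAt (Prod.fst : ℝ × ℝ → ℝ) (C, H) := continuousAt_fst
  have hsnd : ContinuousAt (Prod.snd : ℝ × ℝ → ℝ) (C, H) := continuousAt_snd
  have e1 := hfst.eventually (lt_mem_nhds hC)
  have e2 := ContinuousAt.eventually_lt (ContinuousAt.comp (f := Prod.fst) (x := (C, H))
    (continuousAt_branchH_maxTime hC) hfst) hsnd h1
  have e3 := ContinuousAt.eventually_lt hsnd (continuous_criticalH.continuousAt.comp hfst) h2
  filter_upwards [e1, e2, e3] with q q1 q2 q3
  exact ⟨q1, q2, q3⟩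

lemma branchH_maxTime_lt (hC : 0 < C) : branchH C (maxTime C) < criticalH C := by
  rw [← branchH_pi]
  exact branchH_strictAntiOn hC ⟨le_rfl, (pi_lt_maxTime hC).le⟩ ⟨(pi_lt_maxTime hC).le, le_rfl⟩
    (pi_lt_maxTime hC)

lemma eventually_mem_stabilityRegion (hC : 0 < C) :
    ∀ᶠ H in 𝓝[<] (criticalH C), (C, H) ∈ stabilityRegion := by
  filter_upwards [Ioo_mem_nhdsLT (branchH_maxTime_lt hC)] with H hH
  exact ⟨hC, hH.1, hH.2⟩

lemma continuousAt_halfPeriod {q : ℝ × ℝ} (hq : q ∈ stabilityRegion) :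
    ContinuousAt (fun q : ℝ × ℝ => halfPeriod q.1 q.2) q := by
  obtain ⟨C, H⟩ := q
  have hC : 0 < C := hq.1
  obtain ⟨hmem, heq⟩ := halfPeriod_mem hq
  set t := halfPeriod C H
  have hfst : ContinuousAt (Prod.fst : ℝ × ℝ → ℝ) (C, H) := continuousAt_fst
  have hsnd : ContinuousAt (Prod.snd : ℝ × ℝ → ℝ) (C, H) := continuousAt_snd
  have hbranch : ∀ u ∈ Set.Icc Real.pi (maxTime C),
      ContinuousAt (fun q : ℝ × ℝ => branchH q.1 u) (C, H) := fun u hu =>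
    ContinuousAt.comp (g := fun q : ℝ × ℝ => branchH q.1 q.2) (f := fun q : ℝ × ℝ => (q.1, u))
      (continuousAt_branchH hC hu) (hfst.prodMk continuousAt_const)
  have hB := isOpen_stabilityRegion.mem_nhds hq
  have hmax : ContinuousAt (fun q : ℝ × ℝ => maxTime q.1) (C, H) :=
    ContinuousAt.comp (f := Prod.fst) (x := (C, H)) (continuousAt_maxTime hC) hfst
  refine tendsto_order.2 ⟨fun a ha => ?_, fun a ha => ?_⟩
  · obtain ⟨u, hu, hut⟩ := exists_between (max_lt ha hmem.1)
    have hu' : u ∈ Set.Icc Real.pi (maxTime C) :=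
      ⟨((le_max_right _ _).trans_lt hu).le, (hut.trans hmem.2).le⟩
    have hlt : H < branchH C u := by
      rw [← heq]
      exact branchH_strictAntiOn hC hu' ⟨hmem.1.le, hmem.2.le⟩ hut
    filter_upwards [hB, hsnd.eventually_lt (hbranch u hu') hlt,
      hmax.eventually (lt_mem_nhds (hut.trans hmem.2))] with q hqB hqu hqm
    exact ((le_max_left _ _).trans_lt hu).trans (lt_halfPeriod hqB ⟨hu'.1, le_of_lt hqm⟩ hqu)
  · obtain ⟨u, hut, hu⟩ := exists_between (lt_min ha hmem.2)
    have hum : u < maxTime C := hu.trans_le (min_le_right _ _)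
    have hu' : u ∈ Set.Icc Real.pi (maxTime C) := ⟨(hmem.1.trans hut).le, hum.le⟩
    have hlt : branchH C u < H := by
      conv_rhs => rw [← heq]
      exact branchH_strictAntiOn hC ⟨hmem.1.le, hmem.2.le⟩ hu' hut
    filter_upwards [hB, (hbranch u hu').eventually_lt hsnd hlt,
      hmax.eventually (lt_mem_nhds hum)] with q hqB hqu hqm
    exact (halfPeriod_lt hqB ⟨hu'.1, le_of_lt hqm⟩ hqu).trans (hu.trans_le (min_le_left _ _))

lemma tendsto_halfPeriod (hC : 0 < C) :
    Tendsto (fun H => halfPeriod C H) (𝓝[<] (criticalH C)) (𝓝[>] Real.pi) := by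
  refine tendsto_nhdsWithin_iff.2 ⟨tendsto_order.2 ⟨fun a ha => ?_, fun a ha => ?_⟩, ?_⟩
  · filter_upwards [eventually_mem_stabilityRegion hC] with H hH
    exact ha.trans (halfPeriod_mem hH).1.1
  · obtain ⟨u, hu1, hu2⟩ := exists_between (lt_min ha (pi_lt_maxTime hC))
    have hu : u ∈ Set.Icc Real.pi (maxTime C) := ⟨hu1.le, hu2.le.trans (min_le_right _ _)⟩
    have hlt : branchH C u < criticalH C := by
      rw [← branchH_pi]
      exact branchH_strictAntiOn hC ⟨le_rfl, (pi_lt_maxTime hC).le⟩ hu hu1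
    filter_upwards [eventually_mem_stabilityRegion hC, Ioo_mem_nhdsLT hlt] with H hH hH'
    exact (halfPeriod_lt hH hu hH'.1).trans (hu2.trans_le (min_le_left _ _))
  · filter_upwards [eventually_mem_stabilityRegion hC] with H hH
    exact (halfPeriod_mem hH).1.1

lemma tendsto_crossing_atTop {K : ℝ} (hK : 0 < K) (C : ℝ) :
    Tendsto (crossing K C) (𝓝[>] Real.pi) atTop := by
  have h1 : Tendsto (fun t => K * focal C t) (𝓝[>] Real.pi) (𝓝 (K * focal C Real.pi)) :=
    ((hasStrictDerivAt_focal C Real.pi).hasDerivAt.continuousAt.const_mul K).tendsto.mono_left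
      nhdsWithin_le_nhds
  have h2 : Tendsto (fun t => -Real.sin t) (𝓝[>] Real.pi) (𝓝[>] 0) := by
    refine tendsto_nhdsWithin_iff.2 ⟨?_, ?_⟩
    · have := (Real.continuous_sin.neg.tendsto Real.pi).mono_left
        (nhdsWithin_le_nhds (s := Set.Ioi Real.pi))
      simpa [Pi.neg_def] using this
    · filter_upwards [Ioo_mem_nhdsGT (show Real.pi < 2 * Real.pi by linarith [Real.pi_pos])]
        with t ht
      exact neg_pos.2 (sin_neg_of_mem ht)
  have h3 : 0 < K * focal C Real.pi := by rw [focal_pi]; positivity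
  exact h1.pos_mul_atTop h3 h2.inv_tendsto_nhdsGT_zero

/-- A crossing point of the symmetric limit cycle, as a function of the parameters. -/
noncomputable def cyclePoint (Λ : ℝ) (q : ℝ × ℝ) : R3 :=
  open Classical in
  if 0 < q.1 then crossingPoint Λ q.1 (halfPeriod q.1 q.2)
  else reversal (crossingPoint Λ (-q.1) (halfPeriod (-q.1) q.2))

variable {Λ : ℝ}

lemma exists_stable_limitCycle (hΛ : 0 < Λ) (h : (C, H) ∈ stabilityRegion) :
    ∃ γ, IsSymmetricLimitCycle (canonicalField (-2 * C) C H Λ) γ ∧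
      crossingPoint Λ C (halfPeriod C H) ∈ γ ∩ switchingPlane ∧
      IsAsymptoticallyStable (canonicalField (-2 * C) C H Λ) γ := by
  obtain ⟨hmem, heq⟩ := halfPeriod_mem h
  obtain ⟨s, W, k, hA⟩ := exists_attractingSegment h.1 hΛ hmem heq
  refine ⟨_, hA.isSymmetricLimitCycle, ⟨?_, rfl⟩, hA.isAsymptoticallyStable⟩
  have := AttractingSegment.mem_orbitSet (Φ := canonicalFlow (-2 * C) C H Λ)
    (p₀ := crossingPoint Λ C (halfPeriod C H)) (Set.left_mem_Icc.2 hA.pos.le)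
  rwa [hA.flow.zero] at this

lemma tendsto_norm_crossingPoint (hΛ : 0 < Λ) (hC : 0 < C) :
    Tendsto (fun H => ‖crossingPoint Λ C (halfPeriod C H)‖) (𝓝[<] (criticalH C)) atTop := by
  have hK : 0 < Λ / (1 + C ^ 2) := by positivity
  refine tendsto_atTop_mono (fun H => ?_)
    ((tendsto_crossing_atTop hK C).comp (tendsto_halfPeriod hC))
  exact (le_abs_self _).trans (norm_le_pi_norm (crossingPoint Λ C (halfPeriod C H)) 0)

lemma continuousOn_cyclePoint : ContinuousOn (cyclePoint Λ) stabilityRegion := by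
  have hcong : Set.EqOn (cyclePoint Λ)
      (fun q : ℝ × ℝ => crossingPoint Λ q.1 (halfPeriod q.1 q.2)) stabilityRegion :=
    fun q hq => if_pos hq.1
  refine ContinuousOn.congr (fun q hq => ContinuousAt.continuousWithinAt ?_) hcong
  have hτ := continuousAt_halfPeriod hq
  have hmem := (halfPeriod_mem hq).1
  have hs : Real.sin (halfPeriod q.1 q.2) ≠ 0 :=
    (sin_neg_of_mem ⟨hmem.1, hmem.2.trans (maxTime_lt hq.1)⟩).ne
  have hcr : ∀ s : ℝ, ContinuousAt
      (fun q : ℝ × ℝ => crossing (Λ / (1 + q.1 ^ 2)) (s * q.1) (halfPeriod q.1 q.2)) q := by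
    intro s
    unfold crossing focal
    have hK : ContinuousAt (fun q : ℝ × ℝ => Λ / (1 + q.1 ^ 2)) q :=
      continuousAt_const.div (by fun_prop) (by positivity)
    exact ContinuousAt.div (by fun_prop) (by fun_prop) (neg_ne_zero.2 hs)
  refine continuousAt_pi.2 fun i => ?_
  fin_cases i
  · simpa [crossingPoint] using hcr 1
  · simpa [crossingPoint] using hcr (-1)
  · simpa [crossingPoint] using continuousAt_const

lemma eventually_symmetricLimitCycle (hΛ : 0 < Λ) (hC : C ≠ 0) :
    ∀ᶠ H in 𝓝[<] (criticalH C), ∃ γ,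
      IsSymmetricLimitCycle (canonicalField (-2 * C) C H Λ) γ ∧
      cyclePoint Λ (C, H) ∈ γ ∩ switchingPlane := by
  rcases lt_or_gt_of_ne hC with hneg | hpos
  · have hC' : 0 < -C := neg_pos.2 hneg
    rw [← criticalH_neg]
    filter_upwards [eventually_mem_stabilityRegion hC'] with H hH
    obtain ⟨γ, hγ, ⟨hmem, hplane⟩, -⟩ := exists_stable_limitCycle hΛ hH
    have hrev := isReversalOf_canonicalField (-2 * -C) (-C) H Λ
    rw [neg_neg, show -(-2 * -C) = -2 * C by ring] at hrev
    refine ⟨_, hrev.isSymmetricLimitCycle hγ, ?_⟩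
    rw [cyclePoint, if_neg hneg.not_gt]
    exact ⟨⟨_, hmem, rfl⟩, hplane⟩
  · filter_upwards [eventually_mem_stabilityRegion hpos] with H hH
    obtain ⟨γ, hγ, hmem, -⟩ := exists_stable_limitCycle hΛ hH
    refine ⟨γ, hγ, ?_⟩
    rwa [cyclePoint, if_pos hpos]

lemma tendsto_norm_cyclePoint (hΛ : 0 < Λ) (hC : C ≠ 0) :
    Tendsto (fun H => ‖cyclePoint Λ (C, H)‖) (𝓝[<] (criticalH C)) atTop := by
  rcases lt_or_gt_of_ne hC with hneg | hpos
  · rw [← criticalH_neg]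
    simpa only [cyclePoint, if_neg hneg.not_gt, norm_reversal] using
      tendsto_norm_crossingPoint hΛ (neg_pos.2 hneg)
  · simpa only [cyclePoint, if_pos hpos] using tendsto_norm_crossingPoint hΛ hpos

end Branch

end PWL

theorem theorem1 :
    -- (a) characterization of crossing symmetric periodic orbits by successive crossings
    (∀ Z : PWL.PiecewiseField, PWL.ClassS Z →
      ∀ (φ : ℝ → PWL.R3) (t₀ t₁ x₀ y₀ x₁ y₁ : ℝ), t₀ < t₁ →
        PWL.IsTrajectoryOn Z φ (Set.Icc t₀ t₁) →
        φ t₀ = ![x₀, y₀, 0] → φ t₁ = ![x₁, y₁, 0] →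
        (∀ t ∈ Set.Ioo t₀ t₁, φ t ∉ PWL.switchingPlane) →
        ((∃ γ : Set PWL.R3, PWL.IsCrossingSymmetricPeriodicOrbit Z γ ∧
            φ '' Set.Icc t₀ t₁ ⊆ γ) ↔
          (x₁ = -y₀ ∧ y₁ = -x₀))) ∧
    -- the resonant canonical fields belong to the equivariant class
    (∀ C H Λ : ℝ, C ≠ 0 →
      PWL.ClassS (PWL.canonicalField (-2 * C) C H Λ) ∧
      PWL.IsResonant (PWL.canonicalField (-2 * C) C H Λ)) ∧
    -- `ξ Λ (C, H)` is a crossing point of the large-amplitude cycle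
    (∃ ξ : ℝ → ℝ × ℝ → PWL.R3,
      -- (b) existence of symmetric limit cycles of arbitrarily large amplitude
      (∀ Λ C : ℝ, 0 < Λ → C ≠ 0 →
        (∀ᶠ H in 𝓝[<] (PWL.criticalH C),
          ∃ γ : Set PWL.R3,
            PWL.IsSymmetricLimitCycle (PWL.canonicalField (-2 * C) C H Λ) γ ∧
            ξ Λ (C, H) ∈ γ ∩ PWL.switchingPlane) ∧
        Tendsto (fun H => ‖ξ Λ (C, H)‖) (𝓝[<] (PWL.criticalH C)) atTop) ∧
      -- (c) the stability region
      (∃ B : Set (ℝ × ℝ), IsOpen B ∧ B.Nonempty ∧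
        (∀ C : ℝ, 0 < C → ∀ᶠ H in 𝓝[<] (PWL.criticalH C), (C, H) ∈ B) ∧
        ∀ Λ : ℝ, 0 < Λ →
          ContinuousOn (ξ Λ) B ∧
          ∀ C H : ℝ, (C, H) ∈ B →
            ∃ γ : Set PWL.R3,
              PWL.IsSymmetricLimitCycle (PWL.canonicalField (-2 * C) C H Λ) γ ∧
              ξ Λ (C, H) ∈ γ ∩ PWL.switchingPlane ∧
              PWL.IsAsymptoticallyStable (PWL.canonicalField (-2 * C) C H Λ) γ)) := by
  refine ⟨?_, fun C H Λ hC => ⟨?_, PWL.isResonant_canonicalField H Λ hC⟩, PWL.cyclePoint,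
    fun Λ C hΛ hC => ⟨PWL.eventually_symmetricLimitCycle hΛ hC,
      PWL.tendsto_norm_cyclePoint hΛ hC⟩,
    PWL.stabilityRegion, PWL.isOpen_stabilityRegion, ?_,
    fun C hC => PWL.eventually_mem_stabilityRegion hC,
    fun Λ hΛ => ⟨PWL.continuousOn_cyclePoint, fun C H hCH => ?_⟩⟩
  · intro Z hZ φ t₀ t₁ x₀ y₀ x₁ y₁ ht htraj h0 h1 hne
    have hp : ∀ x y : ℝ, (![x, y, 0] : PWL.R3) ∈ PWL.switchingPlane := fun x y => rfl
    rw [PWL.mem_crossingSymmetricPeriodicOrbit_iff hZ.equivariant ht htraj (h0 ▸ hp _ _)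
      (h1 ▸ hp _ _) hne, h0, h1]
    simp [PWL.invol]
  · exact PWL.classS_canonicalField H Λ (mul_ne_zero (by norm_num) hC)
  · obtain ⟨H, hH⟩ := (PWL.eventually_mem_stabilityRegion one_pos).exists
    exact ⟨_, hH⟩
  · obtain ⟨γ, hγ, hmem, hst⟩ := PWL.exists_stable_limitCycle hΛ hCH
    refine ⟨γ, hγ, ?_, hst⟩
    rwa [PWL.cyclePoint, if_pos hCH.1]
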